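/- Fix an integer $r\ge 2$. Consider the class of equations $$u_t+uu_x=\sum_{j=2}^r A^j(t,x)\,\partial_x^j u+A^0(t,x)\,u+B(t,x),\qquad A^r\neq 0,\qquad (1)$$ for a real function $u(t,x)$, parametrized by the tuple $\kappa=(A^0,A^2,\dots,A^r,B)$ of smooth real functions of $(t,x)$ with $A^r$ nowhere zero. (These are the general Burgers--Korteweg--de Vries equations $u_t+Cuu_x=\sum_{k=0}^rA^k\partial_x^ku+B$ gauged by $C=1$, $A^1=0$.) Below, a domain $V$ is a nonempty connected open set of the $(t,x,u)$-space all of whose sections $t=\mathrm{const}$ are connected; arbitrary elements are considered on the projection of the domain under consideration to the $(t,x)$-plane. A point transformation $\varphi$ is a diffeomorphism of a domain $V$ onto an open set of the $(t,x,u)$-space. It maps the equation (1) with tuple $\kappa$ to the one with tuple $\tilde\kappa$ if its prolongation to jets maps the jets satisfying the first equation to those satisfying the second (whenever the prolongation is defined); then $(\kappa,\tilde\kappa,\varphi)$ is called an admissible transformation. A usual equivalence transformation is a diffeomorphism $\mathcal T$ of $V\times\{\kappa : A^r\ne0\}$ onto an open set of the joint space of $(t,x,u,\kappa)$ that is projectable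 to a point transformation $\pi_*\mathcal T$ of $V$ and that, for every tuple $\kappa$ over $V$, maps the graph of $\kappa$ to the graph of a tuple $\mathcal T\kappa$ such that $\pi_*\mathcal T$ maps the equation with tuple $\kappa$ to the equation with tuple $\mathcal T\kappa$. All of these form the usual equivalence (pseudo)group $G^\sim$. The class (1) is normalized in the usual sense: the admissible transformations are exactly the triples $(\kappa,\mathcal T\kappa,\pi_*\mathcal T)$ with $\mathcal T\in G^\sim$ and $\kappa$ a tuple over the domain of $\mathcal T$. The group $G^\sim$ consists exactly of the transformations $$\tilde t=T(t),\quad \tilde x=X^1(t)x+X^0(t),\quad \tilde u=\frac{X^1}{T_t}u+\frac{X^1_t}{T_t}x+\frac{X^0_t}{T_t},$$ $$\tilde A^j=\frac{(X^1)^j}{T_t}A^j\ \ (j=2,\dots,r),\qquad \tilde A^0=\frac1{T_t}\Big(A^0+2\frac{X^1_t}{X^1}-\frac{T_{tt}}{T_t}\Big),$$ $$\tilde B=\frac{X^1}{(T_t)^2}B+\frac1{T_t}\Big(\frac{X^1_t}{T_t}\Big)_t x+\frac1{T_t}\Big(\frac{X^0_t}{T_t}\Big)_t-\Big(\frac{X^1_t}{T_t}x+\frac{X^0_t}{T_t}\Big)\tilde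 A^0,$$ on the sets $V\times\{\kappa : A^r\ne0\}$ with $V$ a domain, where $T$, $X^1$, $X^0$ are arbitrary smooth functions of $t$ on the set of values of $t$ occurring in $V$, with $T_tX^1\neq0$. (For every domain $V$ and all such $T$, $X^1$, $X^0$ these formulas do define an element of $G^\sim$.) -/

import Mathlib

open scoped ContDiff Topology

namespace BurgersKdV

/-- The space of the variables `(t, x, u)`. -/
abbrev Var : Type := ℝ × ℝ × ℝ

/-- The projection `(t, x, u) ↦ (t, x)`. -/
def base (z : Var) : ℝ × ℝ := (z.1, z.2.1)

/-- The space of values of the reduced arbitrary-element tuple `κ = (A⁰, (A², …, Aʳ), B)`. -/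
abbrev Kappa (r : ℕ) : Type := ℝ × (Finset.Icc 2 r → ℝ) × ℝ

/-- The part `Aʳ ≠ 0` of the space of arbitrary elements. -/
def regular (r : ℕ) : Set (Kappa r) :=
  {k | ∀ j : Finset.Icc 2 r, (j : ℕ) = r → k.2.1 j ≠ 0}

/-- `κ` is an admitted tuple of arbitrary elements on the set `Ω` of the `(t, x)`-plane:
`A⁰, A², …, Aʳ, B` are smooth functions of `(t, x)` on `Ω`, and `Aʳ` vanishes nowhere on `Ω`. -/
def IsArbitraryElement (r : ℕ) (Ω : Set (ℝ × ℝ)) (κ : ℝ × ℝ → Kappa r) : Prop :=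
  ContDiffOn ℝ ∞ κ Ω ∧ ∀ p ∈ Ω, κ p ∈ regular r

/-- At the point `p = (t, x)` the (jet of the) function `u` satisfies the equation
`u_t + u u_x = ∑_{j=2}^r Aʲ(t,x) ∂_x^j u + A⁰(t,x) u + B(t,x)` with coefficients `κ`. -/
def SatisfiesAt (r : ℕ) (κ : ℝ × ℝ → Kappa r) (u : ℝ × ℝ → ℝ) (p : ℝ × ℝ) : Prop :=
  deriv (fun s => u (s, p.2)) p.1 + u p * deriv (fun y => u (p.1, y)) p.2
    = (∑ j : Finset.Icc 2 r, (κ p).2.1 j * iteratedDeriv (j : ℕ) (fun y => u (p.1, y)) p.2)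
      + (κ p).1 * u p + (κ p).2.2

/-- A domain of the space of `(t, x, u)`: a nonempty connected open set
all of whose sections `t = const` are connected (possibly empty). -/
def IsDom (V : Set Var) : Prop :=
  IsOpen V ∧ IsConnected V ∧ ∀ t : ℝ, IsPreconnected {w : ℝ × ℝ | (t, w) ∈ V}

/-- The set of values of `t` occurring in `V`. -/
def times (V : Set Var) : Set ℝ := Prod.fst '' V

/-- `f` is a diffeomorphism between its source and its target. -/
def IsDiffeo {E : Type*} [NormedAddCommGroup E] [NormedSpace ℝ E]
    (f : OpenPartialHomeomorph E E) : Prop :=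
  ContDiffOn ℝ ∞ f f.source ∧ ContDiffOn ℝ ∞ f.symm f.target

/-- Point transformations of the space of `(t, x, u)`; nothing is presupposed
about the dependence of the new variables on the old ones. -/
def IsPointTransformation (φ : OpenPartialHomeomorph Var Var) : Prop :=
  IsDiffeo φ ∧ IsDom φ.source

/-- Near `p`, the map `φ` sends the graph of `u` into the graph of `v`, both functions being
smooth at the respective points. (As `φ` is a diffeomorphism, this determines the germ of `v`.) -/
def TransformsAt (φ : OpenPartialHomeomorph Var Var) (u v : ℝ × ℝ → ℝ) (p : ℝ × ℝ) : Prop :=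
  (p.1, p.2, u p) ∈ φ.source ∧ ContDiffAt ℝ ∞ u p ∧
    ContDiffAt ℝ ∞ v (base (φ (p.1, p.2, u p))) ∧
    ∀ᶠ q in 𝓝 p, v (base (φ (q.1, q.2, u q))) = (φ (q.1, q.2, u q)).2.2

/-- `φ` maps the equation with coefficients `κ` to the equation with coefficients `κ'`: the
prolongation of `φ` to jets maps the jets that satisfy the first equation to those that satisfy
the second one. Jets are represented by functions. -/
def MapsEquation (r : ℕ) (φ : OpenPartialHomeomorph Var Var) (κ κ' : ℝ × ℝ → Kappa r) : Prop :=
  ∀ (u v : ℝ × ℝ → ℝ) (p : ℝ × ℝ), TransformsAt φ u v p →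
    (SatisfiesAt r κ u p ↔ SatisfiesAt r κ' v (base (φ (p.1, p.2, u p))))

/-- The equivalence groupoid of the class: the admissible transformations `(κ, κ', φ)`. -/
def equivalenceGroupoid (r : ℕ) :
    Set ((ℝ × ℝ → Kappa r) × (ℝ × ℝ → Kappa r) × OpenPartialHomeomorph Var Var) :=
  {a | IsPointTransformation a.2.2 ∧
    IsArbitraryElement r (base '' a.2.2.source) a.1 ∧
    IsArbitraryElement r (base '' a.2.2.target) a.2.1 ∧
    MapsEquation r a.2.2 a.1 a.2.1}

/-- `Θ`, defined over all values of the arbitrary elements with `Aʳ ≠ 0`, is projectable to the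
space of `(t, x, u)`, with the projection `φ`. -/
def ProjectsTo (r : ℕ) (Θ : OpenPartialHomeomorph (Var × Kappa r) (Var × Kappa r))
    (φ : OpenPartialHomeomorph Var Var) : Prop :=
  Θ.source = φ.source ×ˢ regular r ∧ ∀ z ∈ Θ.source, (Θ z).1 = φ z.1

/-- `κ' = Θ κ`: the map `Θ`, which projects to `φ`, sends the graph of `κ` to that of `κ'`. -/
def Carries (r : ℕ) (Θ : OpenPartialHomeomorph (Var × Kappa r) (Var × Kappa r))
    (φ : OpenPartialHomeomorph Var Var) (κ κ' : ℝ × ℝ → Kappa r) : Prop :=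
  ∀ z ∈ φ.source, (Θ (z, κ (base z))).2 = κ' (base (φ z))

/-- The usual equivalence (pseudo)group of the class: the point transformations of the joint space
of `(t, x, u, κ)` that are projectable to the space of `(t, x, u)` and that map every
equation of the class to an equation of the class. -/
def usualEquivalenceGroup (r : ℕ) :
    Set (OpenPartialHomeomorph (Var × Kappa r) (Var × Kappa r)) :=
  {Θ | IsDiffeo Θ ∧ ∃ φ : OpenPartialHomeomorph Var Var,
    IsPointTransformation φ ∧ ProjectsTo r Θ φ ∧
    ∀ κ : ℝ × ℝ → Kappa r, IsArbitraryElement r (base '' φ.source) κ →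
      ∃ κ' : ℝ × ℝ → Kappa r, IsArbitraryElement r (base '' φ.target) κ' ∧
        Carries r Θ φ κ κ' ∧ MapsEquation r φ κ κ'}

/-- The family of triples `(κ, Θ κ, π_* Θ)` induced by the usual equivalence group. -/
def inducedSubgroupoid (r : ℕ) :
    Set ((ℝ × ℝ → Kappa r) × (ℝ × ℝ → Kappa r) × OpenPartialHomeomorph Var Var) :=
  {a | IsPointTransformation a.2.2 ∧ IsArbitraryElement r (base '' a.2.2.source) a.1 ∧
    ∃ Θ ∈ usualEquivalenceGroup r, ProjectsTo r Θ a.2.2 ∧ Carries r Θ a.2.2 a.1 a.2.1}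

/-- The class is normalized in the usual sense. -/
def IsNormalized (r : ℕ) : Prop := inducedSubgroupoid r = equivalenceGroupoid r

/-- The parameter functions `T`, `X¹`, `X⁰` are smooth on the set `I`, with `T_t X¹ ≠ 0` there. -/
def AreParameters (I : Set ℝ) (T X1 X0 : ℝ → ℝ) : Prop :=
  ContDiffOn ℝ ∞ T I ∧ ContDiffOn ℝ ∞ X1 I ∧ ContDiffOn ℝ ∞ X0 I ∧
    ∀ t ∈ I, deriv T t * X1 t ≠ 0

/-- The new value of `A⁰`. -/
noncomputable def newA0 (T X1 : ℝ → ℝ) (t a : ℝ) : ℝ :=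
  1 / deriv T t * (a + 2 * (deriv X1 t / X1 t) - deriv (deriv T) t / deriv T t)

/-- The explicit transformation of the joint space with parameter functions `T`, `X¹`, `X⁰`. -/
noncomputable def explicitMap (r : ℕ) (T X1 X0 : ℝ → ℝ) : Var × Kappa r → Var × Kappa r
  | ((t, x, u), (a, A, b)) =>
    ((T t, X1 t * x + X0 t,
        X1 t / deriv T t * u + deriv X1 t / deriv T t * x + deriv X0 t / deriv T t),
      (newA0 T X1 t a,
        fun j => X1 t ^ (j : ℕ) / deriv T t * A j,
        X1 t / deriv T t ^ 2 * b
          + 1 / deriv T t * deriv (fun s => deriv X1 s / deriv T s) t * x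
          + 1 / deriv T t * deriv (fun s => deriv X0 s / deriv T s) t
          - (deriv X1 t / deriv T t * x + deriv X0 t / deriv T t) * newA0 T X1 t a))

end BurgersKdV

/-! Write φ = (T, X, U). The prolongation formulas are never expanded; they are replaced by a
comparison principle (`TransformsAt.exists_isLittleO`). If u and u₁ agree at p and have images v and
v₁, then to leading order v - v₁ is a fixed nonzero multiple of u - u₁ pulled back by the inverse
change of variables. So if a family of functions satisfies the first equation at p, the
corresponding jets of the images can be compared and inserted into the second equation.

Suitable families give the determining relations one by one. Adding (t - t₀)^r leaves u_t and all
x-derivatives at p unchanged, but would alter the r-th derivative of the image if t varied along the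
lines of constant new t; hence T_x = T_u = 0 (`IsAdmissible.fst_fderiv`). Changing the coefficient
of (x - x₀)^r gives Aʳ (X_x + b X_u)^r = T_t Ãʳ whenever X_x + b X_u ≠ 0, with right-hand side
independent of b, so X_u = 0 (`IsAdmissible.snd_fderiv`). An alternating sum over four functions
isolates U_uu, which must vanish (`IsAdmissible.fderiv_fderiv_thd`). For the spatial parts a + e + b
(x - x₀) the resulting relation is polynomial in e and b: the coefficient of e b yields T_t U_u =
X_x, that of e² yields U_xu = 0 (`IsAdmissible.slope_relations`), and that of b, thanks to A¹ = 0,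
yields T_t U = X_x u + X_t (`IsAdmissible.thd_eq`). Thus T and X_x depend on t only and X is affine
in x; connectedness of the sections t = const makes this global (`IsAdmissible.exists_parameters`).

Conversely, the explicit point transformation with the explicit new coefficients multiplies the
defect of every function in the equation by X¹/T_t² (`defect_explicit`), so it maps equations to
equations. The jets over two values of u determine the coefficients, so an admissible transformation
has no other target than the explicit one (`IsAdmissible.eq_newKappa`). Finally, a joint
transformation Θ of the equivalence group is pinned down at each (z, k) by its action on the
constant tuple k, while T, X¹, X⁰ depend only on its projection (`exists_parameters_of_mem`). -/

namespace BurgersKdV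

open Asymptotics Filter

section

/-! ### Leading terms of functions of one variable -/

/-- `f x = m (x - x₀) ^ n + o((x - x₀) ^ n)` as `x → x₀`. -/
def HasLeading (f : ℝ → ℝ) (x₀ : ℝ) (n : ℕ) (m : ℝ) : Prop :=
  (fun x => f x - m * (x - x₀) ^ n) =o[𝓝 x₀] fun x => (x - x₀) ^ n

theorem HasLeading.congr {f g : ℝ → ℝ} {x₀ m : ℝ} {n : ℕ} (h : HasLeading f x₀ n m)
    (hfg : f =ᶠ[𝓝 x₀] g) : HasLeading g x₀ n m :=
  h.congr' (hfg.mono fun x hx => by simp only [hx]) EventuallyEq.rfl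

theorem HasLeading.add {f g : ℝ → ℝ} {x₀ m k : ℝ} {n : ℕ} (hf : HasLeading f x₀ n m)
    (hg : HasLeading g x₀ n k) : HasLeading (fun x => f x + g x) x₀ n (m + k) :=
  (IsLittleO.add hf hg).congr_left fun x => by ring

theorem HasLeading.const_mul {f : ℝ → ℝ} {x₀ m : ℝ} {n : ℕ} (c : ℝ) (hf : HasLeading f x₀ n m) :
    HasLeading (fun x => c * f x) x₀ n (c * m) :=
  (IsLittleO.const_mul_left hf c).congr_left fun x => by ring

theorem HasLeading.isBigO {f : ℝ → ℝ} {x₀ m : ℝ} {n : ℕ} (hf : HasLeading f x₀ n m) :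
    f =O[𝓝 x₀] fun x => (x - x₀) ^ n :=
  ((IsLittleO.isBigO hf).add (isBigO_const_mul_self m (fun x => (x - x₀) ^ n) (𝓝 x₀))).congr_left
    fun x => by ring

theorem HasLeading.of_isLittleO {f g : ℝ → ℝ} {x₀ m : ℝ} {n : ℕ} (hf : HasLeading f x₀ n m)
    (hg : (fun x => g x - f x) =o[𝓝 x₀] f) : HasLeading g x₀ n m :=
  ((hg.trans_isBigO hf.isBigO).add hf).congr_left fun x => by ring

theorem HasLeading.of_lt {f : ℝ → ℝ} {x₀ m : ℝ} {n k : ℕ} (hf : HasLeading f x₀ n m)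
    (hk : k < n) : HasLeading f x₀ k 0 := by
  have h : (fun x : ℝ => (x - x₀) ^ n) =o[𝓝 x₀] fun x => (x - x₀) ^ k := by
    have := isLittleO_pow_pow (𝕜 := ℝ) hk
    have ht : Tendsto (fun x : ℝ => x - x₀) (𝓝 x₀) (𝓝 0) := by
      simpa using (tendsto_id (α := ℝ) (x := 𝓝 x₀)).sub_const x₀
    exact this.comp_tendsto ht
  exact (hf.isBigO.trans_isLittleO h).congr_left fun x => by ring

theorem hasLeading_of_hasDerivAt {f : ℝ → ℝ} {x₀ m : ℝ} (hf : HasDerivAt f m x₀)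
    (h0 : f x₀ = 0) : HasLeading f x₀ 1 m := by
  have := hasDerivAt_iff_isLittleO.1 hf
  refine (this.congr_left fun x => ?_).congr_right fun x => ?_
  · simp only [h0, smul_eq_mul]; ring
  · simp

theorem HasLeading.pow {f : ℝ → ℝ} {x₀ m : ℝ} (hf : HasLeading f x₀ 1 m) (n : ℕ) :
    HasLeading (fun x => f x ^ n) x₀ n (m ^ n) := by
  induction n with
  | zero => simp [HasLeading]
  | succ n ih =>
    have h1 := IsLittleO.mul_isBigO ih hf.isBigO
    have h2 := (isBigO_const_mul_self (m ^ n) (fun x => (x - x₀) ^ n) (𝓝 x₀)).mul_isLittleO hf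
    refine ((h1.add h2).congr_left fun x => ?_).congr_right fun x => ?_
    · ring
    · ring

/-- A nonzero strict derivative makes χ carry 𝓝 x₀ onto 𝓝 (χ x₀), so the estimate may be tested
after substitution, where (χ x - χ x₀)^n is equivalent to c^n (x - x₀)^n. -/
theorem HasLeading.of_comp {f χ : ℝ → ℝ} {x₀ m c : ℝ} {n : ℕ} (hχ : HasStrictDerivAt χ c x₀)
    (hc : c ≠ 0) (h : HasLeading (fun x => f (χ x)) x₀ n m) :
    HasLeading f (χ x₀) n (m / c ^ n) := by
  unfold HasLeading
  rw [← hχ.map_nhds_eq hc, isLittleO_map]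
  have h1 : HasLeading (fun x => χ x - χ x₀) x₀ 1 c :=
    hasLeading_of_hasDerivAt (hχ.hasDerivAt.sub_const _) (by simp)
  have h2 := h1.pow n
  have h3 : HasLeading (fun x => f (χ x) + -(m / c ^ n) * (χ x - χ x₀) ^ n) x₀ n
      (m + -(m / c ^ n) * c ^ n) := h.add (h2.const_mul _)
  have h4 : m + -(m / c ^ n) * c ^ n = 0 := by
    field_simp; ring
  rw [h4] at h3
  have h5 : (fun x => f (χ x) + -(m / c ^ n) * (χ x - χ x₀) ^ n) =o[𝓝 x₀]
      fun x => (x - x₀) ^ n := h3.congr_left fun x => by ring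
  have h6 : (fun x : ℝ => (x - x₀) ^ n) =O[𝓝 x₀] fun x => (χ x - χ x₀) ^ n := by
    have hcn : c ^ n ≠ 0 := pow_ne_zero _ hc
    have h7 : (fun x => (χ x - χ x₀) ^ n - c ^ n * (x - x₀) ^ n) =o[𝓝 x₀]
        fun x => c ^ n * (x - x₀) ^ n := IsLittleO.const_mul_right hcn h2
    have h8 : (fun x => (χ x - χ x₀) ^ n) ~[𝓝 x₀] fun x => c ^ n * (x - x₀) ^ n := h7
    exact (isBigO_self_const_mul hcn (fun x : ℝ => (x - x₀) ^ n) (𝓝 x₀)).trans h8.isBigO_symm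
  exact (h5.trans_isBigO h6).congr_left fun x => by simp only [Function.comp]; ring

/-- Induction on the order: once the lower derivatives vanish, the Taylor polynomial of degree j is
a single monomial, and a nonzero multiple of (x - x₀)^j is not o((x - x₀)^j). -/
theorem iteratedDeriv_eq_zero_of_isLittleO {f : ℝ → ℝ} {x₀ : ℝ} {n : ℕ}
    (hf : ContDiffAt ℝ n f x₀) (h : f =o[𝓝 x₀] fun x => (x - x₀) ^ n) :
    ∀ j ≤ n, iteratedDeriv j f x₀ = 0 := by
  intro j
  induction j using Nat.strong_induction_on with
  | _ j ih =>
  intro hj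
  obtain ⟨u, hu, hfu⟩ := (hf.of_le (Nat.cast_le.2 hj)).contDiffOn le_rfl (by simp)
  obtain ⟨ε, hε, hball⟩ := Metric.mem_nhds_iff.1 hu
  have hx : x₀ ∈ Metric.ball x₀ ε := Metric.mem_ball_self hε
  have ht := taylor_isLittleO (convex_ball x₀ ε) hx (hfu.mono hball)
  rw [Metric.isOpen_ball.nhdsWithin_eq hx] at ht
  have hfj : f =o[𝓝 x₀] fun x => (x - x₀) ^ j := by
    rcases hj.eq_or_lt with rfl | hlt
    · exact h
    · have h0 : HasLeading f x₀ n 0 := h.congr_left fun x => by ring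
      exact (h0.of_lt hlt).congr_left fun x => by ring
  have hd := hfj.sub ht
  have he : (fun x => f x - (f x - taylorWithinEval f j (Metric.ball x₀ ε) x₀ x)) =
      fun x => ((j.factorial : ℝ)⁻¹ * iteratedDeriv j f x₀) * (x - x₀) ^ j := by
    funext x
    rw [taylor_within_apply, Finset.sum_range_succ, Finset.sum_eq_zero]
    · rw [iteratedDerivWithin_of_isOpen Metric.isOpen_ball hx, smul_eq_mul]; ring
    · intro k hk
      have hk' := Finset.mem_range.1 hk
      rw [iteratedDerivWithin_of_isOpen Metric.isOpen_ball hx, ih k hk' (by omega), smul_zero]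
  rw [he] at hd
  by_contra hne
  have hc : (j.factorial : ℝ)⁻¹ * iteratedDeriv j f x₀ ≠ 0 :=
    mul_ne_zero (inv_ne_zero (by positivity)) hne
  have hs := (isLittleO_const_mul_left_iff hc).1 hd
  have hfr : ∃ᶠ x in 𝓝 x₀, (x - x₀) ^ j ≠ 0 := by
    have : ∃ᶠ x in 𝓝[≠] x₀, True := by simp [frequently_true_iff_neBot]; infer_instance
    exact (frequently_nhdsWithin_iff.1 this).mono fun x hx => pow_ne_zero _ (sub_ne_zero.2 hx.2)
  exact isLittleO_irrefl hfr hs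

theorem iteratedDeriv_sub_pow_self (x₀ : ℝ) (n j : ℕ) :
    iteratedDeriv j (fun x : ℝ => (x - x₀) ^ n) x₀ = if j = n then (n.factorial : ℝ) else 0 := by
  have h := congrFun (iteratedDeriv_comp_sub_const j (fun x : ℝ => x ^ n) x₀) x₀
  rw [h]
  simp only [sub_self]
  rw [iteratedDeriv_fun_pow_zero]; split_ifs <;> simp

theorem HasLeading.iteratedDeriv_eq {f : ℝ → ℝ} {x₀ m : ℝ} {n : ℕ} (h : HasLeading f x₀ n m)
    (hf : ContDiffAt ℝ n f x₀) {j : ℕ} (hj : j ≤ n) :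
    iteratedDeriv j f x₀ = if j = n then (n.factorial : ℝ) * m else 0 := by
  have hp : ContDiffAt ℝ n (fun x : ℝ => m * (x - x₀) ^ n) x₀ := by fun_prop
  have h0 := iteratedDeriv_eq_zero_of_isLittleO (hf.sub hp) h j hj
  have hjn : (j : WithTop ℕ∞) ≤ n := Nat.cast_le.2 hj
  have h1 := iteratedDeriv_sub (hf.of_le hjn) (hp.of_le hjn)
  have h2 : iteratedDeriv j (fun x : ℝ => m * (x - x₀) ^ n) x₀ =
      m * iteratedDeriv j (fun x : ℝ => (x - x₀) ^ n) x₀ :=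
    iteratedDeriv_const_mul m (by fun_prop)
  have h3 : iteratedDeriv j f x₀ - iteratedDeriv j (fun x : ℝ => m * (x - x₀) ^ n) x₀ = 0 := by
    rw [← h1]; exact h0
  rw [h2, iteratedDeriv_sub_pow_self] at h3
  split_ifs at h3 ⊢ with hjn
  · linarith
  · linarith

theorem iteratedDeriv_comp_affine (f : ℝ → ℝ) (c d : ℝ) (j : ℕ) (y : ℝ) :
    iteratedDeriv j (fun x => f (c * x + d)) y = c ^ j * iteratedDeriv j f (c * y + d) := by
  induction j generalizing y with
  | zero => simp
  | succ j ih =>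
    have : iteratedDeriv j (fun x => f (c * x + d)) =
        fun y => c ^ j * iteratedDeriv j f (c * y + d) := funext ih
    rw [iteratedDeriv_succ, this, iteratedDeriv_succ, deriv_const_mul_field]
    have h1 := deriv_comp_mul_left c (fun x => iteratedDeriv j f (x + d)) y
    rw [h1, deriv_comp_add_const, smul_eq_mul]
    ring

end

section

/-! ### Prolongation of point transformations -/

/-- The projection `(t, x, u) ↦ (t, x)` as a continuous linear map. -/
noncomputable def baseL : Var →L[ℝ] ℝ × ℝ :=
  (ContinuousLinearMap.fst ℝ ℝ (ℝ × ℝ)).prod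
    ((ContinuousLinearMap.fst ℝ ℝ ℝ).comp (ContinuousLinearMap.snd ℝ ℝ (ℝ × ℝ)))

@[simp] theorem baseL_apply (z : Var) : baseL z = base z := rfl

/-- The parametrization of the graph of `u`. -/
def graph (u : ℝ × ℝ → ℝ) (q : ℝ × ℝ) : Var := (q.1, q.2, u q)

/-- The tangent vector of the graph of `u` over `p` in the direction `η`. -/
noncomputable def tangent (u : ℝ × ℝ → ℝ) (p η : ℝ × ℝ) : Var := (η.1, η.2, fderiv ℝ u p η)

theorem base_graph (u : ℝ × ℝ → ℝ) (q : ℝ × ℝ) : base (graph u q) = q := rfl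

theorem graph_base {u : ℝ × ℝ → ℝ} {z : Var} (h : u (base z) = z.2.2) : graph u (base z) = z := by
  obtain ⟨t, x, w⟩ := z
  simp only [graph, base] at h ⊢
  rw [h]

theorem contDiffAt_graph {u : ℝ × ℝ → ℝ} {p : ℝ × ℝ} {n : WithTop ℕ∞} (hu : ContDiffAt ℝ n u p) :
    ContDiffAt ℝ n (graph u) p :=
  contDiffAt_fst.prodMk (contDiffAt_snd.prodMk hu)

theorem hasFDerivAt_graph {u : ℝ × ℝ → ℝ} {p : ℝ × ℝ} (hu : DifferentiableAt ℝ u p) :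
    HasFDerivAt (graph u) ((ContinuousLinearMap.fst ℝ ℝ ℝ).prod
      ((ContinuousLinearMap.snd ℝ ℝ ℝ).prod (fderiv ℝ u p))) p :=
  hasFDerivAt_fst.prodMk (hasFDerivAt_snd.prodMk hu.hasFDerivAt)

theorem IsDiffeo.symm {E : Type*} [NormedAddCommGroup E] [NormedSpace ℝ E]
    {f : OpenPartialHomeomorph E E} (hf : IsDiffeo f) : IsDiffeo f.symm :=
  ⟨hf.2, by simpa using hf.1⟩

section Diffeo

variable {E : Type*} [NormedAddCommGroup E] [NormedSpace ℝ E]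

theorem IsDiffeo.contDiffAt {f : OpenPartialHomeomorph E E} (hf : IsDiffeo f) {z : E}
    (hz : z ∈ f.source) : ContDiffAt ℝ ∞ f z :=
  (hf.1 z hz).contDiffAt (f.open_source.mem_nhds hz)

theorem IsDiffeo.differentiableAt {f : OpenPartialHomeomorph E E} (hf : IsDiffeo f) {z : E}
    (hz : z ∈ f.source) : DifferentiableAt ℝ f z :=
  (hf.contDiffAt hz).differentiableAt (by simp)

theorem IsDiffeo.fderiv_symm_fderiv {f : OpenPartialHomeomorph E E} (hf : IsDiffeo f) {z : E}
    (hz : z ∈ f.source) (w : E) : fderiv ℝ f.symm (f z) (fderiv ℝ f z w) = w := by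
  have h1 := (hf.symm.differentiableAt (f.map_source hz)).hasFDerivAt.comp z
    (hf.differentiableAt hz).hasFDerivAt
  have h2 : HasFDerivAt (f.symm ∘ f) (ContinuousLinearMap.id ℝ E) z :=
    (hasFDerivAt_id z).congr_of_eventuallyEq (f.eventually_left_inverse hz)
  exact DFunLike.congr_fun (h1.unique h2) w

theorem IsDiffeo.fderiv_fderiv_symm {f : OpenPartialHomeomorph E E} (hf : IsDiffeo f) {z : E}
    (hz : z ∈ f.source) (w : E) : fderiv ℝ f z (fderiv ℝ f.symm (f z) w) = w := by
  have := hf.symm.fderiv_symm_fderiv (f.map_source hz) w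
  simpa [f.left_inv hz] using this

theorem IsDiffeo.eq_zero_of_fderiv {f : OpenPartialHomeomorph E E} (hf : IsDiffeo f) {z : E}
    (hz : z ∈ f.source) {w : E} (h : fderiv ℝ f z w = 0) : w = 0 := by
  rw [← hf.fderiv_symm_fderiv hz w, h, map_zero]

end Diffeo

theorem exists_equiv_of_injective (L : ℝ × ℝ →L[ℝ] ℝ × ℝ) (h : ∀ η, L η = 0 → η = 0) :
    ∃ e : (ℝ × ℝ) ≃L[ℝ] (ℝ × ℝ), (e : ℝ × ℝ →L[ℝ] ℝ × ℝ) = L := by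
  have hinj : Function.Injective (L : ℝ × ℝ →ₗ[ℝ] ℝ × ℝ) :=
    (injective_iff_map_eq_zero _).2 h
  refine ⟨(LinearEquiv.ofInjectiveEndo _ hinj).toContinuousLinearEquiv, ?_⟩
  ext <;> rfl

variable {r : ℕ} {φ : OpenPartialHomeomorph Var Var} {u v : ℝ × ℝ → ℝ} {p : ℝ × ℝ}

theorem contDiffAt_base_comp_graph (hφ : IsDiffeo φ) (hz : graph u p ∈ φ.source)
    (hu : ContDiffAt ℝ ∞ u p) : ContDiffAt ℝ ∞ (fun q => base (φ (graph u q))) p :=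
  baseL.contDiff.contDiffAt.comp p ((hφ.contDiffAt hz).comp p (contDiffAt_graph hu))

theorem fderiv_comp_graph_apply (hφ : IsDiffeo φ) (hz : graph u p ∈ φ.source)
    (hu : ContDiffAt ℝ ∞ u p) (η : ℝ × ℝ) :
    fderiv ℝ (fun q => φ (graph u q)) p η = fderiv ℝ φ (graph u p) (tangent u p η) := by
  have hu' : DifferentiableAt ℝ u p := hu.differentiableAt (by simp)
  have := (hφ.differentiableAt hz).hasFDerivAt.comp p (hasFDerivAt_graph hu')
  rw [show (fun q => φ (graph u q)) = φ ∘ graph u from rfl, this.fderiv]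
  rfl

theorem fderiv_base_comp_graph_apply (hφ : IsDiffeo φ) (hz : graph u p ∈ φ.source)
    (hu : ContDiffAt ℝ ∞ u p) (η : ℝ × ℝ) :
    fderiv ℝ (fun q => base (φ (graph u q))) p η =
      base (fderiv ℝ φ (graph u p) (tangent u p η)) := by
  rw [← fderiv_comp_graph_apply hφ hz hu]
  have h : DifferentiableAt ℝ (fun q => φ (graph u q)) p :=
    ((hφ.contDiffAt hz).comp p (contDiffAt_graph hu)).differentiableAt (by simp)
  have := baseL.hasFDerivAt.comp p h.hasFDerivAt
  rw [show (fun q => base (φ (graph u q))) = baseL ∘ fun q => φ (graph u q) from rfl, this.fderiv]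
  rfl

theorem TransformsAt.mem (h : TransformsAt φ u v p) : graph u p ∈ φ.source := h.1

theorem TransformsAt.eventually_eq_graph (h : TransformsAt φ u v p) :
    ∀ᶠ q in 𝓝 p, φ (graph u q) = graph v (base (φ (graph u q))) :=
  h.2.2.2.mono fun _ hq => (graph_base hq).symm

theorem TransformsAt.eq_graph (h : TransformsAt φ u v p) :
    φ (graph u p) = graph v (base (φ (graph u p))) := h.eventually_eq_graph.self_of_nhds

theorem TransformsAt.fderiv_eq (h : TransformsAt φ u v p) (hφ : IsDiffeo φ) (η : ℝ × ℝ) :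
    fderiv ℝ v (base (φ (graph u p))) (base (fderiv ℝ φ (graph u p) (tangent u p η))) =
      (fderiv ℝ φ (graph u p) (tangent u p η)).2.2 := by
  have h1 : DifferentiableAt ℝ (fun q => base (φ (graph u q))) p :=
    (contDiffAt_base_comp_graph hφ h.mem h.2.1).differentiableAt (by simp)
  have h2 : DifferentiableAt ℝ (fun q => φ (graph u q)) p :=
    ((hφ.contDiffAt h.mem).comp p (contDiffAt_graph h.2.1)).differentiableAt (by simp)
  have hv : DifferentiableAt ℝ v (base (φ (graph u p))) := h.2.2.1.differentiableAt (by simp)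
  have h3 := hv.hasFDerivAt.comp p h1.hasFDerivAt
  have h4 := ((ContinuousLinearMap.snd ℝ ℝ ℝ).comp
    (ContinuousLinearMap.snd ℝ ℝ (ℝ × ℝ))).hasFDerivAt.comp p h2.hasFDerivAt
  have h5 := h4.congr_of_eventuallyEq (f₁ := v ∘ fun q => base (φ (graph u q))) h.2.2.2
  have h6 := DFunLike.congr_fun (h3.unique h5) η
  rw [← fderiv_comp_graph_apply hφ h.mem h.2.1]
  simp only [ContinuousLinearMap.comp_apply, fderiv_base_comp_graph_apply hφ h.mem h.2.1] at h6
  rw [← fderiv_comp_graph_apply hφ h.mem h.2.1] at h6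
  exact h6

/-- The differential of φ maps the tangent plane of the graph of u into that of the graph of v,
which contains no nonzero vertical vector; injectivity of the differential does the rest. -/
theorem TransformsAt.eq_zero_of_base (h : TransformsAt φ u v p) (hφ : IsDiffeo φ) {η : ℝ × ℝ}
    (hη : base (fderiv ℝ φ (graph u p) (tangent u p η)) = 0) : η = 0 := by
  have h1 := h.fderiv_eq hφ η
  rw [hη, map_zero] at h1
  have h2 : fderiv ℝ φ (graph u p) (tangent u p η) = 0 := by
    have ha := congrArg Prod.fst hη
    have hb := congrArg Prod.snd hη
    exact Prod.ext ha (Prod.ext hb h1.symm)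
  have h3 := hφ.eq_zero_of_fderiv h.mem h2
  exact Prod.ext (congrArg (fun z : Var => z.1) h3) (congrArg (fun z : Var => z.2.1) h3)

theorem TransformsAt.map_nhds_eq (h : TransformsAt φ u v p) (hφ : IsDiffeo φ) :
    map (fun q => base (φ (graph u q))) (𝓝 p) = 𝓝 (base (φ (graph u p))) := by
  obtain ⟨e, he⟩ := exists_equiv_of_injective (fderiv ℝ (fun q => base (φ (graph u q))) p)
    fun η hη => h.eq_zero_of_base hφ (by rwa [fderiv_base_comp_graph_apply hφ h.mem h.2.1] at hη)
  have hs := (contDiffAt_base_comp_graph hφ h.mem h.2.1).hasStrictFDerivAt (by simp)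
  rw [← he] at hs
  exact hs.map_nhds_eq_of_equiv

theorem TransformsAt.symm (h : TransformsAt φ u v p) (hφ : IsDiffeo φ) :
    TransformsAt φ.symm v u (base (φ (graph u p))) ∧
      base (φ.symm (graph v (base (φ (graph u p))))) = p := by
  have hb : base (φ.symm (graph v (base (φ (graph u p))))) = p := by
    rw [← h.eq_graph, φ.left_inv h.mem, base_graph]
  refine ⟨⟨?_, h.2.2.1, ?_, ?_⟩, hb⟩
  · change graph v (base (φ (graph u p))) ∈ φ.target
    rw [← h.eq_graph]
    exact φ.map_source h.mem
  · change ContDiffAt ℝ ∞ u (base (φ.symm (graph v (base (φ (graph u p))))))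
    rw [hb]; exact h.2.1
  · change ∀ᶠ q in 𝓝 (base (φ (graph u p))), u (base (φ.symm (graph v q))) =
      (φ.symm (graph v q)).2.2
    rw [← h.map_nhds_eq hφ, eventually_map]
    have hs : ∀ᶠ q in 𝓝 p, graph u q ∈ φ.source :=
      (contDiffAt_graph h.2.1).continuousAt (φ.open_source.mem_nhds h.mem)
    filter_upwards [h.eventually_eq_graph, hs] with q hq hq'
    rw [← hq, φ.left_inv hq']
    rfl

theorem TransformsAt.eventually_symm_eq_graph (h : TransformsAt φ u v p) (hφ : IsDiffeo φ) :
    ∀ᶠ q in 𝓝 (base (φ (graph u p))),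
      φ.symm (graph v q) = graph u (base (φ.symm (graph v q))) ∧
      φ (graph u (base (φ.symm (graph v q)))) = graph v q := by
  have h1 := (h.symm hφ).1
  have hs : ∀ᶠ q in 𝓝 (base (φ (graph u p))), graph v q ∈ φ.target :=
    (contDiffAt_graph h1.2.1).continuousAt (φ.open_target.mem_nhds h1.mem)
  filter_upwards [h1.eventually_eq_graph, hs] with q hq hq'
  exact ⟨hq, by rw [← hq, φ.right_inv hq']⟩

/-- The hypothesis `hinj` says that the image of the tangent plane is transversal to the vertical
direction. The inverse function theorem then makes the image of the graph a graph near the image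
point. -/
theorem exists_transformsAt (hφ : IsDiffeo φ) (hz : graph u p ∈ φ.source)
    (hu : ContDiffAt ℝ ∞ u p)
    (hinj : ∀ η, base (fderiv ℝ φ (graph u p) (tangent u p η)) = 0 → η = 0) :
    ∃ v, TransformsAt φ u v p := by
  set g : ℝ × ℝ → ℝ × ℝ := fun q => base (φ (graph u q)) with hg
  have hgs : ContDiffAt ℝ ∞ g p := contDiffAt_base_comp_graph hφ hz hu
  obtain ⟨e, he⟩ := exists_equiv_of_injective (fderiv ℝ g p)
    fun η hη => hinj η (by rwa [fderiv_base_comp_graph_apply hφ hz hu] at hη)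
  have hd : HasFDerivAt g (e : ℝ × ℝ →L[ℝ] ℝ × ℝ) p := by
    rw [he]; exact (hgs.differentiableAt (by simp)).hasFDerivAt
  have hne : (∞ : WithTop ℕ∞) ≠ 0 := by simp
  have hk := hgs.to_localInverse hd hne
  set k := hgs.localInverse hd hne with hkdef
  have hkp : k (g p) = p := hgs.localInverse_apply_image hd hne
  have hkg : ∀ᶠ q in 𝓝 p, k (g q) = q :=
    (hgs.toOpenPartialHomeomorph g hd hne).eventually_left_inverse
      (hgs.mem_toOpenPartialHomeomorph_source hd hne)
  refine ⟨fun q => (φ (graph u (k q))).2.2, hz, hu, ?_, ?_⟩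
  · change ContDiffAt ℝ ∞ (fun q => (φ (graph u (k q))).2.2) (g p)
    have h1 : ContDiffAt ℝ ∞ (fun q => φ (graph u q)) (k (g p)) := by
      rw [hkp]; exact (hφ.contDiffAt hz).comp p (contDiffAt_graph hu)
    exact contDiff_snd.contDiffAt.comp _ (contDiff_snd.contDiffAt.comp _ (h1.comp (g p) hk))
  · filter_upwards [hkg] with q hq
    change (φ (graph u (k (g q)))).2.2 = (φ (graph u q)).2.2
    rw [hq]

/-- Chain rule for the change of base variables composed with its local inverse. It expresses the
derivatives of the old variables along the new coordinate lines through the differential of φ. -/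
theorem TransformsAt.fderiv_symm_eq (h : TransformsAt φ u v p) (hφ : IsDiffeo φ) (η : ℝ × ℝ) :
    base (fderiv ℝ φ (graph u p) (tangent u p
      (fderiv ℝ (fun q => base (φ.symm (graph v q))) (base (φ (graph u p))) η))) = η := by
  obtain ⟨h1, hb⟩ := h.symm hφ
  have hd : DifferentiableAt ℝ (fun q => base (φ.symm (graph v q))) (base (φ (graph u p))) :=
    (contDiffAt_base_comp_graph hφ.symm h1.mem h1.2.1).differentiableAt (by simp)
  have hg : DifferentiableAt ℝ (fun q => base (φ (graph u q)))
      (base (φ.symm (graph v (base (φ (graph u p)))))) := by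
    rw [hb]
    exact (contDiffAt_base_comp_graph hφ h.mem h.2.1).differentiableAt (by simp)
  have hc := HasFDerivAt.comp (g := fun q => base (φ (graph u q)))
    (f := fun q => base (φ.symm (graph v q))) (base (φ (graph u p))) hg.hasFDerivAt hd.hasFDerivAt
  have hi : HasFDerivAt ((fun q => base (φ (graph u q))) ∘ fun q => base (φ.symm (graph v q)))
      (ContinuousLinearMap.id ℝ (ℝ × ℝ)) (base (φ (graph u p))) := by
    refine (hasFDerivAt_id _).congr_of_eventuallyEq ?_
    filter_upwards [h.eventually_symm_eq_graph hφ] with q hq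
    simp only [Function.comp, hq.2, base_graph, id]
  have := DFunLike.congr_fun (hc.unique hi) η
  rw [hb] at this
  simp only [ContinuousLinearMap.comp_apply, fderiv_base_comp_graph_apply hφ h.mem h.2.1] at this
  exact this

/-- Comparison of two functions with the same value at `p`: the difference of their images is,
to leading order, proportional to their difference. -/
theorem TransformsAt.exists_isLittleO {u₁ v₁ : ℝ × ℝ → ℝ} (h₁ : TransformsAt φ u₁ v₁ p)
    (h : TransformsAt φ u v p) (hφ : IsDiffeo φ) (huu : u p = u₁ p) :
    ∃ c : ℝ, c ≠ 0 ∧ (fun q => v q - v₁ q - c * (u (base (φ.symm (graph v q))) -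
        u₁ (base (φ.symm (graph v q))))) =o[𝓝 (base (φ (graph u p)))]
      fun q => u (base (φ.symm (graph v q))) - u₁ (base (φ.symm (graph v q))) := by
  have hgr : graph u₁ p = graph u p := by simp [graph, huu]
  set z := graph u p with hz
  -- Ψ is a defining function of the graph of u₁, obtained by pulling back that of the graph of v₁.
  -- On the graph of u it equals v - v₁ at the image point, so it suffices to expand Ψ in the
  -- vertical direction; the constant c is its u-derivative.
  set Ψ : Var → ℝ := fun y => (φ y).2.2 - v₁ (base (φ y)) with hΨ
  have hv₁ : ContDiffAt ℝ ∞ v₁ (base (φ z)) := by rw [← hgr]; exact h₁.2.2.1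
  have hφz := hφ.contDiffAt h.mem
  have hΨs : ContDiffAt ℝ ∞ Ψ z :=
    (contDiff_snd.contDiffAt.comp _ (contDiff_snd.contDiffAt.comp _ hφz)).sub
      (hv₁.comp z (baseL.contDiff.contDiffAt.comp z hφz))
  have hΨstrict := hΨs.hasStrictFDerivAt (by simp)
  have hΨ' : ∀ w, fderiv ℝ Ψ z w = (fderiv ℝ φ z w).2.2 -
      fderiv ℝ v₁ (base (φ z)) (base (fderiv ℝ φ z w)) := by
    intro w
    have hd := (hφ.differentiableAt h.mem).hasFDerivAt
    have ha := ((ContinuousLinearMap.snd ℝ ℝ ℝ).comp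
      (ContinuousLinearMap.snd ℝ ℝ (ℝ × ℝ))).hasFDerivAt.comp z hd
    have hb := (hv₁.differentiableAt (by simp)).hasFDerivAt.comp z (baseL.hasFDerivAt.comp z hd)
    have := (ha.sub hb).fderiv
    have he : Ψ = (⇑((ContinuousLinearMap.snd ℝ ℝ ℝ).comp
      (ContinuousLinearMap.snd ℝ ℝ (ℝ × ℝ))) ∘ φ - v₁ ∘ ⇑baseL ∘ φ) := rfl
    rw [he, this]
    rfl
  have hΨ0 : ∀ᶠ q in 𝓝 p, Ψ (graph u₁ q) = 0 :=
    h₁.2.2.2.mono fun q hq => sub_eq_zero.2 hq.symm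
  refine ⟨fderiv ℝ Ψ z (0, 0, 1), ?_, ?_⟩
  -- If the vertical derivative vanished, the differential of Ψ would vanish altogether, since it
  -- also kills the tangent plane of the graph of u₁. But it equals 1 on the preimage of the new
  -- vertical direction.
  · intro hc
    have htan : ∀ η, fderiv ℝ Ψ z (tangent u₁ p η) = 0 := by
      intro η
      have := h₁.fderiv_eq hφ η
      rw [hgr] at this
      rw [hΨ', this, sub_self]
    have hall : ∀ w, fderiv ℝ Ψ z w = 0 := by
      intro w
      have hw : w = tangent u₁ p (base w) + (w.2.2 - fderiv ℝ u₁ p (base w)) • ((0, 0, 1) : Var) := by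
        obtain ⟨a, b, c⟩ := w
        simp [tangent, base]
      rw [hw, map_add, map_smul, htan, hc, smul_zero, add_zero]
    have h1 := hΨ' (fderiv ℝ φ.symm (φ z) (0, 0, 1))
    rw [hall, hφ.fderiv_fderiv_symm h.mem] at h1
    have h2 : base ((0, 0, 1) : Var) = 0 := rfl
    rw [h2, map_zero] at h1
    simp at h1
  · obtain ⟨hsym, hb⟩ := h.symm hφ
    rw [← hz] at hsym hb
    have hk : Tendsto (fun q => base (φ.symm (graph v q))) (𝓝 (base (φ z))) (𝓝 p) := by
      have := (contDiffAt_base_comp_graph hφ.symm hsym.mem hsym.2.1).continuousAt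
      unfold ContinuousAt at this
      exact hb ▸ this
    have ht : Tendsto (fun q => (graph u q, graph u₁ q)) (𝓝 p) (𝓝 (z, z)) := by
      have t1 := (contDiffAt_graph h.2.1).continuousAt
      have t2 := (contDiffAt_graph h₁.2.1).continuousAt
      unfold ContinuousAt at t1 t2
      rw [hgr] at t2
      exact t1.prodMk_nhds t2
    -- Strict differentiability is essential: both points move, and the error must be small relative
    -- to u - u₁, not merely relative to the distance from p.
    have ho := hΨstrict.isLittleO.comp_tendsto ht
    have hdiff : ∀ q, graph u q - graph u₁ q = (u q - u₁ q) • ((0, 0, 1) : Var) := by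
      intro q; simp [graph]
    have ho' : (fun q => Ψ (graph u q) - fderiv ℝ Ψ z (0, 0, 1) * (u q - u₁ q)) =o[𝓝 p]
        fun q => u q - u₁ q := by
      refine (ho.congr' ?_ EventuallyEq.rfl).trans_isBigO ?_
      · filter_upwards [hΨ0] with q hq
        simp only [Function.comp, hq, hdiff, map_smul, smul_eq_mul]
        ring
      · refine IsBigO.of_bound 1 (Eventually.of_forall fun q => ?_)
        simp only [Function.comp, hdiff, norm_smul]
        simp [Prod.norm_def]
    refine (ho'.comp_tendsto hk).congr' ?_ EventuallyEq.rfl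
    filter_upwards [h.eventually_symm_eq_graph hφ] with q hq
    simp only [Function.comp, hΨ, hq.2]
    rfl

end

section

/-! ### Jets and the equation -/

/-- The derivatives of `u` with respect to `x` at `p`. -/
noncomputable def xjet (u : ℝ × ℝ → ℝ) (p : ℝ × ℝ) (j : ℕ) : ℝ :=
  iteratedDeriv j (fun y => u (p.1, y)) p.2

/-- The derivative of `u` with respect to `t` at `p`. -/
noncomputable def tderiv (u : ℝ × ℝ → ℝ) (p : ℝ × ℝ) : ℝ := deriv (fun s => u (s, p.2)) p.1

/-- The value of `u_t` prescribed by the equation with coefficients `k`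
for the spatial derivatives `J`. -/
def spatial (r : ℕ) (k : Kappa r) (J : ℕ → ℝ) : ℝ :=
  (∑ j : Finset.Icc 2 r, k.2.1 j * J j) + k.1 * J 0 + k.2.2 - J 0 * J 1

/-- The leading coefficient `Aʳ`. -/
def lead {r : ℕ} (hr : 2 ≤ r) (k : Kappa r) : ℝ := k.2.1 ⟨r, Finset.mem_Icc.2 ⟨hr, le_rfl⟩⟩

theorem lead_ne_zero {r : ℕ} (hr : 2 ≤ r) {k : Kappa r} (hk : k ∈ regular r) : lead hr k ≠ 0 :=
  hk _ rfl

theorem satisfiesAt_iff {r : ℕ} {κ : ℝ × ℝ → Kappa r} {u : ℝ × ℝ → ℝ} {p : ℝ × ℝ} :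
    SatisfiesAt r κ u p ↔ tderiv u p = spatial r (κ p) (xjet u p) := by
  simp only [SatisfiesAt, tderiv, spatial, xjet, iteratedDeriv_zero, iteratedDeriv_one]
  constructor <;> intro h <;> linarith

/-- The bound 2 ≤ r puts both factors of the quadratic term J 0 * J 1 among the common lower jets,
so only the top term survives. -/
theorem spatial_sub_spatial {r : ℕ} (hr : 2 ≤ r) (k : Kappa r) {J J' : ℕ → ℝ}
    (h : ∀ j < r, J j = J' j) : spatial r k J - spatial r k J' = lead hr k * (J r - J' r) := by
  have hs : (∑ j : Finset.Icc 2 r, k.2.1 j * J j) - ∑ j : Finset.Icc 2 r, k.2.1 j * J' j =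
      lead hr k * (J r - J' r) := by
    rw [← Finset.sum_sub_distrib,
      Finset.sum_eq_single (⟨r, Finset.mem_Icc.2 ⟨hr, le_rfl⟩⟩ : Finset.Icc 2 r)]
    · simp only [lead]; ring
    · intro j _ hj
      have h1 : (j : ℕ) ≤ r := (Finset.mem_Icc.1 j.2).2
      have h2 : (j : ℕ) ≠ r := fun h => hj (Subtype.ext h)
      rw [h j (by omega)]; ring
    · simp
  simp only [spatial]
  rw [h 0 (by omega), h 1 (by omega)]
  linarith

theorem contDiffAt_slice_snd {u : ℝ × ℝ → ℝ} {p : ℝ × ℝ} {n : WithTop ℕ∞}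
    (hu : ContDiffAt ℝ n u p) : ContDiffAt ℝ n (fun y => u (p.1, y)) p.2 :=
  ContDiffAt.comp (g := u) (f := fun y : ℝ => (p.1, y)) p.2 hu
    (contDiffAt_const.prodMk contDiffAt_id)

theorem contDiffAt_slice_fst {u : ℝ × ℝ → ℝ} {p : ℝ × ℝ} {n : WithTop ℕ∞}
    (hu : ContDiffAt ℝ n u p) : ContDiffAt ℝ n (fun s => u (s, p.2)) p.1 :=
  ContDiffAt.comp (g := u) (f := fun s : ℝ => (s, p.2)) p.1 hu
    (contDiffAt_id.prodMk contDiffAt_const)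

theorem hasDerivAt_slice_snd {E : Type*} [NormedAddCommGroup E] [NormedSpace ℝ E]
    {u : ℝ × ℝ → E} {p : ℝ × ℝ} (hu : DifferentiableAt ℝ u p) :
    HasDerivAt (fun y => u (p.1, y)) (fderiv ℝ u p (0, 1)) p.2 :=
  HasFDerivAt.comp_hasDerivAt (l := u) (f := fun y : ℝ => (p.1, y)) p.2 hu.hasFDerivAt
    ((hasDerivAt_const _ _).prodMk (hasDerivAt_id _))

theorem hasDerivAt_slice_fst {E : Type*} [NormedAddCommGroup E] [NormedSpace ℝ E]
    {u : ℝ × ℝ → E} {p : ℝ × ℝ} (hu : DifferentiableAt ℝ u p) :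
    HasDerivAt (fun s => u (s, p.2)) (fderiv ℝ u p (1, 0)) p.1 :=
  HasFDerivAt.comp_hasDerivAt (l := u) (f := fun s : ℝ => (s, p.2)) p.1 hu.hasFDerivAt
    ((hasDerivAt_id _).prodMk (hasDerivAt_const _ _))

theorem tderiv_eq_fderiv {u : ℝ × ℝ → ℝ} {p : ℝ × ℝ} (hu : DifferentiableAt ℝ u p) :
    tderiv u p = fderiv ℝ u p (1, 0) := (hasDerivAt_slice_fst hu).deriv

theorem xjet_zero (u : ℝ × ℝ → ℝ) (p : ℝ × ℝ) : xjet u p 0 = u p := by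
  simp [xjet]

theorem xjet_one {u : ℝ × ℝ → ℝ} {p : ℝ × ℝ} (hu : DifferentiableAt ℝ u p) :
    xjet u p 1 = fderiv ℝ u p (0, 1) := by
  rw [xjet, iteratedDeriv_one]; exact (hasDerivAt_slice_snd hu).deriv

theorem fderiv_eq_tderiv_xjet {u : ℝ × ℝ → ℝ} {p : ℝ × ℝ} (hu : DifferentiableAt ℝ u p)
    (η : ℝ × ℝ) : fderiv ℝ u p η = η.1 * tderiv u p + η.2 * xjet u p 1 := by
  have : η = η.1 • ((1, 0) : ℝ × ℝ) + η.2 • ((0, 1) : ℝ × ℝ) := by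
    ext <;> simp
  conv_lhs => rw [this]
  rw [map_add, map_smul, map_smul, ← tderiv_eq_fderiv hu, ← xjet_one hu]
  rfl

/-- The function `f(x) + ψ(t)`. -/
def sep (f ψ : ℝ → ℝ) (q : ℝ × ℝ) : ℝ := f q.2 + ψ q.1

theorem contDiff_sep {f ψ : ℝ → ℝ} (hf : ContDiff ℝ ∞ f) (hψ : ContDiff ℝ ∞ ψ) :
    ContDiff ℝ ∞ (sep f ψ) := (hf.comp contDiff_snd).add (hψ.comp contDiff_fst)

theorem xjet_sep {f ψ : ℝ → ℝ} {p : ℝ × ℝ} (hψ : ψ p.1 = 0) (j : ℕ) :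
    xjet (sep f ψ) p j = iteratedDeriv j f p.2 := by
  simp [xjet, sep, hψ]

theorem tderiv_sep {f ψ : ℝ → ℝ} {p : ℝ × ℝ} : tderiv (sep f ψ) p = deriv ψ p.1 := by
  simp [tderiv, sep]

theorem tangent_eq {u : ℝ × ℝ → ℝ} {p : ℝ × ℝ} (hu : DifferentiableAt ℝ u p) (η : ℝ × ℝ) :
    tangent u p η = (η.1, η.2, η.1 * tderiv u p + η.2 * xjet u p 1) := by
  rw [tangent, fderiv_eq_tderiv_xjet hu]

/-! ### Admissible transformations without restrictions on the domains -/

/-- A diffeomorphism that maps an equation of the class to an equation of the class. -/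
structure IsAdmissible (r : ℕ) (φ : OpenPartialHomeomorph Var Var) (κ κ' : ℝ × ℝ → Kappa r) :
    Prop where
  diffeo : IsDiffeo φ
  reg : ∀ p ∈ base '' φ.source, κ p ∈ regular r
  reg' : ∀ p ∈ base '' φ.target, κ' p ∈ regular r
  maps : MapsEquation r φ κ κ'

/-- Nothing is required of the sections of the domain or of the smoothness of the coefficients, so
the notion is symmetric and each local result also applies to the inverse of φ. -/
theorem IsAdmissible.symm {r : ℕ} {φ : OpenPartialHomeomorph Var Var} {κ κ' : ℝ × ℝ → Kappa r}
    (h : IsAdmissible r φ κ κ') : IsAdmissible r φ.symm κ' κ where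
  diffeo := h.diffeo.symm
  reg := h.reg'
  reg' := by simpa using h.reg
  maps := by
    intro v u p' hT
    obtain ⟨hS, hb⟩ := hT.symm h.diffeo.symm
    rw [OpenPartialHomeomorph.symm_symm] at hS hb
    have := h.maps u v _ hS
    change SatisfiesAt r κ u _ ↔ SatisfiesAt r κ' v (base (φ (graph u _))) at this
    rw [hb] at this
    exact this.symm

variable {r : ℕ} {φ : OpenPartialHomeomorph Var Var} {κ κ' : ℝ × ℝ → Kappa r}

theorem IsAdmissible.lead_ne (h : IsAdmissible r φ κ κ') (hr : 2 ≤ r) {z : Var}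
    (hz : z ∈ φ.source) : lead hr (κ (base z)) ≠ 0 :=
  lead_ne_zero hr (h.reg _ ⟨z, hz, rfl⟩)

theorem IsAdmissible.lead_ne' (h : IsAdmissible r φ κ κ') (hr : 2 ≤ r) {z : Var}
    (hz : z ∈ φ.source) : lead hr (κ' (base (φ z))) ≠ 0 :=
  lead_ne_zero hr (h.reg' _ ⟨φ z, φ.map_source hz, rfl⟩)

section Comparison

variable {u₁ v₁ u v : ℝ × ℝ → ℝ} {p : ℝ × ℝ}

/-- The comparison principle restricted to the two coordinate lines through the image point. The
same nonzero c serves both lines, so it cancels when the two differences are inserted into the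
equation. -/
theorem TransformsAt.exists_leading (h₁ : TransformsAt φ u₁ v₁ p) (h : TransformsAt φ u v p)
    (hφ : IsDiffeo φ) (huu : u p = u₁ p) :
    ∃ c : ℝ, c ≠ 0 ∧
      (∀ (n : ℕ) (m : ℝ), HasLeading (fun y => u (base (φ.symm (graph v
          ((base (φ (graph u p))).1, y)))) - u₁ (base (φ.symm (graph v
          ((base (φ (graph u p))).1, y))))) (base (φ (graph u p))).2 n m →
        ∀ j ≤ n, xjet v (base (φ (graph u p))) j - xjet v₁ (base (φ (graph u p))) j =
          if j = n then (n.factorial : ℝ) * (c * m) else 0) ∧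
      ∀ m : ℝ, HasLeading (fun s => u (base (φ.symm (graph v
          (s, (base (φ (graph u p))).2)))) - u₁ (base (φ.symm (graph v
          (s, (base (φ (graph u p))).2))))) (base (φ (graph u p))).1 1 m →
        tderiv v (base (φ (graph u p))) - tderiv v₁ (base (φ (graph u p))) = c * m := by
  obtain ⟨c, hc, ho⟩ := h₁.exists_isLittleO h hφ huu
  have hgr : graph u₁ p = graph u p := by simp [graph, huu]
  have hv : ContDiffAt ℝ ∞ v (base (φ (graph u p))) := h.2.2.1
  have hv₁ : ContDiffAt ℝ ∞ v₁ (base (φ (graph u p))) := by rw [← hgr]; exact h₁.2.2.1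
  set q := base (φ (graph u p))
  refine ⟨c, hc, ?_, ?_⟩
  · intro n m hm j hj
    have ht : Tendsto (fun y : ℝ => (q.1, y)) (𝓝 q.2) (𝓝 q) :=
      (continuous_const.prodMk continuous_id).tendsto q.2
    have h1 := IsLittleO.const_mul_right hc (ho.comp_tendsto ht)
    have h2 : HasLeading (fun y => v (q.1, y) - v₁ (q.1, y)) q.2 n (c * m) :=
      (hm.const_mul c).of_isLittleO h1
    have hn : ∀ n : ℕ, (n : WithTop ℕ∞) ≤ ∞ := fun n => by exact_mod_cast le_top
    have h3 := h2.iteratedDeriv_eq ((contDiffAt_slice_snd (hv.of_le (hn n))).sub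
      (contDiffAt_slice_snd (hv₁.of_le (hn n)))) hj
    rw [← h3]
    exact (iteratedDeriv_sub (contDiffAt_slice_snd (hv.of_le (hn j)))
      (contDiffAt_slice_snd (hv₁.of_le (hn j)))).symm
  · intro m hm
    have ht : Tendsto (fun s : ℝ => (s, q.2)) (𝓝 q.1) (𝓝 q) :=
      (continuous_id.prodMk continuous_const).tendsto q.1
    have h1 := IsLittleO.const_mul_right hc (ho.comp_tendsto ht)
    have h2 : HasLeading (fun s => v (s, q.2) - v₁ (s, q.2)) q.1 1 (c * m) :=
      (hm.const_mul c).of_isLittleO h1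
    have d1 := (contDiffAt_slice_fst hv).differentiableAt (by simp)
    have d2 := (contDiffAt_slice_fst hv₁).differentiableAt (by simp)
    have h3 := h2.iteratedDeriv_eq (((contDiffAt_slice_fst hv).sub
      (contDiffAt_slice_fst hv₁)).of_le (by exact_mod_cast le_top)) le_rfl
    rw [iteratedDeriv_one, deriv_fun_sub d1 d2] at h3
    simpa [tderiv] using h3

theorem TransformsAt.hasDerivAt_snd (h : TransformsAt φ u v p) (hφ : IsDiffeo φ) :
    HasDerivAt (fun y => base (φ.symm (graph v ((base (φ (graph u p))).1, y))))
      (fderiv ℝ (fun q => base (φ.symm (graph v q))) (base (φ (graph u p))) (0, 1))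
      (base (φ (graph u p))).2 :=
  hasDerivAt_slice_snd ((contDiffAt_base_comp_graph hφ.symm (h.symm hφ).1.mem
    (h.symm hφ).1.2.1).differentiableAt (by simp))

theorem TransformsAt.hasDerivAt_fst (h : TransformsAt φ u v p) (hφ : IsDiffeo φ) :
    HasDerivAt (fun s => base (φ.symm (graph v (s, (base (φ (graph u p))).2))))
      (fderiv ℝ (fun q => base (φ.symm (graph v q))) (base (φ (graph u p))) (1, 0))
      (base (φ (graph u p))).1 :=
  hasDerivAt_slice_fst ((contDiffAt_base_comp_graph hφ.symm (h.symm hφ).1.mem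
    (h.symm hφ).1.2.1).differentiableAt (by simp))

end Comparison

theorem hasLeading_fst {γ : ℝ → ℝ × ℝ} {γ' : ℝ × ℝ} {s₀ : ℝ} (h : HasDerivAt γ γ' s₀) :
    HasLeading (fun s => (γ s).1 - (γ s₀).1) s₀ 1 γ'.1 :=
  hasLeading_of_hasDerivAt
    ((hasFDerivAt_fst.comp_hasDerivAt s₀ h).sub_const _) (by simp)

theorem hasLeading_snd {γ : ℝ → ℝ × ℝ} {γ' : ℝ × ℝ} {s₀ : ℝ} (h : HasDerivAt γ γ' s₀) :
    HasLeading (fun s => (γ s).2 - (γ s₀).2) s₀ 1 γ'.2 :=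
  hasLeading_of_hasDerivAt
    ((hasFDerivAt_snd.comp_hasDerivAt s₀ h).sub_const _) (by simp)

end

section

/-! ### Fibre-preservation -/

/-- The trial function `a + b (x - x₀) + s (x - x₀) ^ n`. -/
def trial (a b s : ℝ) (n : ℕ) (x₀ x : ℝ) : ℝ := a + b * (x - x₀) + s * (x - x₀) ^ n

theorem contDiff_trial (a b s : ℝ) (n : ℕ) (x₀ : ℝ) {m : WithTop ℕ∞} :
    ContDiff ℝ m (trial a b s n x₀) := by
  unfold trial; fun_prop

@[simp] theorem trial_self (a b s : ℝ) {n : ℕ} (hn : n ≠ 0) (x₀ : ℝ) :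
    trial a b s n x₀ x₀ = a := by simp [trial, hn]

theorem iteratedDeriv_trial (a b s : ℝ) (n : ℕ) (x₀ : ℝ) (j : ℕ) :
    iteratedDeriv j (trial a b s n x₀) x₀ =
      (if j = 0 then a else 0) + (if j = 1 then b else 0) +
        (if j = n then s * n.factorial else 0) := by
  have e : trial a b s n x₀ = fun x => a * (x - x₀) ^ 0 + b * (x - x₀) ^ 1 + s * (x - x₀) ^ n := by
    funext x; simp [trial]
  rw [e, iteratedDeriv_fun_add (by fun_prop) (by fun_prop),
    iteratedDeriv_fun_add (by fun_prop) (by fun_prop),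
    iteratedDeriv_const_mul _ (by fun_prop), iteratedDeriv_const_mul _ (by fun_prop),
    iteratedDeriv_const_mul _ (by fun_prop)]
  simp only [iteratedDeriv_sub_pow_self]
  split_ifs <;> simp

theorem deriv_trial_self (a b s : ℝ) {n : ℕ} (hn : 2 ≤ n) (x₀ : ℝ) :
    deriv (trial a b s n x₀) x₀ = b := by
  rw [← iteratedDeriv_one, iteratedDeriv_trial]
  simp [show 1 ≠ n by omega]

variable {r : ℕ} {φ : OpenPartialHomeomorph Var Var} {κ κ' : ℝ × ℝ → Kappa r}

theorem map_var {F : Type*} [NormedAddCommGroup F] [NormedSpace ℝ F] (L : Var →L[ℝ] F) (w : Var) :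
    L w = w.1 • L (1, 0, 0) + w.2.1 • L (0, 1, 0) + w.2.2 • L (0, 0, 1) := by
  rw [← map_smul, ← map_smul, ← map_smul, ← map_add, ← map_add]
  congr 1
  ext <;> simp

/-- Two functions with u_t = α and u_x = b at p solve the equation there and differ by (t - t₀)^r.
Their images have the same t-derivative and the same x-derivatives below order r, while those of
order r differ by a nonzero multiple of η.1^r, with η.1 the derivative of the old t along the new
x-line. As the leading coefficient is nonzero, η.1 = 0. -/
theorem IsAdmissible.fst_fderiv_of_generic (h : IsAdmissible r φ κ κ') (hr : 2 ≤ r) {z : Var}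
    (hz : z ∈ φ.source) {α b : ℝ}
    (hinj : ∀ η : ℝ × ℝ, base (fderiv ℝ φ z (η.1, η.2, η.1 * α + η.2 * b)) = 0 → η = 0) :
    (fderiv ℝ φ z (0, 1, b)).1 = 0 := by
  obtain ⟨t₀, x₀, a⟩ := z
  set p : ℝ × ℝ := (t₀, x₀) with hp
  set k := κ p with hk
  have hlead : lead hr k ≠ 0 := h.lead_ne hr hz
  -- the top coefficient that makes the equation hold
  set c₀ := spatial r k fun j => iteratedDeriv j (trial a b 0 r x₀) x₀ with hc₀
  set s := (α - c₀) / (lead hr k * r.factorial) with hs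
  set f := trial a b s r x₀ with hf
  have hr0 : r ≠ 0 := by omega
  have hfsat : spatial r k (fun j => iteratedDeriv j f x₀) = α := by
    have := spatial_sub_spatial hr k (J := fun j => iteratedDeriv j f x₀)
      (J' := fun j => iteratedDeriv j (trial a b 0 r x₀) x₀) (by
        intro j hj
        simp only [hf, iteratedDeriv_trial, if_neg hj.ne])
    rw [← hc₀] at this
    simp only [hf, iteratedDeriv_trial, if_true, hr0, if_false, show r ≠ 1 by omega] at this
    have hfac : (r.factorial : ℝ) ≠ 0 := by positivity
    have h2 : lead hr k * (0 + 0 + s * r.factorial - (0 + 0 + 0 * r.factorial)) = α - c₀ := by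
      rw [hs]; field_simp; ring
    rw [h2] at this
    simp only [hf, iteratedDeriv_trial]
    linarith
  have hfs : ContDiff ℝ ∞ f := contDiff_trial _ _ _ _ _
  -- The cases m = 0 and m = 1 are compared. Since r ≥ 2, the term m (t - t₀)^r affects neither u_t
  -- nor the x-jet at p.
  set ψ : ℝ → ℝ → ℝ := fun m => trial 0 α m r t₀ with hψ
  have hψs : ∀ m, ContDiff ℝ ∞ (ψ m) := fun m => contDiff_trial _ _ _ _ _
  have hψ0 : ∀ m, ψ m p.1 = 0 := fun m => trial_self _ _ _ hr0 _
  have hψ1 : ∀ m, deriv (ψ m) p.1 = α := fun m => deriv_trial_self _ _ _ hr _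
  have hus : ∀ m, ContDiff ℝ ∞ (sep f (ψ m)) := fun m => contDiff_sep hfs (hψs m)
  have hval : ∀ m, sep f (ψ m) p = a := by
    intro m; rw [sep, hψ0, add_zero]; exact trial_self _ _ _ hr0 _
  have hgr : ∀ m, graph (sep f (ψ m)) p = (t₀, x₀, a) := by
    intro m; rw [graph, hval]
  have htan : ∀ m η, tangent (sep f (ψ m)) p η = (η.1, η.2, η.1 * α + η.2 * b) := by
    intro m η
    rw [tangent_eq ((hus m).differentiable (by simp) _), tderiv_sep, hψ1,
      xjet_sep (hψ0 m), iteratedDeriv_one, hf, deriv_trial_self _ _ _ hr]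
  have hex : ∀ m, ∃ v, TransformsAt φ (sep f (ψ m)) v p := fun m =>
    exists_transformsAt h.diffeo (by rw [hgr]; exact hz) (hus m).contDiffAt (by
      intro η hη; rw [hgr, htan] at hη; exact hinj η hη)
  have hsat : ∀ m, SatisfiesAt r κ (sep f (ψ m)) p := by
    intro m
    rw [satisfiesAt_iff, tderiv_sep, hψ1, ← hfsat]
    congr 1
    funext j
    exact (xjet_sep (hψ0 m) j).symm
  obtain ⟨v₁, h₁⟩ := hex 0
  obtain ⟨v, h₂⟩ := hex 1
  have hs₁ := (h.maps _ _ _ h₁).1 (hsat 0)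
  have hs₂ := (h.maps _ _ _ h₂).1 (hsat 1)
  change SatisfiesAt r κ' v₁ (base (φ (graph (sep f (ψ 0)) p))) at hs₁
  change SatisfiesAt r κ' v (base (φ (graph (sep f (ψ 1)) p))) at hs₂
  obtain ⟨c, hc, hx, ht⟩ := h₁.exists_leading h₂ h.diffeo (by rw [hval, hval])
  have hw : ∀ q, sep f (ψ 1) q - sep f (ψ 0) q = (q.1 - p.1) ^ r := by
    intro q; simp only [sep, hψ, trial, hp]; ring
  simp only [hw] at hx ht
  have hpk : base (φ.symm (graph v (base (φ (graph (sep f (ψ 1)) p))))) = p :=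
    (h₂.symm h.diffeo).2
  have lx := (hasLeading_fst (h₂.hasDerivAt_snd h.diffeo)).pow r
  -- A term of order r > 1 has no first-order part, so the t-derivatives of the two images coincide.
  have lt := ((hasLeading_fst (h₂.hasDerivAt_fst h.diffeo)).pow r).of_lt (show 1 < r by omega)
  simp only [Prod.mk.eta, hpk] at lx lt
  have hη := h₂.fderiv_symm_eq h.diffeo (0, 1)
  set η := fderiv ℝ (fun q => base (φ.symm (graph v q))) (base (φ (graph (sep f (ψ 1)) p))) (0, 1)
    with hηdef
  have jx := hx _ _ lx
  have jt := ht _ lt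
  rw [satisfiesAt_iff] at hs₁ hs₂
  rw [hgr] at hs₁ hs₂ jx jt hη
  rw [htan] at hη
  set p' := base (φ (t₀, x₀, a)) with hp'
  have hd := spatial_sub_spatial hr (κ' p') (J := xjet v p') (J' := xjet v₁ p') (by
    intro j hj
    have := jx j hj.le
    rw [if_neg hj.ne] at this
    linarith)
  have jr := jx r le_rfl
  rw [if_pos rfl] at jr
  rw [jr, ← hs₁, ← hs₂, jt, mul_zero] at hd
  have hl' : lead hr (κ' p') ≠ 0 := h.lead_ne' hr hz
  have hη1 : η.1 = 0 := by
    have hfac : (r.factorial : ℝ) ≠ 0 := by positivity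
    rcases mul_eq_zero.1 hd.symm with h0 | h0
    · exact absurd h0 hl'
    · rcases mul_eq_zero.1 h0 with h0 | h0
      · exact absurd h0 hfac
      · rcases mul_eq_zero.1 h0 with h0 | h0
        · exact absurd h0 hc
        · exact (pow_eq_zero_iff hr0).1 h0
  have hsm : ((η.1, η.2, η.1 * α + η.2 * b) : Var) = η.2 • ((0, 1, b) : Var) := by
    rw [hη1]; simp
  rw [hsm, map_smul] at hη
  have e1 : η.2 * (fderiv ℝ φ (t₀, x₀, a) (0, 1, b)).1 = 0 := congrArg Prod.fst hη
  have e2 : η.2 * (fderiv ℝ φ (t₀, x₀, a) (0, 1, b)).2.1 = 1 := congrArg Prod.snd hη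
  rcases mul_eq_zero.1 e1 with h0 | h0
  · rw [h0, zero_mul] at e2; exact absurd e2 zero_ne_one
  · exact h0

/-- The generic case gives T_x + b T_u = 0 for every b for which some α makes the tangent plane
transversal; two different such b force both derivatives to vanish. -/
theorem IsAdmissible.fst_fderiv (h : IsAdmissible r φ κ κ') (hr : 2 ≤ r) {z : Var}
    (hz : z ∈ φ.source) :
    (fderiv ℝ φ z (0, 1, 0)).1 = 0 ∧ (fderiv ℝ φ z (0, 0, 1)).1 = 0 := by
  -- ν is the old direction that becomes vertical. The plane with slopes α, b is transversal as soon
  -- as ν does not lie in it.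
  set ν := fderiv ℝ φ.symm (φ z) (0, 0, 1) with hν
  have hDν : fderiv ℝ φ z ν = (0, 0, 1) := h.diffeo.fderiv_fderiv_symm hz _
  have hν0 : ν ≠ 0 := by
    intro h0; rw [h0, map_zero] at hDν
    have := congrArg (fun w : Var => w.2.2) hDν
    simp at this
  have key : ∀ α b : ℝ, ν.2.2 ≠ ν.1 * α + ν.2.1 * b →
      (fderiv ℝ φ z (0, 1, 0)).1 + b * (fderiv ℝ φ z (0, 0, 1)).1 = 0 := by
    intro α b hne
    have h1 := h.fst_fderiv_of_generic hr hz (α := α) (b := b) (by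
      intro η hη
      set w : Var := (η.1, η.2, η.1 * α + η.2 * b) with hw
      have h2 : fderiv ℝ φ z w = fderiv ℝ φ z ((fderiv ℝ φ z w).2.2 • ν) := by
        rw [map_smul, hDν]
        have ha : (fderiv ℝ φ z w).1 = 0 := congrArg Prod.fst hη
        have hb : (fderiv ℝ φ z w).2.1 = 0 := congrArg Prod.snd hη
        ext <;> simp [ha, hb]
      have h3 : w - (fderiv ℝ φ z w).2.2 • ν = 0 :=
        h.diffeo.eq_zero_of_fderiv hz (by rw [map_sub, sub_eq_zero]; exact h2)
      set l := (fderiv ℝ φ z w).2.2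
      have e1 : η.1 - l * ν.1 = 0 := congrArg (fun y : Var => y.1) h3
      have e2 : η.2 - l * ν.2.1 = 0 := congrArg (fun y : Var => y.2.1) h3
      have e3 : η.1 * α + η.2 * b - l * ν.2.2 = 0 := congrArg (fun y : Var => y.2.2) h3
      have e4 : l * (ν.2.2 - (ν.1 * α + ν.2.1 * b)) = 0 := by
        linear_combination α * e1 + b * e2 - e3
      have hl : l = 0 := (mul_eq_zero.1 e4).resolve_right (sub_ne_zero.2 hne)
      rw [hl] at e1 e2
      ext
      · simpa using e1
      · simpa using e2)
    rw [map_var] at h1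
    simpa using h1
  -- A slope b fails for all α only if ν.1 = 0 and ν.2.2 = ν.2.1 * b; since ν ≠ 0, this excludes at
  -- most one b, and among 0, 1, 2 at least two remain.
  have good : ∀ b : ℝ, (∃ α, ν.2.2 ≠ ν.1 * α + ν.2.1 * b) ∨ (ν.1 = 0 ∧ ν.2.2 = ν.2.1 * b) := by
    intro b
    by_cases hb : ∃ α, ν.2.2 ≠ ν.1 * α + ν.2.1 * b
    · exact Or.inl hb
    · push Not at hb
      have h0 := hb 0
      have h1 := hb 1
      exact Or.inr ⟨by linarith, by linarith⟩
  have bad : ∀ b b' : ℝ, b ≠ b' → ν.1 = 0 → ν.2.2 = ν.2.1 * b → ν.2.2 = ν.2.1 * b' → False := by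
    intro b b' hbb h1 h2 h3
    have h4 : ν.2.1 * (b - b') = 0 := by linarith
    have h5 : ν.2.1 = 0 := (mul_eq_zero.1 h4).resolve_right (sub_ne_zero.2 hbb)
    rw [h5, zero_mul] at h2
    exact hν0 (Prod.ext h1 (Prod.ext h5 h2))
  have fin : ∀ b b' : ℝ, b ≠ b' → (∃ α, ν.2.2 ≠ ν.1 * α + ν.2.1 * b) →
      (∃ α, ν.2.2 ≠ ν.1 * α + ν.2.1 * b') →
      (fderiv ℝ φ z (0, 1, 0)).1 = 0 ∧ (fderiv ℝ φ z (0, 0, 1)).1 = 0 := by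
    rintro b b' hbb ⟨α, hα⟩ ⟨α', hα'⟩
    have e1 := key α b hα
    have e2 := key α' b' hα'
    have e3 : (b - b') * (fderiv ℝ φ z (0, 0, 1)).1 = 0 := by linear_combination e1 - e2
    have e4 := (mul_eq_zero.1 e3).resolve_left (sub_ne_zero.2 hbb)
    rw [e4] at e1
    exact ⟨by linarith, e4⟩
  rcases good 0 with g0 | g0
  · rcases good 1 with g1 | g1
    · exact fin 0 1 (by norm_num) g0 g1
    · rcases good 2 with g2 | g2
      · exact fin 0 2 (by norm_num) g0 g2
      · exact (bad 1 2 (by norm_num) g1.1 g1.2 g2.2).elim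
  · rcases good 1 with g1 | g1
    · rcases good 2 with g2 | g2
      · exact fin 1 2 (by norm_num) g1 g2
      · exact (bad 0 2 (by norm_num) g0.1 g0.2 g2.2).elim
    · exact (bad 0 1 (by norm_num) g0.1 g0.2 g1.2).elim

/-- Local constancy in directions annihilated by the derivative. -/
theorem exists_ball_eq {G : Var → ℝ} {W : Set Var} (hW : IsOpen W)
    (hG : ∀ y ∈ W, DifferentiableAt ℝ G y) {z : Var} (hz : z ∈ W) :
    ∃ ε > 0, Metric.ball z ε ⊆ W ∧ ∀ y ∈ Metric.ball z ε, ∀ y' ∈ Metric.ball z ε,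
      (∀ w ∈ W, fderiv ℝ G w (y' - y) = 0) → G y' = G y := by
  obtain ⟨ε, hε, hb⟩ := Metric.isOpen_iff.1 hW z hz
  refine ⟨ε, hε, hb, fun y hy y' hy' h0 => ?_⟩
  have hmem : ∀ s ∈ Set.Icc (0 : ℝ) 1, y + s • (y' - y) ∈ W := fun s hs =>
    hb ((convex_ball z ε).add_smul_sub_mem hy hy' hs)
  have hd : ∀ s ∈ Set.Icc (0 : ℝ) 1, HasDerivAt (fun s : ℝ => G (y + s • (y' - y))) 0 s := by
    intro s hs
    have h1 : HasDerivAt (fun s : ℝ => y + s • (y' - y)) (y' - y) s := by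
      simpa using ((hasDerivAt_id s).smul_const (y' - y)).const_add y
    have h2 := (hG _ (hmem s hs)).hasFDerivAt.comp_hasDerivAt s h1
    rwa [h0 _ (hmem s hs)] at h2
  have h3 := (convex_Icc (0 : ℝ) 1).norm_image_sub_le_of_norm_hasDerivWithin_le (C := 0)
    (fun s hs => (hd s hs).hasDerivWithinAt) (by simp) (Set.left_mem_Icc.2 zero_le_one)
    (Set.right_mem_Icc.2 zero_le_one)
  simp only [zero_smul, add_zero, one_smul, add_sub_cancel, zero_mul, norm_le_zero_iff] at h3
  exact sub_eq_zero.1 h3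

end

/-! ### Transformation of the leading coefficient; independence of the new x from u -/

section

variable {r : ℕ} {φ : OpenPartialHomeomorph Var Var} {κ κ' : ℝ × ℝ → Kappa r}

theorem IsAdmissible.fst_fderiv_eq (h : IsAdmissible r φ κ κ') (hr : 2 ≤ r) {z : Var}
    (hz : z ∈ φ.source) (w : Var) :
    (fderiv ℝ φ z w).1 = w.1 * (fderiv ℝ φ z (1, 0, 0)).1 := by
  obtain ⟨h1, h2⟩ := h.fst_fderiv hr hz
  rw [map_var (fderiv ℝ φ z) w]
  simp [h1, h2]

theorem IsAdmissible.fst_fderiv_ne_zero (h : IsAdmissible r φ κ κ') (hr : 2 ≤ r) {z : Var}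
    (hz : z ∈ φ.source) : (fderiv ℝ φ z (1, 0, 0)).1 ≠ 0 := by
  intro h0
  have h1 := h.fst_fderiv_eq hr hz (fderiv ℝ φ.symm (φ z) (1, 0, 0))
  rw [h.diffeo.fderiv_fderiv_symm hz, h0, mul_zero] at h1
  exact one_ne_zero h1

theorem fderiv_fst_comp {φ : OpenPartialHomeomorph Var Var} (hφ : IsDiffeo φ) {z : Var}
    (hz : z ∈ φ.source) (w : Var) :
    fderiv ℝ (fun y => (φ y).1) z w = (fderiv ℝ φ z w).1 := by
  have := (ContinuousLinearMap.fst ℝ ℝ (ℝ × ℝ)).hasFDerivAt.comp z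
    (hφ.differentiableAt hz).hasFDerivAt
  rw [show (fun y => (φ y).1) = ⇑(ContinuousLinearMap.fst ℝ ℝ (ℝ × ℝ)) ∘ φ from rfl, this.fderiv]
  rfl

theorem fderiv_snd_comp {φ : OpenPartialHomeomorph Var Var} (hφ : IsDiffeo φ) {z : Var}
    (hz : z ∈ φ.source) (w : Var) :
    fderiv ℝ (fun y => (φ y).2.1) z w = (fderiv ℝ φ z w).2.1 := by
  have := ((ContinuousLinearMap.fst ℝ ℝ ℝ).comp
    (ContinuousLinearMap.snd ℝ ℝ (ℝ × ℝ))).hasFDerivAt.comp z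
    (hφ.differentiableAt hz).hasFDerivAt
  rw [show (fun y => (φ y).2.1) = ⇑((ContinuousLinearMap.fst ℝ ℝ ℝ).comp
    (ContinuousLinearMap.snd ℝ ℝ (ℝ × ℝ))) ∘ φ from rfl, this.fderiv]
  rfl

theorem fderiv_thd_comp {φ : OpenPartialHomeomorph Var Var} (hφ : IsDiffeo φ) {z : Var}
    (hz : z ∈ φ.source) (w : Var) :
    fderiv ℝ (fun y => (φ y).2.2) z w = (fderiv ℝ φ z w).2.2 := by
  have := ((ContinuousLinearMap.snd ℝ ℝ ℝ).comp
    (ContinuousLinearMap.snd ℝ ℝ (ℝ × ℝ))).hasFDerivAt.comp z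
    (hφ.differentiableAt hz).hasFDerivAt
  rw [show (fun y => (φ y).2.2) = ⇑((ContinuousLinearMap.snd ℝ ℝ ℝ).comp
    (ContinuousLinearMap.snd ℝ ℝ (ℝ × ℝ))) ∘ φ from rfl, this.fderiv]
  rfl

theorem IsDiffeo.differentiableAt_fst {φ : OpenPartialHomeomorph Var Var} (hφ : IsDiffeo φ)
    {z : Var} (hz : z ∈ φ.source) : DifferentiableAt ℝ (fun y => (φ y).1) z :=
  (hφ.differentiableAt hz).fst

theorem IsDiffeo.differentiableAt_snd {φ : OpenPartialHomeomorph Var Var} (hφ : IsDiffeo φ)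
    {z : Var} (hz : z ∈ φ.source) : DifferentiableAt ℝ (fun y => (φ y).2.1) z :=
  (hφ.differentiableAt hz).snd.fst

theorem IsDiffeo.differentiableAt_thd {φ : OpenPartialHomeomorph Var Var} (hφ : IsDiffeo φ)
    {z : Var} (hz : z ∈ φ.source) : DifferentiableAt ℝ (fun y => (φ y).2.2) z :=
  (hφ.differentiableAt hz).snd.snd

/-- Near a point, the new `t` is a function of the old `t` alone. -/
theorem IsAdmissible.exists_ball_fst (h : IsAdmissible r φ κ κ') (hr : 2 ≤ r) {z : Var}
    (hz : z ∈ φ.source) : ∃ ε > 0, Metric.ball z ε ⊆ φ.source ∧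
      ∀ y ∈ Metric.ball z ε, ∀ y' ∈ Metric.ball z ε, y'.1 = y.1 → (φ y').1 = (φ y).1 := by
  obtain ⟨ε, hε, hb, hc⟩ := exists_ball_eq (G := fun y => (φ y).1) φ.open_source
    (fun y hy => h.diffeo.differentiableAt_fst hy) hz
  refine ⟨ε, hε, hb, fun y hy y' hy' he => hc y hy y' hy' fun w hw => ?_⟩
  rw [fderiv_fst_comp h.diffeo hw, h.fst_fderiv_eq hr hw]
  simp [he]

/-- Solution jets with x-parts a + b (x - x₀) + s (x - x₀)^r, s = 0 and s = 1, have t-derivatives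
differing by r! Aʳ. For the images, the r-th derivatives differ by r! c η.2^r and the t-derivatives
by c r! Aʳ η'.1, where η.2 and η'.1 are the reciprocals of X_x + b X_u and T_t. The second equation
relates the two. -/
theorem IsAdmissible.top_relation (h : IsAdmissible r φ κ κ') (hr : 2 ≤ r) {z : Var}
    (hz : z ∈ φ.source) {b : ℝ} (hb : (fderiv ℝ φ z (0, 1, b)).2.1 ≠ 0) :
    lead hr (κ (base z)) * (fderiv ℝ φ z (0, 1, b)).2.1 ^ r =
      (fderiv ℝ φ z (1, 0, 0)).1 * lead hr (κ' (base (φ z))) := by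
  have hfst := h.fst_fderiv_eq hr hz
  have hT := h.fst_fderiv_ne_zero hr hz
  obtain ⟨t₀, x₀, a⟩ := z
  set D := fderiv ℝ φ (t₀, x₀, a) with hD
  set p : ℝ × ℝ := (t₀, x₀) with hp
  have hr0 : r ≠ 0 := by omega
  set f : ℝ → ℝ → ℝ := fun s => trial a b s r x₀ with hf
  set α : ℝ → ℝ := fun s => spatial r (κ p) fun j => iteratedDeriv j (f s) x₀ with hα
  have hαd : α 1 - α 0 = lead hr (κ p) * r.factorial := by
    have := spatial_sub_spatial hr (κ p) (J := fun j => iteratedDeriv j (f 1) x₀)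
      (J' := fun j => iteratedDeriv j (f 0) x₀) (by
        intro j hj
        simp only [hf, iteratedDeriv_trial, if_neg hj.ne])
    rw [hα]
    simp only
    rw [this]
    simp only [hf, iteratedDeriv_trial, if_true]
    ring
  set u : ℝ → ℝ × ℝ → ℝ := fun s => sep (f s) (trial 0 (α s) 0 r t₀) with hu
  have hus : ∀ s, ContDiff ℝ ∞ (u s) := fun s =>
    contDiff_sep (contDiff_trial _ _ _ _ _) (contDiff_trial _ _ _ _ _)
  have hval : ∀ s, u s p = a := by
    intro s
    simp only [hu, sep, hf, hp, trial_self _ _ _ hr0, add_zero]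
  have hgr : ∀ s, graph (u s) p = (t₀, x₀, a) := fun s => by rw [graph, hval]
  have hjet : ∀ s j, xjet (u s) p j = iteratedDeriv j (f s) x₀ := fun s j =>
    xjet_sep (trial_self _ _ _ hr0 _) j
  have htd : ∀ s, tderiv (u s) p = α s := fun s => by
    rw [hu, tderiv_sep]; exact deriv_trial_self _ _ _ hr _
  have htan : ∀ s η, tangent (u s) p η = (η.1, η.2, η.1 * α s + η.2 * b) := by
    intro s η
    rw [tangent_eq ((hus s).differentiable (by simp) _), htd, hjet, iteratedDeriv_one, hf,
      deriv_trial_self _ _ _ hr]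
  have hDt : ∀ s η, base (D (tangent (u s) p η)) = (η.1 * (D (1, 0, 0)).1,
      η.1 * (D (1, 0, α s)).2.1 + η.2 * (D (0, 1, b)).2.1) := by
    intro s η
    have e : tangent (u s) p η = η.1 • ((1, 0, α s) : Var) + η.2 • ((0, 1, b) : Var) := by
      rw [htan]; ext <;> simp
    refine Prod.ext ?_ ?_
    · change (D _).1 = _
      rw [hfst, htan]
    · change (D _).2.1 = _
      rw [e, map_add, map_smul, map_smul]
      rfl
  have hex : ∀ s, ∃ v, TransformsAt φ (u s) v p := fun s =>
    exists_transformsAt h.diffeo (by rw [hgr]; exact hz) (hus s).contDiffAt (by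
      intro η hη
      rw [hgr, hDt] at hη
      have e1 : η.1 * (D (1, 0, 0)).1 = 0 := congrArg Prod.fst hη
      have e2 : η.1 * (D (1, 0, α s)).2.1 + η.2 * (D (0, 1, b)).2.1 = 0 := congrArg Prod.snd hη
      have e3 : η.1 = 0 := (mul_eq_zero.1 e1).resolve_right hT
      rw [e3, zero_mul, zero_add] at e2
      exact Prod.ext e3 ((mul_eq_zero.1 e2).resolve_right hb))
  have hsat : ∀ s, SatisfiesAt r κ (u s) p := by
    intro s
    rw [satisfiesAt_iff, htd]
    simp only [hα]
    congr 1
    funext j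
    exact (hjet s j).symm
  obtain ⟨v₁, h₁⟩ := hex 0
  obtain ⟨v, h₂⟩ := hex 1
  have hs₁ := (h.maps _ _ _ h₁).1 (hsat 0)
  have hs₂ := (h.maps _ _ _ h₂).1 (hsat 1)
  change SatisfiesAt r κ' v₁ (base (φ (graph (u 0) p))) at hs₁
  change SatisfiesAt r κ' v (base (φ (graph (u 1) p))) at hs₂
  obtain ⟨c, hc, hx, ht⟩ := h₁.exists_leading h₂ h.diffeo (by rw [hval, hval])
  have hpk : base (φ.symm (graph v (base (φ (graph (u 1) p))))) = p := (h₂.symm h.diffeo).2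
  have hw : ∀ q : ℝ × ℝ, u 1 q - u 0 q = (q.2 - p.2) ^ r + (α 1 - α 0) * (q.1 - p.1) := by
    intro q; simp only [hu, hf, sep, trial, hp]; ring
  simp only [hw] at hx ht
  have lx := (hasLeading_snd (h₂.hasDerivAt_snd h.diffeo)).pow r
  have lt2 := ((hasLeading_snd (h₂.hasDerivAt_fst h.diffeo)).pow r).of_lt (show 1 < r by omega)
  have lt1 := (hasLeading_fst (h₂.hasDerivAt_fst h.diffeo)).const_mul (α 1 - α 0)
  have lt := lt2.add lt1
  simp only [Prod.mk.eta, hpk] at lx lt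
  have hη := h₂.fderiv_symm_eq h.diffeo (0, 1)
  have hη' := h₂.fderiv_symm_eq h.diffeo (1, 0)
  have hmem : graph v (base (φ (graph (u 1) p))) ∈ φ.target := (h₂.symm h.diffeo).1.mem
  -- The inverse of φ is admissible too, so the old t is constant along the new x-line near the
  -- point. A vanishing first derivative would not suffice: the linear term in t must contribute
  -- nothing up to order r.
  obtain ⟨ε, hε, hbl, hcst⟩ := h.symm.exists_ball_fst hr (z := graph v (base (φ (graph (u 1) p))))
    hmem
  set p' := base (φ (graph (u 1) p)) with hp'
  have hevt : ∀ᶠ y in 𝓝 p'.2, (base (φ.symm (graph v (p'.1, y)))).1 = p.1 := by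
    have hcont : ContinuousAt (fun y : ℝ => graph v (p'.1, y)) p'.2 :=
      ContinuousAt.comp (g := graph v) (f := fun y : ℝ => (p'.1, y)) (x := p'.2)
        (contDiffAt_graph h₂.2.2.1).continuousAt (by fun_prop)
    filter_upwards [hcont (Metric.ball_mem_nhds _ hε)] with y hy
    have := hcst _ (Metric.mem_ball_self hε) _ hy rfl
    rw [← hpk]
    exact this
  have lx' : HasLeading (fun y => ((base (φ.symm (graph v (p'.1, y)))).2 - p.2) ^ r +
      (α 1 - α 0) * ((base (φ.symm (graph v (p'.1, y)))).1 - p.1)) p'.2 r _ :=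
    lx.congr (hevt.mono fun y hy => by simp only [hy, sub_self, mul_zero, add_zero])
  have jx := hx _ _ lx'
  have jt := ht _ lt
  rw [satisfiesAt_iff] at hs₁ hs₂
  have hp'0 : base (φ (graph (u 0) p)) = p' := by rw [hp', hgr, hgr]
  have hp'1 : base (φ (t₀, x₀, a)) = p' := by rw [hp', hgr]
  rw [hp'0] at hs₁
  have hd := spatial_sub_spatial hr (κ' p') (J := xjet v p') (J' := xjet v₁ p') (by
    intro j hj
    have := jx j hj.le
    rw [if_neg hj.ne] at this
    linarith)
  have jr := jx r le_rfl
  rw [if_pos rfl] at jr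
  rw [jr, ← hs₁, ← hs₂, jt, hαd] at hd
  rw [hgr] at hη hη'
  rw [hDt] at hη hη'
  set η := fderiv ℝ (fun q => base (φ.symm (graph v q))) p' (0, 1)
  set η' := fderiv ℝ (fun q => base (φ.symm (graph v q))) p' (1, 0)
  have e1 : η.1 * (D (1, 0, 0)).1 = 0 := congrArg Prod.fst hη
  have e2 : η.1 * (D (1, 0, α 1)).2.1 + η.2 * (D (0, 1, b)).2.1 = 1 := congrArg Prod.snd hη
  have e3 : η'.1 * (D (1, 0, 0)).1 = 1 := congrArg Prod.fst hη'
  rw [(mul_eq_zero.1 e1).resolve_right hT, zero_mul, zero_add] at e2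
  have hfac : (r.factorial : ℝ) ≠ 0 := by positivity
  have e4 : η.2 ^ r * (D (0, 1, b)).2.1 ^ r = 1 := by rw [← mul_pow, e2, one_pow]
  have hbase : base ((t₀, x₀, a) : Var) = p := rfl
  rw [hbase, hp'1]
  have hcf : c * r.factorial ≠ 0 := mul_ne_zero hc hfac
  apply mul_left_cancel₀ hcf
  linear_combination (D (1, 0, 0)).1 * (D (0, 1, b)).2.1 ^ r * hd
    - c * r.factorial * lead hr (κ p) * (D (0, 1, b)).2.1 ^ r * e3
    + lead hr (κ' p') * r.factorial * c * (D (1, 0, 0)).1 * e4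

/-- In `top_relation` only X_x + b X_u involves b. If X_u ≠ 0, two choices of b give this factor the
values 1 and 2, whence 2^r = 1. Then X_x ≠ 0 because the differential of φ is onto. -/
theorem IsAdmissible.snd_fderiv (h : IsAdmissible r φ κ κ') (hr : 2 ≤ r) {z : Var}
    (hz : z ∈ φ.source) :
    (fderiv ℝ φ z (0, 0, 1)).2.1 = 0 ∧ (fderiv ℝ φ z (0, 1, 0)).2.1 ≠ 0 := by
  have hdec : ∀ b, (fderiv ℝ φ z (0, 1, b)).2.1 =
      (fderiv ℝ φ z (0, 1, 0)).2.1 + b * (fderiv ℝ φ z (0, 0, 1)).2.1 := by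
    intro b; rw [map_var]; simp
  have hrel : ∀ b, (fderiv ℝ φ z (0, 1, 0)).2.1 + b * (fderiv ℝ φ z (0, 0, 1)).2.1 ≠ 0 → _ :=
    fun b hb => hdec b ▸ h.top_relation hr hz (b := b) (by rwa [hdec b])
  set Xx := (fderiv ℝ φ z (0, 1, 0)).2.1
  set Xu := (fderiv ℝ φ z (0, 0, 1)).2.1 with hXu
  have hu : Xu = 0 := by
    by_contra hne
    have e1 := hrel ((1 - Xx) / Xu) (by field_simp; simp)
    have e2 := hrel ((2 - Xx) / Xu) (by field_simp; simp)
    have s1 : Xx + (1 - Xx) / Xu * Xu = 1 := by field_simp; ring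
    have s2 : Xx + (2 - Xx) / Xu * Xu = 2 := by field_simp; ring
    rw [s1, one_pow] at e1
    rw [s2, ← e1] at e2
    have e3 : (2 : ℝ) ^ r = 1 := mul_left_cancel₀ (h.lead_ne hr hz) e2
    have e4 : (1 : ℝ) < 2 ^ r := one_lt_pow₀ (by norm_num) (by omega)
    linarith
  refine ⟨hu, fun h0 => ?_⟩
  have hs := h.diffeo.fderiv_fderiv_symm hz (0, 1, 0)
  set ν := fderiv ℝ φ.symm (φ z) (0, 1, 0)
  have e1 : ν.1 * (fderiv ℝ φ z (1, 0, 0)).1 = 0 := by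
    rw [← h.fst_fderiv_eq hr hz, hs]
  have e2 : ν.1 = 0 := (mul_eq_zero.1 e1).resolve_right (h.fst_fderiv_ne_zero hr hz)
  have e3 := congrArg (fun w : Var => w.2.1) hs
  rw [map_var, e2] at e3
  change 0 * (fderiv ℝ φ z (1, 0, 0)).2.1 + ν.2.1 * Xx + ν.2.2 * Xu = 1 at e3
  rw [h0, hu, zero_mul, mul_zero, mul_zero, add_zero, add_zero] at e3
  exact zero_ne_one e3

end

section

/-! ### Linearity with respect to the unknown function -/

/-- The mean value inequality in the second variable, applied to F(x, θ + w₂) - F(x, θ) - K w₂ θ: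
its θ-derivative is small relative to w₂ by strict differentiability of F_θ, and θ runs over an
interval of radius |w₁|. -/
theorem isLittleO_second_difference {F : ℝ × ℝ → ℝ} {x₀ a : ℝ} (hF : ContDiffAt ℝ ∞ F (x₀, a))
    {w₁ w₂ : ℝ → ℝ} (h₁ : Tendsto w₁ (𝓝 x₀) (𝓝 0)) (h₂ : Tendsto w₂ (𝓝 x₀) (𝓝 0)) :
    (fun x => F (x, a + w₁ x + w₂ x) - F (x, a + w₁ x) - F (x, a + w₂ x) + F (x, a) -
      fderiv ℝ (fun y => fderiv ℝ F y (0, 1)) (x₀, a) (0, 1) * (w₁ x * w₂ x)) =o[𝓝 x₀]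
      fun x => w₁ x * w₂ x := by
  set Fθ : ℝ × ℝ → ℝ := fun y => fderiv ℝ F y (0, 1) with hFθ
  set K := fderiv ℝ Fθ (x₀, a) (0, 1) with hK
  have hFθs : ContDiffAt ℝ ∞ Fθ (x₀, a) :=
    (hF.fderiv_right (m := ∞) le_rfl).clm_apply contDiffAt_const
  have hst := hFθs.hasStrictFDerivAt (by simp)
  rw [isLittleO_iff]
  intro c hc
  have hdiff : ∀ᶠ y in 𝓝 (x₀, a), DifferentiableAt ℝ F y :=
    ((hF.of_le (by exact_mod_cast le_top : (1 : WithTop ℕ∞) ≤ ∞)).eventually (by simp)).mono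
      fun y hy => hy.differentiableAt (by simp)
  have hst' := isLittleO_iff.1 hst.isLittleO hc
  rw [nhds_prod_eq] at hst'
  obtain ⟨s, hs, hss⟩ := (eventually_prod_self_iff (r := fun y y' =>
    ‖Fθ y - Fθ y' - fderiv ℝ Fθ (x₀, a) (y - y')‖ ≤ c * ‖y - y'‖)).1 hst'
  obtain ⟨ε, hε, hb⟩ := Metric.mem_nhds_iff.1 (inter_mem hs hdiff)
  have e₁ : ∀ᶠ x in 𝓝 x₀, |w₁ x| < ε / 2 := by
    have := h₁.abs; rw [abs_zero] at this
    exact this.eventually_lt_const (by linarith)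
  have e₂ : ∀ᶠ x in 𝓝 x₀, |w₂ x| < ε / 2 := by
    have := h₂.abs; rw [abs_zero] at this
    exact this.eventually_lt_const (by linarith)
  filter_upwards [e₁, e₂, Metric.ball_mem_nhds x₀ hε] with x hx₁ hx₂ hx
  have hmem : ∀ θ, |θ - a| < ε → (x, θ) ∈ Metric.ball (x₀, a) ε := by
    intro θ hθ
    rw [Metric.mem_ball, Prod.dist_eq]
    exact max_lt hx (by rwa [Real.dist_eq])
  set g : ℝ → ℝ := fun θ => F (x, θ + w₂ x) - F (x, θ) - K * w₂ x * θ with hg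
  have hFd : ∀ θ, |θ - a| < ε → HasDerivAt (fun θ => F (x, θ)) (Fθ (x, θ)) θ := fun θ hθ =>
    hasDerivAt_slice_snd (p := (x, θ)) (hb (hmem θ hθ)).2
  have hseg : ∀ θ ∈ Metric.closedBall a |w₁ x|, |θ - a| < ε ∧ |θ + w₂ x - a| < ε := by
    intro θ hθ
    rw [Metric.mem_closedBall, Real.dist_eq] at hθ
    refine ⟨by linarith, ?_⟩
    have : |θ + w₂ x - a| ≤ |θ - a| + |w₂ x| := by
      rw [show θ + w₂ x - a = (θ - a) + w₂ x by ring]; exact abs_add_le _ _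
    linarith
  have hgd : ∀ θ ∈ Metric.closedBall a |w₁ x|, HasDerivWithinAt g
      (Fθ (x, θ + w₂ x) - Fθ (x, θ) - K * w₂ x) (Metric.closedBall a |w₁ x|) θ := by
    intro θ hθ
    obtain ⟨k1, k2⟩ := hseg θ hθ
    have d1 : HasDerivAt (fun θ => F (x, θ + w₂ x)) (Fθ (x, θ + w₂ x)) θ :=
      HasDerivAt.comp_add_const θ (w₂ x) (hFd _ k2)
    have d3 : HasDerivAt (fun θ => K * w₂ x * θ) (K * w₂ x) θ := by
      simpa using (hasDerivAt_id θ).const_mul (K * w₂ x)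
    exact ((d1.sub (hFd _ k1)).sub d3).hasDerivWithinAt
  have hbd : ∀ θ ∈ Metric.closedBall a |w₁ x|,
      ‖Fθ (x, θ + w₂ x) - Fθ (x, θ) - K * w₂ x‖ ≤ c * |w₂ x| := by
    intro θ hθ
    obtain ⟨k1, k2⟩ := hseg θ hθ
    have := hss _ (hb (hmem _ k2)).1 _ (hb (hmem _ k1)).1
    have e : ((x, θ + w₂ x) : ℝ × ℝ) - (x, θ) = w₂ x • ((0, 1) : ℝ × ℝ) := by simp
    simp only [e, map_smul, smul_eq_mul, norm_smul] at this
    rw [← hK] at this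
    have hn : ‖((0, 1) : ℝ × ℝ)‖ = 1 := by simp [Prod.norm_def]
    rw [hn, mul_one, mul_comm (w₂ x) K] at this
    exact this
  have hmvt := (convex_closedBall a |w₁ x|).norm_image_sub_le_of_norm_hasDerivWithin_le hgd hbd
    (Metric.mem_closedBall_self (abs_nonneg _)) (y := a + w₁ x) (by simp)
  rw [add_sub_cancel_left] at hmvt
  have e : g (a + w₁ x) - g a = F (x, a + w₁ x + w₂ x) - F (x, a + w₁ x) - F (x, a + w₂ x) +
      F (x, a) - K * (w₁ x * w₂ x) := by
    simp only [hg]; ring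
  rw [← e]
  refine hmvt.trans (le_of_eq ?_)
  simp only [Real.norm_eq_abs, abs_mul]; ring

variable {r : ℕ} {φ : OpenPartialHomeomorph Var Var} {κ κ' : ℝ × ℝ → Kappa r}

/-- Near a point, the new `(t, x)` is a function of the old `(t, x)`. -/
theorem IsAdmissible.exists_ball_base (h : IsAdmissible r φ κ κ') (hr : 2 ≤ r) {z : Var}
    (hz : z ∈ φ.source) : ∃ ε > 0, Metric.ball z ε ⊆ φ.source ∧
      ∀ y ∈ Metric.ball z ε, ∀ y' ∈ Metric.ball z ε, y'.1 = y.1 →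
        (φ y').1 = (φ y).1 ∧ (y'.2.1 = y.2.1 → (φ y').2.1 = (φ y).2.1) := by
  obtain ⟨ε, hε, hb, hc⟩ := h.exists_ball_fst hr hz
  obtain ⟨δ, hδ, hb', hc'⟩ := exists_ball_eq (G := fun y => (φ y).2.1) φ.open_source
    (fun y hy => h.diffeo.differentiableAt_snd hy) hz
  refine ⟨min ε δ, lt_min hε hδ, (Metric.ball_subset_ball (min_le_left _ _)).trans hb,
    fun y hy y' hy' he => ?_⟩
  have s1 := Metric.ball_subset_ball (x := z) (min_le_left ε δ)
  have s2 := Metric.ball_subset_ball (x := z) (min_le_right ε δ)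
  refine ⟨hc y (s1 hy) y' (s1 hy') he, fun he' => hc' y (s2 hy) y' (s2 hy') fun w hw => ?_⟩
  rw [fderiv_snd_comp h.diffeo hw, map_var]
  simp [he, he', (h.snd_fderiv hr hw).1]

/-- With T_x = T_u = X_u = 0, T_t ≠ 0 and X_x ≠ 0, every graph is transversal to the vertical
direction after transformation, so no genericity condition remains. -/
theorem IsAdmissible.exists_transformsAt (h : IsAdmissible r φ κ κ') (hr : 2 ≤ r)
    {u : ℝ × ℝ → ℝ} {p : ℝ × ℝ} (hz : graph u p ∈ φ.source) (hu : ContDiffAt ℝ ∞ u p) :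
    ∃ v, TransformsAt φ u v p := by
  refine BurgersKdV.exists_transformsAt h.diffeo hz hu fun η hη => ?_
  have hT := h.fst_fderiv_ne_zero hr hz
  obtain ⟨hXu, hXx⟩ := h.snd_fderiv hr hz
  obtain ⟨hTx, hTu⟩ := h.fst_fderiv hr hz
  have e1 : (fderiv ℝ φ (graph u p) (tangent u p η)).1 = 0 := congrArg Prod.fst hη
  have e2 : (fderiv ℝ φ (graph u p) (tangent u p η)).2.1 = 0 := congrArg Prod.snd hη
  rw [map_var] at e1 e2
  simp only [Prod.fst_add, Prod.snd_add, Prod.smul_fst, Prod.smul_snd, smul_eq_mul, hTx, hTu,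
    hXu, mul_zero, add_zero] at e1 e2
  have e3 : η.1 = 0 := (mul_eq_zero.1 e1).resolve_right hT
  have e4 : (tangent u p η).1 = 0 := e3
  rw [e4, zero_mul, zero_add] at e2
  exact Prod.ext e3 ((mul_eq_zero.1 e2).resolve_right hXx)

/-- A solution jet with prescribed spatial part `f`, and the relation
that it implies for its image. -/
theorem IsAdmissible.exists_image (h : IsAdmissible r φ κ κ') (hr : 2 ≤ r) {f : ℝ → ℝ}
    (hf : ContDiff ℝ ∞ f) {t₀ x₀ a : ℝ} (hfa : f x₀ = a) (hz : (t₀, x₀, a) ∈ φ.source) :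
    ∃ v : ℝ × ℝ → ℝ, ContDiffAt ℝ ∞ v (base (φ (t₀, x₀, a))) ∧
      (∀ᶠ x in 𝓝 x₀, v ((φ (t₀, x₀, a)).1, (φ (t₀, x, f x)).2.1) = (φ (t₀, x, f x)).2.2) ∧
      (fderiv ℝ φ (t₀, x₀, a) (1, 0, 0)).1 *
          spatial r (κ' (base (φ (t₀, x₀, a)))) (xjet v (base (φ (t₀, x₀, a)))) +
        xjet v (base (φ (t₀, x₀, a))) 1 * (fderiv ℝ φ (t₀, x₀, a) (1, 0, 0)).2.1 =
      (fderiv ℝ φ (t₀, x₀, a) (1, 0, 0)).2.2 + (fderiv ℝ φ (t₀, x₀, a) (0, 0, 1)).2.2 *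
        spatial r (κ (t₀, x₀)) fun j => iteratedDeriv j f x₀ := by
  have hXu := (h.snd_fderiv hr hz).1
  have hTu := (h.fst_fderiv hr hz).2
  set D := fderiv ℝ φ (t₀, x₀, a) with hD
  set p : ℝ × ℝ := (t₀, x₀) with hp
  set α := spatial r (κ p) fun j => iteratedDeriv j f x₀ with hα
  set ψ : ℝ → ℝ := trial 0 α 0 2 t₀ with hψ
  set u := sep f ψ with hu
  have hψ0 : ψ p.1 = 0 := trial_self _ _ _ two_ne_zero _
  have hus : ContDiff ℝ ∞ u := contDiff_sep hf (contDiff_trial _ _ _ _ _)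
  have hval : u p = a := by rw [hu, sep, hψ0, add_zero, ← hfa]
  have hgr : graph u p = (t₀, x₀, a) := by rw [graph, hval]
  have hjet : ∀ j, xjet u p j = iteratedDeriv j f x₀ := fun j => xjet_sep hψ0 j
  have htd : tderiv u p = α := by
    rw [hu, tderiv_sep]; exact deriv_trial_self _ _ _ le_rfl _
  obtain ⟨v, hv⟩ := h.exists_transformsAt hr (p := p) (by rw [hgr]; exact hz)
    hus.contDiffAt
  have hsat : SatisfiesAt r κ u p := by
    rw [satisfiesAt_iff, htd, hα]
    congr 1
    funext j
    exact (hjet j).symm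
  have hs := (h.maps _ _ _ hv).1 hsat
  change SatisfiesAt r κ' v (base (φ (graph u p))) at hs
  have hvs : ContDiffAt ℝ ∞ v (base (φ (graph u p))) := hv.2.2.1
  have hch := hv.fderiv_eq h.diffeo (1, 0)
  rw [hgr] at hs hvs hch
  refine ⟨v, hvs, ?_, ?_⟩
  · obtain ⟨ε, hε, hb, hc⟩ := h.exists_ball_fst hr hz
    have hcont : ContinuousAt (fun y : ℝ => graph u (t₀, y)) x₀ :=
      ContinuousAt.comp (g := graph u) (f := fun y : ℝ => (t₀, y)) (x := x₀)
        (contDiffAt_graph hus.contDiffAt).continuousAt (by fun_prop)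
    have hbm : ∀ᶠ y in 𝓝 x₀, graph u (t₀, y) ∈ Metric.ball ((t₀, x₀, a) : Var) ε := by
      refine hcont (Metric.isOpen_ball.mem_nhds ?_)
      change graph u p ∈ _
      rw [hgr]; exact Metric.mem_ball_self hε
    have hev : ∀ᶠ y in 𝓝 x₀, v (base (φ (graph u (t₀, y)))) = (φ (graph u (t₀, y))).2.2 :=
      (show Tendsto (fun y : ℝ => (t₀, y)) (𝓝 x₀) (𝓝 p) from
        (continuous_const.prodMk continuous_id).tendsto x₀).eventually hv.2.2.2
    filter_upwards [hbm, hev] with x hx hx'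
    have e : graph u (t₀, x) = (t₀, x, f x) := by
      have : ψ t₀ = 0 := hψ0
      simp [graph, hu, sep, this]
    rw [e] at hx hx'
    rw [← hx', base, hc _ (Metric.mem_ball_self hε) _ hx rfl]
  · rw [satisfiesAt_iff] at hs
    rw [fderiv_eq_tderiv_xjet (hvs.differentiableAt (by simp)), hs] at hch
    have htan : tangent u p (1, 0) = (1, 0, α) := by
      rw [tangent_eq (hus.differentiable (by simp) _), htd]; simp
    rw [htan] at hch
    have e : D (1, 0, α) = D (1, 0, 0) + α • D (0, 0, 1) := by
      rw [map_var]; simp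
    rw [← hD, e] at hch
    simp only [base, Prod.fst_add, Prod.snd_add, Prod.smul_fst, Prod.smul_snd, smul_eq_mul, hTu,
      hXu, mul_zero, add_zero] at hch
    simp only [base]
    linarith

/-- The common value c of the functions turns the quadratic term into the linear term c J 1, so the
alternating sum passes through and only the top order is left. -/
theorem spatial_alternating {r : ℕ} (hr : 2 ≤ r) (k : Kappa r) {J₁ J₂ J₃ J₄ : ℕ → ℝ} {c : ℝ}
    (h₁ : J₁ 0 = c) (h₂ : J₂ 0 = c) (h₃ : J₃ 0 = c) (h₄ : J₄ 0 = c)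
    (h : ∀ j < r, J₁ j - J₂ j - J₃ j + J₄ j = 0) :
    spatial r k J₁ - spatial r k J₂ - spatial r k J₃ + spatial r k J₄ =
      lead hr k * (J₁ r - J₂ r - J₃ r + J₄ r) := by
  have hs : (∑ j : Finset.Icc 2 r, k.2.1 j * J₁ j) - (∑ j : Finset.Icc 2 r, k.2.1 j * J₂ j) -
      (∑ j : Finset.Icc 2 r, k.2.1 j * J₃ j) + (∑ j : Finset.Icc 2 r, k.2.1 j * J₄ j) =
      lead hr k * (J₁ r - J₂ r - J₃ r + J₄ r) := by
    rw [← Finset.sum_sub_distrib, ← Finset.sum_sub_distrib, ← Finset.sum_add_distrib,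
      Finset.sum_eq_single (⟨r, Finset.mem_Icc.2 ⟨hr, le_rfl⟩⟩ : Finset.Icc 2 r)]
    · simp only [lead]; ring
    · intro j _ hj
      have h1 : (j : ℕ) ≤ r := (Finset.mem_Icc.1 j.2).2
      have h2 : (j : ℕ) ≠ r := fun h => hj (Subtype.ext h)
      linear_combination k.2.1 j * h j (by omega)
    · simp
  simp only [spatial]
  rw [h₁, h₂, h₃, h₄]
  linear_combination hs - c * h 1 (by omega)

theorem hasStrictDerivAt_slice_snd {φ : OpenPartialHomeomorph Var Var} (hφ : IsDiffeo φ)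
    {t₀ x₀ a : ℝ} (hz : (t₀, x₀, a) ∈ φ.source) :
    HasStrictDerivAt (fun x => (φ (t₀, x, a)).2.1) (fderiv ℝ φ (t₀, x₀, a) (0, 1, 0)).2.1 x₀ := by
  have h1 : HasStrictDerivAt (fun x : ℝ => ((t₀, x, a) : Var)) (0, 1, 0) x₀ :=
    (hasStrictDerivAt_const _ _).prodMk ((hasStrictDerivAt_id _).prodMk (hasStrictDerivAt_const _ _))
  have h2 := ((hφ.contDiffAt hz).hasStrictFDerivAt (by simp)).comp_hasStrictDerivAt x₀ h1
  exact ((ContinuousLinearMap.fst ℝ ℝ ℝ).comp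
    (ContinuousLinearMap.snd ℝ ℝ (ℝ × ℝ))).hasStrictFDerivAt.comp_hasStrictDerivAt x₀ h2

theorem hasFDerivAt_section (t₀ : ℝ) (y : ℝ × ℝ) :
    HasFDerivAt (fun y : ℝ × ℝ => ((t₀, y) : Var)) (ContinuousLinearMap.inr ℝ ℝ (ℝ × ℝ)) y := by
  exact hasFDerivAt_prodMk_right t₀ y

theorem fderiv_comp_section {G : Var → ℝ} {t₀ : ℝ} {y : ℝ × ℝ}
    (hG : DifferentiableAt ℝ G (t₀, y)) (w : ℝ × ℝ) :
    fderiv ℝ (fun y : ℝ × ℝ => G (t₀, y)) y w = fderiv ℝ G (t₀, y) (0, w) := by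
  have := HasFDerivAt.comp (g := G) y hG.hasFDerivAt (hasFDerivAt_section t₀ y)
  rw [show (fun y : ℝ × ℝ => G (t₀, y)) = G ∘ fun y => (t₀, y) from rfl, this.fderiv]
  rfl

theorem IsDiffeo.contDiffAt_fderiv_thd {φ : OpenPartialHomeomorph Var Var} (hφ : IsDiffeo φ)
    {z : Var} (hz : z ∈ φ.source) (w : Var) :
    ContDiffAt ℝ ∞ (fun y => (fderiv ℝ φ y w).2.2) z :=
  (((hφ.contDiffAt hz).fderiv_right (m := ∞) le_rfl).clm_apply contDiffAt_const).snd.snd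

/-- The four spatial parts a + b (x - x₀) + s (x - x₀)^(r - 1), b, s ∈ {0, 1}, have zero alternating
sum. The alternating sum of their images is U_uu (x - x₀)^r to leading order, hence invisible to all
derivatives below order r and multiplied by the nonzero leading coefficient at order r. -/
theorem IsAdmissible.fderiv_fderiv_thd (h : IsAdmissible r φ κ κ') (hr : 2 ≤ r) {z : Var}
    (hz : z ∈ φ.source) :
    fderiv ℝ (fun y => (fderiv ℝ φ y (0, 0, 1)).2.2) z (0, 0, 1) = 0 := by
  obtain ⟨ε, hε, hball, hloc⟩ := h.exists_ball_base hr hz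
  have hT := h.fst_fderiv_ne_zero hr hz
  have hXx := (h.snd_fderiv hr hz).2
  have hl' := h.lead_ne' hr hz
  obtain ⟨t₀, x₀, a⟩ := z
  set F : ℝ × ℝ → ℝ := fun y => (φ (t₀, y)).2.2 with hFdef
  have hFs : ContDiffAt ℝ ∞ F (x₀, a) :=
    (ContDiffAt.comp (g := φ) (f := fun y : ℝ × ℝ => ((t₀, y) : Var)) (x₀, a)
      (h.diffeo.contDiffAt hz) (contDiffAt_const.prodMk contDiffAt_id)).snd.snd
  set K := fderiv ℝ (fun y => fderiv ℝ F y (0, 1)) (x₀, a) (0, 1) with hK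
  have hKeq : K = fderiv ℝ (fun y => (fderiv ℝ φ y (0, 0, 1)).2.2) (t₀, x₀, a) (0, 0, 1) := by
    have h1 := fderiv_comp_section (G := fun y => (fderiv ℝ φ y (0, 0, 1)).2.2) (t₀ := t₀)
      (y := (x₀, a)) ((h.diffeo.contDiffAt_fderiv_thd hz _).differentiableAt (by simp)) (0, 1)
    rw [← h1, hK]
    congr 1
    refine Filter.EventuallyEq.fderiv_eq ?_
    have hev : ∀ᶠ y : ℝ × ℝ in 𝓝 (x₀, a), ((t₀, y) : Var) ∈ φ.source :=
      (show ContinuousAt (fun y : ℝ × ℝ => ((t₀, y) : Var)) (x₀, a) by fun_prop)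
        (φ.open_source.mem_nhds hz)
    filter_upwards [hev] with y hy
    have h2 := fderiv_comp_section (G := fun y => (φ y).2.2) (t₀ := t₀) (y := y)
      (h.diffeo.differentiableAt_thd hy) (0, 1)
    rw [h2, fderiv_thd_comp h.diffeo hy]
  rw [← hKeq]
  -- the four trial functions
  set f : ℝ → ℝ → ℝ → ℝ := fun b s => trial a b s (r - 1) x₀ with hf
  have hr1 : r - 1 ≠ 0 := by omega
  have hf0 : ∀ b s, f b s x₀ = a := fun b s => trial_self _ _ _ hr1 _
  have hfs : ∀ b s, ContDiff ℝ ∞ (f b s) := fun b s => contDiff_trial _ _ _ _ _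
  have hv := fun b s => h.exists_image hr (hfs b s) (hf0 b s) hz
  choose v hvs hvf hvr using hv
  set p' := base (φ (t₀, x₀, a)) with hp'
  set χ : ℝ → ℝ := fun x => (φ (t₀, x, a)).2.1 with hχ
  have hχd : HasStrictDerivAt χ _ x₀ := hasStrictDerivAt_slice_snd h.diffeo hz
  set d : ℝ → ℝ := fun y => v 1 1 (p'.1, y) - v 1 0 (p'.1, y) - v 0 1 (p'.1, y) + v 0 0 (p'.1, y)
    with hd
  have hslice : ∀ b s, ∀ᶠ x in 𝓝 x₀, v b s (p'.1, χ x) = F (x, f b s x) := by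
    intro b s
    have hc : ContinuousAt (fun x => ((t₀, x, f b s x) : Var)) x₀ := by
      have := (hfs b s).continuous
      fun_prop
    have hc' : ContinuousAt (fun x => ((t₀, x, a) : Var)) x₀ := by fun_prop
    have m1 : ∀ᶠ x in 𝓝 x₀, ((t₀, x, f b s x) : Var) ∈ Metric.ball ((t₀, x₀, a) : Var) ε := by
      refine hc (Metric.isOpen_ball.mem_nhds ?_)
      change ((t₀, x₀, f b s x₀) : Var) ∈ _
      rw [hf0]; exact Metric.mem_ball_self hε
    have m2 : ∀ᶠ x in 𝓝 x₀, ((t₀, x, a) : Var) ∈ Metric.ball ((t₀, x₀, a) : Var) ε :=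
      hc' (Metric.ball_mem_nhds _ hε)
    filter_upwards [m1, m2, hvf b s] with x h1 h2 h3
    have e : (φ (t₀, x, f b s x)).2.1 = χ x := (hloc _ h2 _ h1 rfl).2 rfl
    rw [e] at h3
    exact h3
  -- The exponents 1 and r - 1 make the product of the increments exactly (x - x₀)^r.
  have hsd := isLittleO_second_difference hFs (w₁ := fun x => x - x₀)
    (w₂ := fun x => (x - x₀) ^ (r - 1))
    (by have : ContinuousAt (fun x => x - x₀) x₀ := by fun_prop
        simpa [ContinuousAt] using this)
    (by have : ContinuousAt (fun x => (x - x₀) ^ (r - 1)) x₀ := by fun_prop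
        simpa [ContinuousAt, hr1] using this)
  have hpow : ∀ x, (x - x₀) * (x - x₀) ^ (r - 1) = (x - x₀) ^ r := by
    intro x; rw [← pow_succ']; congr 1; omega
  simp only [hpow] at hsd
  have hlead : HasLeading (fun x => d (χ x)) x₀ r K := by
    have h0 : HasLeading (fun x => F (x, a + (x - x₀) + (x - x₀) ^ (r - 1)) - F (x, a + (x - x₀)) -
      F (x, a + (x - x₀) ^ (r - 1)) + F (x, a)) x₀ r K := hsd
    refine h0.congr ?_
    filter_upwards [hslice 1 1, hslice 1 0, hslice 0 1, hslice 0 0] with x h1 h2 h3 h4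
    simp only [hd, h1, h2, h3, h4, hf, trial]
    simp
  have hlead' := hlead.of_comp hχd hXx
  have hn : ∀ n : ℕ, (n : WithTop ℕ∞) ≤ ∞ := fun n => by exact_mod_cast le_top
  have hsl : ∀ (n : ℕ) b s, ContDiffAt ℝ n (fun y => v b s (p'.1, y)) p'.2 := fun n b s =>
    contDiffAt_slice_snd ((hvs b s).of_le (hn n))
  have hdj : ∀ j, iteratedDeriv j d p'.2 =
      xjet (v 1 1) p' j - xjet (v 1 0) p' j - xjet (v 0 1) p' j + xjet (v 0 0) p' j := by
    intro j
    have s1 := hsl j 1 1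
    have s2 := hsl j 1 0
    have s3 := hsl j 0 1
    have s4 := hsl j 0 0
    simp only [hd]
    rw [iteratedDeriv_fun_add ((s1.sub s2).sub s3) s4, iteratedDeriv_fun_sub (s1.sub s2) s3,
      iteratedDeriv_fun_sub s1 s2]
    rfl
  have hdval := fun j (hj : j ≤ r) => hlead'.iteratedDeriv_eq
    ((((hsl r 1 1).sub (hsl r 1 0)).sub (hsl r 0 1)).add (hsl r 0 0)) hj
  change ∀ j ≤ r, iteratedDeriv j d p'.2 = _ at hdval
  have hv0 : ∀ b s, xjet (v b s) p' 0 = F (x₀, a) := by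
    intro b s
    rw [xjet_zero]
    have := (hslice b s).self_of_nhds
    rw [hf0] at this
    exact this
  have e1 := spatial_alternating hr (κ' p') (hv0 1 1) (hv0 1 0) (hv0 0 1) (hv0 0 0) (by
    intro j hj
    rw [← hdj, hdval j hj.le, if_neg hj.ne])
  have e2 := spatial_alternating hr (κ (t₀, x₀)) (c := a)
    (J₁ := fun j => iteratedDeriv j (f 1 1) x₀) (J₂ := fun j => iteratedDeriv j (f 1 0) x₀)
    (J₃ := fun j => iteratedDeriv j (f 0 1) x₀) (J₄ := fun j => iteratedDeriv j (f 0 0) x₀)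
    (by simp [hf0]) (by simp [hf0]) (by simp [hf0]) (by simp [hf0]) (by
      intro j _
      simp only [hf, iteratedDeriv_trial]
      ring)
  rw [← hdj, hdval r le_rfl, if_pos rfl] at e1
  have e3 : iteratedDeriv r (f 1 1) x₀ - iteratedDeriv r (f 1 0) x₀ - iteratedDeriv r (f 0 1) x₀ +
      iteratedDeriv r (f 0 0) x₀ = 0 := by
    simp only [hf, iteratedDeriv_trial]
    ring
  have e4 : xjet (v 1 1) p' 1 - xjet (v 1 0) p' 1 - xjet (v 0 1) p' 1 + xjet (v 0 0) p' 1 = 0 := by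
    rw [← hdj, hdval 1 (by omega), if_neg (by omega)]
  rw [e3, mul_zero] at e2
  have e5 : (fderiv ℝ φ (t₀, x₀, a) (1, 0, 0)).1 * (lead hr (κ' p') *
      (r.factorial * (K / (fderiv ℝ φ (t₀, x₀, a) (0, 1, 0)).2.1 ^ r))) = 0 := by
    linear_combination hvr 1 1 - hvr 1 0 - hvr 0 1 + hvr 0 0 -
      (fderiv ℝ φ (t₀, x₀, a) (1, 0, 0)).1 * e1 +
      (fderiv ℝ φ (t₀, x₀, a) (0, 0, 1)).2.2 * e2 -
      (fderiv ℝ φ (t₀, x₀, a) (1, 0, 0)).2.1 * e4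
  have hfac : (r.factorial : ℝ) ≠ 0 := by positivity
  have e6 := (mul_eq_zero.1 ((mul_eq_zero.1 ((mul_eq_zero.1 e5).resolve_left hT)).resolve_left
    hl')).resolve_left hfac
  exact (div_eq_zero_iff.1 e6).resolve_right (pow_ne_zero _ hXx)

end

/-! ### Affinity in u and the remaining determining relations -/

section

variable {r : ℕ} {φ : OpenPartialHomeomorph Var Var} {κ κ' : ℝ × ℝ → Kappa r}

/-- The derivative of the new `u` with respect to the old `u`. -/
noncomputable def slope (φ : OpenPartialHomeomorph Var Var) (y : Var) : ℝ :=
  (fderiv ℝ φ y (0, 0, 1)).2.2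

theorem IsDiffeo.contDiffAt_slope (hφ : IsDiffeo φ) {z : Var} (hz : z ∈ φ.source) :
    ContDiffAt ℝ ∞ (slope φ) z := hφ.contDiffAt_fderiv_thd hz _

theorem IsAdmissible.fderiv_thd (h : IsAdmissible r φ κ κ') (hr : 2 ≤ r) {z : Var}
    (hz : z ∈ φ.source) : fderiv ℝ φ z (0, 0, 1) = (0, 0, slope φ z) :=
  Prod.ext (h.fst_fderiv hr hz).2 (Prod.ext (h.snd_fderiv hr hz).1 rfl)

theorem IsAdmissible.slope_ne_zero (h : IsAdmissible r φ κ κ') (hr : 2 ≤ r) {z : Var}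
    (hz : z ∈ φ.source) : slope φ z ≠ 0 := by
  intro h0
  have h1 := h.fderiv_thd hr hz
  rw [h0] at h1
  have h2 := h.diffeo.eq_zero_of_fderiv hz h1
  exact one_ne_zero (congrArg (fun w : Var => w.2.2) h2)

/-- Near a point, the transformation is affine in `u`. -/
theorem IsAdmissible.exists_ball_affine (h : IsAdmissible r φ κ κ') (hr : 2 ≤ r) {z : Var}
    (hz : z ∈ φ.source) : ∃ ε > 0, Metric.ball z ε ⊆ φ.source ∧
      (∀ y ∈ Metric.ball z ε, ∀ y' ∈ Metric.ball z ε, y'.1 = y.1 → (φ y').1 = (φ y).1) ∧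
      ∀ y ∈ Metric.ball z ε, ∀ y' ∈ Metric.ball z ε, y'.1 = y.1 → y'.2.1 = y.2.1 →
        slope φ y' = slope φ y ∧
        φ y' = φ y + (y'.2.2 - y.2.2) • ((0, 0, slope φ y) : Var) := by
  obtain ⟨ε, hε, hb, hc⟩ := h.exists_ball_base hr hz
  obtain ⟨δ, hδ, hb', hc'⟩ := exists_ball_eq (G := slope φ) φ.open_source
    (fun y hy => (h.diffeo.contDiffAt_slope hy).differentiableAt (by simp)) hz
  have s1 := Metric.ball_subset_ball (x := z) (min_le_left ε δ)
  have s2 := Metric.ball_subset_ball (x := z) (min_le_right ε δ)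
  have hsl : ∀ y ∈ Metric.ball z (min ε δ), ∀ y' ∈ Metric.ball z (min ε δ), y'.1 = y.1 →
      y'.2.1 = y.2.1 → slope φ y' = slope φ y := by
    intro y hy y' hy' e1 e2
    refine hc' y (s2 hy) y' (s2 hy') fun w hw => ?_
    have : fderiv ℝ (slope φ) w (0, 0, 1) = 0 := h.fderiv_fderiv_thd hr hw
    rw [map_var, this]
    simp [e1, e2]
  refine ⟨min ε δ, lt_min hε hδ, s1.trans hb, fun y hy y' hy' e1 => (hc y (s1 hy) y' (s1 hy') e1).1,
    fun y hy y' hy' e1 e2 => ⟨hsl y hy y' hy' e1 e2, ?_⟩⟩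
  have hyy : y' - y = (y'.2.2 - y.2.2) • ((0, 0, 1) : Var) := by
    ext <;> simp [e1, e2]
  set c := y'.2.2 - y.2.2 with hcdef
  have hmem : ∀ s ∈ Set.Icc (0 : ℝ) 1, y + s • (y' - y) ∈ Metric.ball z (min ε δ) := fun s hs =>
    (convex_ball z _).add_smul_sub_mem hy hy' hs
  have hd : ∀ s ∈ Set.Icc (0 : ℝ) 1,
      HasDerivAt (fun s : ℝ => (φ (y + s • (y' - y))).2.2 - c * slope φ y * s) 0 s := by
    intro s hs
    have h1 : HasDerivAt (fun s : ℝ => y + s • (y' - y)) (y' - y) s := by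
      simpa using ((hasDerivAt_id s).smul_const (y' - y)).const_add y
    have hm := hb (s1 (hmem s hs))
    have h2 := (h.diffeo.differentiableAt_thd hm).hasFDerivAt.comp_hasDerivAt s h1
    have h3 := h2.sub ((hasDerivAt_id s).const_mul (c * slope φ y))
    have h4 : slope φ (y + s • (y' - y)) = slope φ y :=
      hsl y hy _ (hmem s hs) (by simp [hyy]) (by simp [hyy])
    convert! h3 using 1
    rw [fderiv_thd_comp h.diffeo hm, hyy, map_smul, ← hyy, h.fderiv_thd hr hm, h4]
    simp
  have h3 := (convex_Icc (0 : ℝ) 1).norm_image_sub_le_of_norm_hasDerivWithin_le (C := 0)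
    (fun s hs => (hd s hs).hasDerivWithinAt) (by simp) (Set.left_mem_Icc.2 zero_le_one)
    (Set.right_mem_Icc.2 zero_le_one)
  simp only [zero_smul, add_zero, one_smul, add_sub_cancel, zero_mul, norm_le_zero_iff, mul_one,
    mul_zero, sub_zero] at h3
  obtain ⟨g1, g2⟩ := hc y (s1 hy) y' (s1 hy') e1
  refine Prod.ext ?_ (Prod.ext ?_ ?_)
  · simp [g1]
  · simp [g2 e2]
  · simp only [Prod.snd_add, Prod.smul_snd, smul_eq_mul]
    linarith

/-- The linear part of the right-hand side of the equation. -/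
def linPart (r : ℕ) (k : Kappa r) (J : ℕ → ℝ) : ℝ :=
  (∑ j : Finset.Icc 2 r, k.2.1 j * J j) + k.1 * J 0

theorem spatial_eq (k : Kappa r) (J : ℕ → ℝ) :
    spatial r k J = linPart r k J + k.2.2 - J 0 * J 1 := rfl

theorem linPart_comb (k : Kappa r) (J J₁ J₂ : ℕ → ℝ) (e b : ℝ) :
    linPart r k (fun j => J j + e * J₁ j + b * J₂ j) =
      linPart r k J + e * linPart r k J₁ + b * linPart r k J₂ := by
  have : ∑ j : Finset.Icc 2 r, k.2.1 j * (J j + e * J₁ j + b * J₂ j) =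
      (∑ j : Finset.Icc 2 r, k.2.1 j * J j) + e * (∑ j : Finset.Icc 2 r, k.2.1 j * J₁ j) +
        b * ∑ j : Finset.Icc 2 r, k.2.1 j * J₂ j := by
    rw [Finset.mul_sum, Finset.mul_sum, ← Finset.sum_add_distrib, ← Finset.sum_add_distrib]
    exact Finset.sum_congr rfl fun j _ => by ring
  simp only [linPart, this]
  ring

/-- The gauge A¹ = 0 enters here: the sum starts at order 2, so a first derivative contributes
nothing to the linear part. -/
theorem linPart_eq_of_vanish (k : Kappa r) {J : ℕ → ℝ} (h : ∀ j, 2 ≤ j → J j = 0) :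
    linPart r k J = k.1 * J 0 := by
  rw [linPart, Finset.sum_eq_zero, zero_add]
  intro j _
  rw [h j (Finset.mem_Icc.1 j.2).1, mul_zero]

theorem hasDerivAt_comp_snd {F : Type*} [NormedAddCommGroup F] [NormedSpace ℝ F] {G : Var → F}
    {t₀ x₀ a : ℝ} (hG : DifferentiableAt ℝ G (t₀, x₀, a)) :
    HasDerivAt (fun x => G (t₀, x, a)) (fderiv ℝ G (t₀, x₀, a) (0, 1, 0)) x₀ :=
  HasFDerivAt.comp_hasDerivAt (l := G) (f := fun x : ℝ => ((t₀, x, a) : Var)) x₀ hG.hasFDerivAt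
    ((hasDerivAt_const _ _).prodMk ((hasDerivAt_id _).prodMk (hasDerivAt_const _ _)))

theorem hasDerivAt_comp_fst {F : Type*} [NormedAddCommGroup F] [NormedSpace ℝ F] {G : Var → F}
    {t₀ x₀ a : ℝ} (hG : DifferentiableAt ℝ G (t₀, x₀, a)) :
    HasDerivAt (fun t => G (t, x₀, a)) (fderiv ℝ G (t₀, x₀, a) (1, 0, 0)) t₀ :=
  HasFDerivAt.comp_hasDerivAt (l := G) (f := fun t : ℝ => ((t, x₀, a) : Var)) t₀ hG.hasFDerivAt
    ((hasDerivAt_id _).prodMk ((hasDerivAt_const _ _).prodMk (hasDerivAt_const _ _)))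

/-- The relations obtained from the solution jets with spatial parts `a + e + b (x - x₀)`. -/
theorem IsAdmissible.exists_family (h : IsAdmissible r φ κ κ') (hr : 2 ≤ r) {t₀ x₀ a : ℝ}
    (hz : (t₀, x₀, a) ∈ φ.source) :
    ∃ (δ : ℝ) (ρ π θ : ℕ → ℝ) (Θ : ℝ → ℝ), 0 < δ ∧
      ρ 0 = (φ (t₀, x₀, a)).2.2 ∧ π 0 = slope φ (t₀, x₀, a) ∧ θ 0 = 0 ∧
      π 1 * (fderiv ℝ φ (t₀, x₀, a) (0, 1, 0)).2.1 =
        fderiv ℝ (slope φ) (t₀, x₀, a) (0, 1, 0) ∧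
      θ 1 * (fderiv ℝ φ (t₀, x₀, a) (0, 1, 0)).2.1 = slope φ (t₀, x₀, a) ∧
      (∀ j, θ j = iteratedDeriv j Θ (φ (t₀, x₀, a)).2.1) ∧
      (∀ᶠ x in 𝓝 x₀, Θ (φ (t₀, x, a)).2.1 = slope φ (t₀, x, a) * (x - x₀)) ∧
      ∀ e, |e| ≤ δ → ∀ b,
        (fderiv ℝ φ (t₀, x₀, a) (1, 0, 0)).1 * spatial r (κ' (base (φ (t₀, x₀, a))))
            (fun j => ρ j + e * π j + b * θ j) +
          (ρ 1 + e * π 1 + b * θ 1) * (fderiv ℝ φ (t₀, x₀, a) (1, 0, 0)).2.1 =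
        (fderiv ℝ φ (t₀, x₀, a) (1, 0, 0)).2.2 + e * fderiv ℝ (slope φ) (t₀, x₀, a) (1, 0, 0) +
          slope φ (t₀, x₀, a) * ((κ (t₀, x₀)).1 * (a + e) + (κ (t₀, x₀)).2.2 - (a + e) * b) := by
  have hXx := (h.snd_fderiv hr hz).2
  obtain ⟨ε, hε, hball, hTloc, hloc⟩ := h.exists_ball_affine hr hz
  set z : Var := (t₀, x₀, a) with hzdef
  set δ := ε / 2 with hδ
  have hδ0 : 0 < δ := by positivity
  have hmem : ∀ e, |e| ≤ δ → ((t₀, x₀, a + e) : Var) ∈ Metric.ball z ε := by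
    intro e he
    rw [Metric.mem_ball, Prod.dist_eq, Prod.dist_eq]
    simp only [hzdef, dist_self, Real.dist_eq, add_sub_cancel_left]
    rw [max_lt_iff, max_lt_iff]
    exact ⟨hε, hε, by linarith⟩
  have hzb : z ∈ Metric.ball z ε := Metric.mem_ball_self hε
  have hφe : ∀ e, |e| ≤ δ → φ (t₀, x₀, a + e) = φ z + e • ((0, 0, slope φ z) : Var) := by
    intro e he
    have := (hloc z hzb _ (hmem e he) rfl rfl).2
    simpa [hzdef] using this
  have hbase : ∀ e, |e| ≤ δ → base (φ (t₀, x₀, a + e)) = base (φ z) := by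
    intro e he; rw [hφe e he]; simp [base]
  have hslope : ∀ e, |e| ≤ δ → slope φ (t₀, x₀, a + e) = slope φ z := fun e he =>
    (hloc z hzb _ (hmem e he) rfl rfl).1
  have hDe : ∀ e, |e| ≤ δ → fderiv ℝ φ (t₀, x₀, a + e) (1, 0, 0) =
      fderiv ℝ φ z (1, 0, 0) + e • ((0, 0, fderiv ℝ (slope φ) z (1, 0, 0)) : Var) := by
    intro e he
    have d1 := hasDerivAt_comp_fst (G := φ) (h.diffeo.differentiableAt (hball (hmem e he)))
    have d2 := hasDerivAt_comp_fst (G := φ) (h.diffeo.differentiableAt hz)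
    have d3 := hasDerivAt_comp_fst (G := slope φ)
      ((h.diffeo.contDiffAt_slope hz).differentiableAt (by simp))
    have d4 : HasDerivAt (fun t => φ (t, x₀, a) + e • ((0, 0, slope φ (t, x₀, a)) : Var))
        (fderiv ℝ φ z (1, 0, 0) + e • ((0, 0, fderiv ℝ (slope φ) z (1, 0, 0)) : Var)) t₀ :=
      d2.add (((hasDerivAt_const _ _).prodMk ((hasDerivAt_const _ _).prodMk d3)).const_smul e)
    refine d1.unique (d4.congr_of_eventuallyEq ?_)
    have c1 : ∀ᶠ t in 𝓝 t₀, ((t, x₀, a + e) : Var) ∈ Metric.ball z ε :=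
      (show ContinuousAt (fun t : ℝ => ((t, x₀, a + e) : Var)) t₀ by fun_prop)
        (Metric.isOpen_ball.mem_nhds (hmem e he))
    have c2 : ∀ᶠ t in 𝓝 t₀, ((t, x₀, a) : Var) ∈ Metric.ball z ε :=
      (show ContinuousAt (fun t : ℝ => ((t, x₀, a) : Var)) t₀ by fun_prop)
        (Metric.isOpen_ball.mem_nhds hzb)
    filter_upwards [c1, c2] with t h1 h2
    have := (hloc _ h2 _ h1 rfl rfl).2
    simpa using this
  set f : ℝ → ℝ → ℝ → ℝ := fun e b => trial (a + e) b 0 2 x₀ with hf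
  have hfs : ∀ e b, ContDiff ℝ ∞ (f e b) := fun e b => contDiff_trial _ _ _ _ _
  have hf0 : ∀ e b, f e b x₀ = a + e := fun e b => trial_self _ _ _ two_ne_zero _
  -- The bound on e keeps the shifted point in the ball where φ is affine in u; outside this range v
  -- is the dummy function 0.
  have hex : ∀ e b, ∃ v : ℝ × ℝ → ℝ, |e| ≤ δ → _ := fun e b => by
    by_cases he : |e| ≤ δ
    · exact (h.exists_image hr (hfs e b) (hf0 e b) (hball (hmem e he))).imp fun v hv _ => hv
    · exact ⟨0, fun h => absurd h he⟩
  choose v hv using hex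
  set p' := base (φ z) with hp'
  set χ : ℝ → ℝ := fun x => (φ (t₀, x, a)).2.1 with hχ
  have hχd : HasStrictDerivAt χ (fderiv ℝ φ z (0, 1, 0)).2.1 x₀ :=
    hasStrictDerivAt_slice_snd h.diffeo hz
  set R : ℝ → ℝ := fun x => (φ (t₀, x, a)).2.2 with hR
  set P : ℝ → ℝ := fun x => slope φ (t₀, x, a) with hP
  have hvs : ∀ e, |e| ≤ δ → ∀ b, ContDiffAt ℝ ∞ (v e b) p' := by
    intro e he b
    have := (hv e b he).1
    rwa [hbase e he] at this
  have hslice : ∀ e, |e| ≤ δ → ∀ b, ∀ᶠ x in 𝓝 x₀,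
      v e b (p'.1, χ x) = R x + P x * (e + b * (x - x₀)) := by
    intro e he b
    have hc : ContinuousAt (fun x => ((t₀, x, f e b x) : Var)) x₀ := by
      have := (hfs e b).continuous
      fun_prop
    have m1 : ∀ᶠ x in 𝓝 x₀, ((t₀, x, f e b x) : Var) ∈ Metric.ball z ε := by
      refine hc (Metric.isOpen_ball.mem_nhds ?_)
      change ((t₀, x₀, f e b x₀) : Var) ∈ _
      rw [hf0]; exact hmem e he
    have m2 : ∀ᶠ x in 𝓝 x₀, ((t₀, x, a) : Var) ∈ Metric.ball z ε :=
      (show ContinuousAt (fun x : ℝ => ((t₀, x, a) : Var)) x₀ by fun_prop)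
        (Metric.ball_mem_nhds _ hε)
    filter_upwards [m1, m2, (hv e b he).2.1] with x h1 h2 h3
    have e1 := (hloc _ h2 _ h1 rfl rfl).2
    have e2 : (base (φ (t₀, x₀, a + e))).1 = p'.1 := congrArg Prod.fst (hbase e he)
    change (φ (t₀, x₀, a + e)).1 = p'.1 at e2
    rw [e1, e2] at h3
    simp only [Prod.snd_add, Prod.fst_add, Prod.smul_snd, Prod.smul_fst, smul_eq_mul, mul_zero,
      add_zero] at h3
    rw [h3]
    simp only [hf, trial, hR, hP]
    ring
  have h00 : |(0 : ℝ)| ≤ δ := by rw [abs_zero]; exact hδ0.le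
  have hδδ : |δ| ≤ δ := by rw [abs_of_pos hδ0]
  -- By affinity in u, the image of a + e + b (x - x₀) is R + e P + b P (x - x₀) on the slice. The
  -- three coefficients, as functions of the new x, are recovered from the images at (e, b) = (0,
  -- 0), (δ, 0), (0, 1), which also gives their smoothness.
  set ρs : ℝ → ℝ := fun y => v 0 0 (p'.1, y) with hρs
  set πs : ℝ → ℝ := fun y => δ⁻¹ * (v δ 0 (p'.1, y) - v 0 0 (p'.1, y)) with hπs
  set θs : ℝ → ℝ := fun y => v 0 1 (p'.1, y) - v 0 0 (p'.1, y) with hθs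
  have hsm : ∀ e, |e| ≤ δ → ∀ b, ContDiffAt ℝ ∞ (fun y => v e b (p'.1, y)) p'.2 := fun e he b =>
    contDiffAt_slice_snd (hvs e he b)
  have hρsm : ContDiffAt ℝ ∞ ρs p'.2 := hsm 0 h00 0
  have hπsm : ContDiffAt ℝ ∞ πs p'.2 := contDiffAt_const.mul ((hsm δ hδδ 0).sub (hsm 0 h00 0))
  have hθsm : ContDiffAt ℝ ∞ θs p'.2 := (hsm 0 h00 1).sub (hsm 0 h00 0)
  have hρc : ∀ᶠ x in 𝓝 x₀, ρs (χ x) = R x := by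
    filter_upwards [hslice 0 h00 0] with x hx
    simp only [hρs, hx]; ring
  have hπc : ∀ᶠ x in 𝓝 x₀, πs (χ x) = P x := by
    filter_upwards [hslice 0 h00 0, hslice δ hδδ 0] with x hx hx'
    simp only [hπs, hx, hx']; field_simp; ring
  have hθc : ∀ᶠ x in 𝓝 x₀, θs (χ x) = P x * (x - x₀) := by
    filter_upwards [hslice 0 h00 0, hslice 0 h00 1] with x hx hx'
    simp only [hθs, hx, hx']; ring
  have hχ0 : χ x₀ = p'.2 := rfl
  have hjet : ∀ e, |e| ≤ δ → ∀ b j, xjet (v e b) p' j =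
      iteratedDeriv j ρs p'.2 + e * iteratedDeriv j πs p'.2 + b * iteratedDeriv j θs p'.2 := by
    intro e he b j
    have hn : (j : WithTop ℕ∞) ≤ ∞ := by exact_mod_cast le_top
    have hev : (fun y => v e b (p'.1, y)) =ᶠ[𝓝 p'.2] fun y => ρs y + e * πs y + b * θs y := by
      rw [← hχ0, ← hχd.map_nhds_eq hXx]
      refine eventually_map.2 ?_
      filter_upwards [hslice e he b, hρc, hπc, hθc] with x h1 h2 h3 h4
      rw [h1, h2, h3, h4]; ring
    have g1 := hρsm.of_le hn
    have g2 := hπsm.of_le hn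
    have g3 := hθsm.of_le hn
    rw [xjet, hev.iteratedDeriv_eq, iteratedDeriv_fun_add
      (g1.add (contDiffAt_const.mul g2)) (contDiffAt_const.mul g3),
      iteratedDeriv_fun_add g1 (contDiffAt_const.mul g2), iteratedDeriv_const_mul _ g2,
      iteratedDeriv_const_mul _ g3]
  have hPd : HasDerivAt P (fderiv ℝ (slope φ) z (0, 1, 0)) x₀ :=
    hasDerivAt_comp_snd ((h.diffeo.contDiffAt_slope hz).differentiableAt (by simp))
  refine ⟨δ, fun j => iteratedDeriv j ρs p'.2, fun j => iteratedDeriv j πs p'.2,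
    fun j => iteratedDeriv j θs p'.2, θs, hδ0, ?_, ?_, ?_, ?_, ?_, fun j => rfl, hθc, ?_⟩
  · simp only [iteratedDeriv_zero]; exact hρc.self_of_nhds
  · simp only [iteratedDeriv_zero]; exact hπc.self_of_nhds
  · simp only [iteratedDeriv_zero]
    have := hθc.self_of_nhds
    rw [sub_self, mul_zero] at this
    exact this
  · simp only [iteratedDeriv_one]
    have d1 : HasDerivAt (fun x => πs (χ x)) _ x₀ := HasDerivAt.comp x₀ (h₂ := πs)
      ((hπsm.differentiableAt (by simp)).hasDerivAt) hχd.hasDerivAt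
    exact (d1.congr_of_eventuallyEq (EventuallyEq.symm hπc)).unique hPd
  · simp only [iteratedDeriv_one]
    have d1 : HasDerivAt (fun x => θs (χ x)) _ x₀ := HasDerivAt.comp x₀ (h₂ := θs)
      ((hθsm.differentiableAt (by simp)).hasDerivAt) hχd.hasDerivAt
    have d2 : HasDerivAt (fun x => P x * (x - x₀)) (slope φ z) x₀ := by
      have := hPd.fun_mul ((hasDerivAt_id x₀).sub_const x₀)
      simp only [id, sub_self, mul_zero, mul_one, zero_add] at this
      exact this
    exact (d1.congr_of_eventuallyEq (EventuallyEq.symm hθc)).unique d2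
  · intro e he b
    have hrel := (hv e b he).2.2
    rw [hbase e he, hDe e he] at hrel
    have hsl : (fderiv ℝ φ (t₀, x₀, a + e) (0, 0, 1)).2.2 = slope φ z := hslope e he
    have hj : xjet (v e b) p' = fun j => iteratedDeriv j ρs p'.2 + e * iteratedDeriv j πs p'.2 +
        b * iteratedDeriv j θs p'.2 := funext (hjet e he b)
    rw [hsl, hj, spatial_eq (κ (t₀, x₀)), linPart_eq_of_vanish] at hrel
    · simp only [hf, iteratedDeriv_trial, Prod.fst_add, Prod.snd_add, Prod.smul_fst, Prod.smul_snd,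
        smul_eq_mul, mul_zero, add_zero] at hrel
      simp only [if_true, zero_ne_one, one_ne_zero, if_false, zero_mul, ite_self, add_zero,
        zero_add] at hrel
      linarith
    · intro j hj
      simp only [hf, iteratedDeriv_trial]
      simp [show j ≠ 0 by omega, show j ≠ 1 by omega]

/-- Only the quadratic term of the equation produces e b and e² in the family relation. The mixed
difference in e and b gives T_t θ 1 = 1, the second difference in e gives π 1 = 0; θ 1 and π 1 are
U_u / X_x and U_xu / X_x. -/
theorem IsAdmissible.slope_relations (h : IsAdmissible r φ κ κ') (hr : 2 ≤ r) {z : Var}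
    (hz : z ∈ φ.source) :
    (fderiv ℝ φ z (1, 0, 0)).1 * slope φ z = (fderiv ℝ φ z (0, 1, 0)).2.1 ∧
      fderiv ℝ (slope φ) z (0, 1, 0) = 0 := by
  obtain ⟨t₀, x₀, a⟩ := z
  have hT := h.fst_fderiv_ne_zero hr hz
  have hS := h.slope_ne_zero hr hz
  obtain ⟨δ, ρ, π, θ, Θ, hδ, hρ0, hπ0, hθ0, hπ1, hθ1, -, -, hrel⟩ := h.exists_family hr hz
  have h0 : |(0 : ℝ)| ≤ δ := by rw [abs_zero]; exact hδ.le
  have hp : |δ| ≤ δ := by rw [abs_of_pos hδ]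
  have hm : |-δ| ≤ δ := by rw [abs_neg]; exact hp
  have r00 := hrel 0 h0 0
  have r01 := hrel 0 h0 1
  have rp0 := hrel δ hp 0
  have rp1 := hrel δ hp 1
  have rm0 := hrel (-δ) hm 0
  simp only [spatial_eq, linPart_comb, hθ0, hπ0] at r00 r01 rp0 rp1 rm0
  set Tt := (fderiv ℝ φ (t₀, x₀, a) (1, 0, 0)).1
  set Xx := (fderiv ℝ φ (t₀, x₀, a) (0, 1, 0)).2.1
  set S := slope φ (t₀, x₀, a)
  have e1 : δ * S * (Tt * θ 1 - 1) = 0 := by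
    linear_combination -(rp1 - rp0 - r01 + r00)
  have e2 : Tt * θ 1 - 1 = 0 := (mul_eq_zero.1 e1).resolve_left (mul_ne_zero hδ.ne' hS)
  have e3 : Tt * (2 * δ ^ 2) * S * π 1 = 0 := by
    linear_combination -(rp0 + rm0 - 2 * r00)
  have e4 : π 1 = 0 := (mul_eq_zero.1 e3).resolve_left
    (mul_ne_zero (mul_ne_zero hT (by positivity)) hS)
  refine ⟨?_, ?_⟩
  · linear_combination Xx * e2 - Tt * hθ1
  · rw [← hπ1, e4, zero_mul]

/-- The transformation near a point, in terms of first derivatives. -/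
theorem IsAdmissible.exists_ball_normal (h : IsAdmissible r φ κ κ') (hr : 2 ≤ r) {z : Var}
    (hz : z ∈ φ.source) : ∃ ε > 0, Metric.ball z ε ⊆ φ.source ∧
      ∀ y ∈ Metric.ball z ε, y.1 = z.1 → (φ y).1 = (φ z).1 ∧
        (fderiv ℝ φ y (0, 1, 0)).2.1 = (fderiv ℝ φ z (0, 1, 0)).2.1 ∧
        slope φ y = slope φ z ∧
        (φ y).2.1 = (φ z).2.1 + (fderiv ℝ φ z (0, 1, 0)).2.1 * (y.2.1 - z.2.1) := by
  obtain ⟨ε, hε, hb, hc⟩ := h.exists_ball_fst hr hz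
  obtain ⟨δ, hδ, hb', hc'⟩ := exists_ball_eq (G := slope φ) φ.open_source
    (fun y hy => (h.diffeo.contDiffAt_slope hy).differentiableAt (by simp)) hz
  have s1 := Metric.ball_subset_ball (x := z) (min_le_left ε δ)
  have s2 := Metric.ball_subset_ball (x := z) (min_le_right ε δ)
  have hz1 : z ∈ Metric.ball z (min ε δ) := Metric.mem_ball_self (lt_min hε hδ)
  have hsl : ∀ y ∈ Metric.ball z (min ε δ), y.1 = z.1 → slope φ y = slope φ z := by
    intro y hy e1
    refine hc' z (s2 hz1) y (s2 hy) fun w hw => ?_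
    have : fderiv ℝ (slope φ) w (0, 0, 1) = 0 := h.fderiv_fderiv_thd hr hw
    rw [map_var, this, (h.slope_relations hr hw).2]
    simp [e1]
  have hTt : ∀ y ∈ Metric.ball z (min ε δ), y.1 = z.1 →
      (fderiv ℝ φ y (1, 0, 0)).1 = (fderiv ℝ φ z (1, 0, 0)).1 := by
    intro y hy e1
    obtain ⟨t₀, x₀, a⟩ := z
    obtain ⟨t₁, x₁, a₁⟩ := y
    obtain rfl : t₁ = t₀ := e1
    have d1 := hasDerivAt_comp_fst (h.diffeo.differentiableAt_fst (hb (s1 hy)))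
    have d2 := hasDerivAt_comp_fst (h.diffeo.differentiableAt_fst hz)
    rw [fderiv_fst_comp h.diffeo (hb (s1 hy))] at d1
    rw [fderiv_fst_comp h.diffeo hz] at d2
    refine d1.unique (d2.congr_of_eventuallyEq ?_)
    have c1 : ∀ᶠ t in 𝓝 t₁, ((t, x₁, a₁) : Var) ∈ Metric.ball ((t₁, x₀, a) : Var) (min ε δ) :=
      (show ContinuousAt (fun t : ℝ => ((t, x₁, a₁) : Var)) t₁ by fun_prop)
        (Metric.isOpen_ball.mem_nhds hy)
    have c2 : ∀ᶠ t in 𝓝 t₁, ((t, x₀, a) : Var) ∈ Metric.ball ((t₁, x₀, a) : Var) (min ε δ) :=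
      (show ContinuousAt (fun t : ℝ => ((t, x₀, a) : Var)) t₁ by fun_prop)
        (Metric.isOpen_ball.mem_nhds hz1)
    filter_upwards [c1, c2] with t h1 h2
    exact hc _ (s1 h2) _ (s1 h1) rfl
  have hXx : ∀ y ∈ Metric.ball z (min ε δ), y.1 = z.1 →
      (fderiv ℝ φ y (0, 1, 0)).2.1 = (fderiv ℝ φ z (0, 1, 0)).2.1 := by
    intro y hy e1
    -- X_x = T_t U_u, and both factors depend on t alone near the point.
    rw [← (h.slope_relations hr hz).1, ← (h.slope_relations hr (hb (s1 hy))).1, hsl y hy e1,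
      hTt y hy e1]
  refine ⟨min ε δ, lt_min hε hδ, s1.trans hb, fun y hy e1 =>
    ⟨hc z (s1 hz1) y (s1 hy) e1, hXx y hy e1, hsl y hy e1, ?_⟩⟩
  have hyz : y - z = (0, y.2.1 - z.2.1, y.2.2 - z.2.2) := by
    ext <;> simp [e1]
  set c := (fderiv ℝ φ z (0, 1, 0)).2.1 * (y.2.1 - z.2.1) with hcdef
  have hmem : ∀ s ∈ Set.Icc (0 : ℝ) 1, z + s • (y - z) ∈ Metric.ball z (min ε δ) := fun s hs =>
    (convex_ball z _).add_smul_sub_mem hz1 hy hs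
  have hd : ∀ s ∈ Set.Icc (0 : ℝ) 1,
      HasDerivAt (fun s : ℝ => (φ (z + s • (y - z))).2.1 - c * s) 0 s := by
    intro s hs
    have h1 : HasDerivAt (fun s : ℝ => z + s • (y - z)) (y - z) s := by
      simpa using ((hasDerivAt_id s).smul_const (y - z)).const_add z
    have hm := hb (s1 (hmem s hs))
    have h2 := (h.diffeo.differentiableAt_snd hm).hasFDerivAt.comp_hasDerivAt s h1
    have h3 := h2.sub ((hasDerivAt_id s).const_mul c)
    have h4 := hXx (z + s • (y - z)) (hmem s hs) (by simp [hyz])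
    convert! h3 using 1
    rw [fderiv_snd_comp h.diffeo hm, map_var]
    simp only [Prod.fst_add, Prod.snd_add, Prod.smul_fst, Prod.smul_snd, smul_eq_mul, h4,
      (h.snd_fderiv hr hm).1]
    rw [hcdef, hyz]
    simp only
    ring
  have h3 := (convex_Icc (0 : ℝ) 1).norm_image_sub_le_of_norm_hasDerivWithin_le (C := 0)
    (fun s hs => (hd s hs).hasDerivWithinAt) (by simp) (Set.left_mem_Icc.2 zero_le_one)
    (Set.right_mem_Icc.2 zero_le_one)
  simp only [zero_smul, add_zero, one_smul, add_sub_cancel, zero_mul, norm_le_zero_iff, mul_one,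
    mul_zero, sub_zero] at h3
  linarith

/-- The coefficient of b at e = 0 in the family relation. Since U_u is constant on the slice and X
is affine in x, U_u (x - x₀) is linear in the new x, so its jet has order one and drops out of the
linear part; what remains is - T_t U θ 1 + X_t θ 1 = - u U_u. -/
theorem IsAdmissible.thd_eq (h : IsAdmissible r φ κ κ') (hr : 2 ≤ r) {z : Var}
    (hz : z ∈ φ.source) :
    (fderiv ℝ φ z (1, 0, 0)).1 * (φ z).2.2 =
      (fderiv ℝ φ z (0, 1, 0)).2.1 * z.2.2 + (fderiv ℝ φ z (1, 0, 0)).2.1 := by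
  obtain ⟨ε, hε, hb, hn⟩ := h.exists_ball_normal hr hz
  obtain ⟨hrelS, -⟩ := h.slope_relations hr hz
  have hS := h.slope_ne_zero hr hz
  have hXx := (h.snd_fderiv hr hz).2
  obtain ⟨t₀, x₀, a⟩ := z
  obtain ⟨δ, ρ, π, θ, Θ, hδ, hρ0, hπ0, hθ0, -, hθ1, hθj, hΘ, hrel⟩ := h.exists_family hr hz
  have h0 : |(0 : ℝ)| ≤ δ := by rw [abs_zero]; exact hδ.le
  set Tt := (fderiv ℝ φ (t₀, x₀, a) (1, 0, 0)).1
  set Xx := (fderiv ℝ φ (t₀, x₀, a) (0, 1, 0)).2.1 with hXxdef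
  set S := slope φ (t₀, x₀, a) with hSdef
  have hθ2 : ∀ j, 2 ≤ j → θ j = 0 := by
    intro j hj
    have hev : Θ =ᶠ[𝓝 (φ (t₀, x₀, a)).2.1]
        trial 0 (S / Xx) 0 2 (φ (t₀, x₀, a)).2.1 := by
      have hχd := hasStrictDerivAt_slice_snd h.diffeo hz
      change Θ =ᶠ[𝓝 ((fun x => (φ (t₀, x, a)).2.1) x₀)] _
      rw [← hχd.map_nhds_eq hXx]
      refine eventually_map.2 ?_
      have c2 : ∀ᶠ x in 𝓝 x₀, ((t₀, x, a) : Var) ∈ Metric.ball ((t₀, x₀, a) : Var) ε :=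
        (show ContinuousAt (fun x : ℝ => ((t₀, x, a) : Var)) x₀ by fun_prop)
          (Metric.ball_mem_nhds _ hε)
      filter_upwards [hΘ, c2] with x h1 h2
      obtain ⟨-, -, e3, e4⟩ := hn _ h2 rfl
      rw [h1, e3, e4, trial]
      field_simp
      ring
    rw [hθj, hev.iteratedDeriv_eq, iteratedDeriv_trial]
    simp [show j ≠ 0 by omega, show j ≠ 1 by omega]
  have r00 := hrel 0 h0 0
  have r01 := hrel 0 h0 1
  simp only [spatial_eq, linPart_comb, hθ0, hπ0, hρ0, linPart_eq_of_vanish _ hθ2] at r00 r01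
  have e1 : Tt * θ 1 = 1 := by
    apply mul_right_cancel₀ hXx
    linear_combination Tt * hθ1 + hrelS
  have hθ1' : θ 1 ≠ 0 := fun h => by rw [h, mul_zero] at e1; exact zero_ne_one e1
  apply mul_left_cancel₀ hθ1'
  simp only
  linear_combination -(r01 - r00) - a * hθ1

end

section

variable {r : ℕ} {φ : OpenPartialHomeomorph Var Var} {κ κ' : ℝ × ℝ → Kappa r}

/-! ### The global form of admissible point transformations -/

/-- The point transformation with parameter functions `T`, `X¹`, `X⁰`. -/
noncomputable def pointMap (T X1 X0 : ℝ → ℝ) (z : Var) : Var :=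
  (T z.1, X1 z.1 * z.2.1 + X0 z.1,
    X1 z.1 / deriv T z.1 * z.2.2 + deriv X1 z.1 / deriv T z.1 * z.2.1 + deriv X0 z.1 / deriv T z.1)

/-- Connectedness of the sections t = const enters here: on a section G is locally constant, hence
has zero derivative on a connected open set. -/
theorem IsDom.eq_of_locally_eq {V : Set Var} (hV : IsDom V) {G : Var → ℝ}
    (hG : ∀ z ∈ V, ∃ ε > 0, ∀ y ∈ Metric.ball z ε, y.1 = z.1 → G y = G z) {z z' : Var}
    (hz : z ∈ V) (hz' : z' ∈ V) (h : z.1 = z'.1) : G z = G z' := by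
  obtain ⟨t, w⟩ := z
  obtain ⟨t', w'⟩ := z'
  obtain rfl : t = t' := h
  have hev : ∀ w ∈ {w : ℝ × ℝ | (t, w) ∈ V}, (fun w : ℝ × ℝ => G (t, w)) =ᶠ[𝓝 w]
      fun _ => G (t, w) := by
    intro w hw
    obtain ⟨ε, hε, hε'⟩ := hG _ hw
    have : ∀ᶠ w' in 𝓝 w, ((t, w') : Var) ∈ Metric.ball ((t, w) : Var) ε :=
      (show ContinuousAt (fun w' : ℝ × ℝ => ((t, w') : Var)) w by fun_prop)
        (Metric.ball_mem_nhds _ hε)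
    exact this.mono fun w' hw' => hε' _ hw' rfl
  have hopen : IsOpen {w : ℝ × ℝ | (t, w) ∈ V} :=
    hV.1.preimage (show Continuous fun w : ℝ × ℝ => ((t, w) : Var) by fun_prop)
  exact hopen.is_const_of_fderiv_eq_zero (𝕜 := ℝ) (f := fun w : ℝ × ℝ => G (t, w)) (hV.2.2 t)
    (fun w hw => ((differentiableAt_const _).congr_of_eventuallyEq
      (hev w hw)).differentiableWithinAt)
    (fun w hw => by rw [(hev w hw).fderiv_eq]; simp) hz hz'

theorem IsDom.isOpen_times {V : Set Var} (hV : IsDom V) : IsOpen (times V) :=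
  isOpenMap_fst _ hV.1

theorem IsDom.ordConnected_times {V : Set Var} (hV : IsDom V) : (times V).OrdConnected :=
  (hV.2.1.isPreconnected.image _ continuous_fst.continuousOn).ordConnected

/-- T, X_x and X - X_x x are constant on sections, so each is a function of t over the whole domain;
`thd_eq` then gives the third component. -/
theorem IsAdmissible.exists_parameters (h : IsAdmissible r φ κ κ') (hr : 2 ≤ r)
    (hV : IsDom φ.source) :
    ∃ T X1 X0 : ℝ → ℝ, AreParameters (times φ.source) T X1 X0 ∧
      Set.EqOn φ (pointMap T X1 X0) φ.source := by
  have hsec : ∀ t, ∃ w : ℝ × ℝ, t ∈ times φ.source → ((t, w) : Var) ∈ φ.source := by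
    intro t
    by_cases ht : t ∈ times φ.source
    · obtain ⟨⟨t', w⟩, hz, rfl⟩ := ht
      exact ⟨w, fun _ => hz⟩
    · exact ⟨0, fun h => absurd h ht⟩
  choose σ hσ using hsec
  have hloc := fun z hz => h.exists_ball_normal hr (z := z) hz
  set G₁ : Var → ℝ := fun y => (φ y).1 with hG₁
  set G₂ : Var → ℝ := fun y => (fderiv ℝ φ y (0, 1, 0)).2.1 with hG₂
  set G₃ : Var → ℝ := fun y => (φ y).2.1 - G₂ y * y.2.1 with hG₃
  have ext : ∀ G : Var → ℝ, (∀ z ∈ φ.source, ∃ ε > 0, ∀ y ∈ Metric.ball z ε, y.1 = z.1 →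
      G y = G z) → (∀ z ∈ φ.source, ContDiffAt ℝ ∞ G z) →
      (∀ z ∈ φ.source, G z = G (z.1, σ z.1)) ∧
      (∀ z ∈ φ.source, ContDiffAt ℝ ∞ (fun t => G (t, σ t)) z.1 ∧
        HasDerivAt (fun t => G (t, σ t)) (fderiv ℝ G z (1, 0, 0)) z.1) := by
    intro G hG hGs
    have e1 : ∀ z ∈ φ.source, G z = G (z.1, σ z.1) := fun z hz =>
      hV.eq_of_locally_eq hG hz (hσ z.1 ⟨z, hz, rfl⟩) rfl
    refine ⟨e1, fun z hz => ?_⟩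
    -- σ is a bare choice of a point in each section, with no continuity. Near a given point it may
    -- be replaced by a constant, because G does not depend on the point chosen.
    have hev : (fun t => G (t, σ t)) =ᶠ[𝓝 z.1] fun t => G (t, z.2) := by
      have : ∀ᶠ t in 𝓝 z.1, ((t, z.2) : Var) ∈ φ.source :=
        (show ContinuousAt (fun t : ℝ => ((t, z.2) : Var)) z.1 by fun_prop)
          (φ.open_source.mem_nhds hz)
      exact this.mono fun t ht => (e1 _ ht).symm
    refine ⟨ContDiffAt.congr_of_eventuallyEq ?_ hev, HasDerivAt.congr_of_eventuallyEq ?_ hev⟩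
    · exact ContDiffAt.comp (g := G) (f := fun t : ℝ => ((t, z.2) : Var)) z.1 (hGs z hz)
        (contDiffAt_id.prodMk contDiffAt_const)
    · exact hasDerivAt_comp_fst (t₀ := z.1) (x₀ := z.2.1) (a := z.2.2)
        ((hGs z hz).differentiableAt (by simp))
  have hs2 : ∀ z ∈ φ.source, ContDiffAt ℝ ∞ (fun y => (φ y).2.1) z := fun z hz =>
    (h.diffeo.contDiffAt hz).snd.fst
  have hs2' : ∀ z ∈ φ.source, ContDiffAt ℝ ∞ G₂ z := fun z hz =>
    (((h.diffeo.contDiffAt hz).fderiv_right (m := ∞) le_rfl).clm_apply contDiffAt_const).snd.fst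
  obtain ⟨c₁, d₁⟩ := ext G₁ (fun z hz => by
    obtain ⟨ε, hε, -, hb⟩ := hloc z hz
    exact ⟨ε, hε, fun y hy e => (hb y hy e).1⟩) (fun z hz => (h.diffeo.contDiffAt hz).fst)
  obtain ⟨c₂, d₂⟩ := ext G₂ (fun z hz => by
    obtain ⟨ε, hε, -, hb⟩ := hloc z hz
    exact ⟨ε, hε, fun y hy e => (hb y hy e).2.1⟩) hs2'
  obtain ⟨c₃, d₃⟩ := ext G₃ (fun z hz => by
    obtain ⟨ε, hε, -, hb⟩ := hloc z hz
    refine ⟨ε, hε, fun y hy e => ?_⟩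
    obtain ⟨-, e2, -, e3⟩ := hb y hy e
    simp only [hG₃, hG₂, e2, e3]
    ring) (fun z hz => (hs2 z hz).sub ((hs2' z hz).mul contDiffAt_snd.fst))
  refine ⟨fun t => G₁ (t, σ t), fun t => G₂ (t, σ t), fun t => G₃ (t, σ t),
    ⟨?_, ?_, ?_, ?_⟩, ?_⟩
  · rintro _ ⟨z, hz, rfl⟩; exact (d₁ z hz).1.contDiffWithinAt
  · rintro _ ⟨z, hz, rfl⟩; exact (d₂ z hz).1.contDiffWithinAt
  · rintro _ ⟨z, hz, rfl⟩; exact (d₃ z hz).1.contDiffWithinAt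
  · rintro _ ⟨z, hz, rfl⟩
    rw [(d₁ z hz).2.deriv, fderiv_fst_comp h.diffeo hz]
    refine mul_ne_zero (h.fst_fderiv_ne_zero hr hz) ?_
    change G₂ (z.1, σ z.1) ≠ 0
    rw [← c₂ z hz]
    exact (h.snd_fderiv hr hz).2
  · intro z hz
    have hT := h.fst_fderiv_ne_zero hr hz
    have hX : ∀ y ∈ φ.source, (φ y).2.1 = G₂ (y.1, σ y.1) * y.2.1 + G₃ (y.1, σ y.1) := by
      intro y hy
      rw [← c₂ y hy, ← c₃ y hy]
      simp only [hG₃]; ring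
    have hXt : (fderiv ℝ φ z (1, 0, 0)).2.1 =
        fderiv ℝ G₂ z (1, 0, 0) * z.2.1 + fderiv ℝ G₃ z (1, 0, 0) := by
      have e1 := hasDerivAt_comp_fst (t₀ := z.1) (x₀ := z.2.1) (a := z.2.2)
        (h.diffeo.differentiableAt_snd hz)
      rw [Prod.mk.eta, Prod.mk.eta, fderiv_snd_comp h.diffeo hz] at e1
      have e2 := ((d₂ z hz).2.mul_const z.2.1).add (d₃ z hz).2
      refine e1.unique (e2.congr_of_eventuallyEq ?_)
      have : ∀ᶠ t in 𝓝 z.1, ((t, z.2) : Var) ∈ φ.source :=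
        (show ContinuousAt (fun t : ℝ => ((t, z.2) : Var)) z.1 by fun_prop)
          (φ.open_source.mem_nhds hz)
      exact this.mono fun t ht => hX _ ht
    have hU := h.thd_eq hr hz
    simp only [pointMap]
    rw [(d₁ z hz).2.deriv, (d₂ z hz).2.deriv, (d₃ z hz).2.deriv, ← c₁ z hz, ← hX z hz, ← c₂ z hz,
      fderiv_fst_comp h.diffeo hz]
    refine Prod.ext rfl (Prod.ext rfl ?_)
    simp only [hG₂]
    rw [hXt] at hU
    apply mul_left_cancel₀ hT
    rw [hU]
    field_simp
    ring

end

section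

variable {r : ℕ} {φ : OpenPartialHomeomorph Var Var} {κ κ' : ℝ × ℝ → Kappa r}
  {T X1 X0 : ℝ → ℝ}

/-! ### The action of the explicit transformations on equations -/

/-- The new arbitrary elements as functions of the old ones. -/
noncomputable def newKappa (r : ℕ) (T X1 X0 : ℝ → ℝ) (p : ℝ × ℝ) (k : Kappa r) : Kappa r :=
  (newA0 T X1 p.1 k.1,
    fun j => X1 p.1 ^ (j : ℕ) / deriv T p.1 * k.2.1 j,
    X1 p.1 / deriv T p.1 ^ 2 * k.2.2
      + 1 / deriv T p.1 * deriv (fun s => deriv X1 s / deriv T s) p.1 * p.2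
      + 1 / deriv T p.1 * deriv (fun s => deriv X0 s / deriv T s) p.1
      - (deriv X1 p.1 / deriv T p.1 * p.2 + deriv X0 p.1 / deriv T p.1) * newA0 T X1 p.1 k.1)

theorem explicitMap_eq (z : Var) (k : Kappa r) :
    explicitMap r T X1 X0 (z, k) = (pointMap T X1 X0 z, newKappa r T X1 X0 (base z) k) := rfl

theorem newKappa_mem_regular {p : ℝ × ℝ} {k : Kappa r} (h : deriv T p.1 * X1 p.1 ≠ 0)
    (hk : k ∈ regular r) : newKappa r T X1 X0 p k ∈ regular r := fun j hj =>
  mul_ne_zero (div_ne_zero (pow_ne_zero _ (right_ne_zero_of_mul h)) (left_ne_zero_of_mul h))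
    (hk j hj)

section Parameters

variable {I : Set ℝ}

theorem AreParameters.deriv_ne (h : AreParameters I T X1 X0) {t : ℝ} (ht : t ∈ I) :
    deriv T t ≠ 0 := left_ne_zero_of_mul (h.2.2.2 t ht)

theorem AreParameters.ne (h : AreParameters I T X1 X0) {t : ℝ} (ht : t ∈ I) :
    X1 t ≠ 0 := right_ne_zero_of_mul (h.2.2.2 t ht)

theorem contDiffOn_deriv {f : ℝ → ℝ} (hI : IsOpen I) (hf : ContDiffOn ℝ ∞ f I) :
    ContDiffOn ℝ ∞ (deriv f) I := hf.deriv_of_isOpen hI le_rfl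

theorem hasDerivAt_of_contDiffOn {f : ℝ → ℝ} (hI : IsOpen I) (hf : ContDiffOn ℝ ∞ f I) {t : ℝ}
    (ht : t ∈ I) : HasDerivAt f (deriv f t) t :=
  (((hf t ht).contDiffAt (hI.mem_nhds ht)).differentiableAt (by simp)).hasDerivAt

end Parameters

/-- An identity for arbitrary functions and coefficients, not just on solutions: the nonzero factor
gives both directions of the equivalence of the equations, and it later identifies the target
coefficients. -/
theorem defect_explicit (hI : IsOpen (times φ.source))
    (hpar : AreParameters (times φ.source) T X1 X0)
    (hexp : Set.EqOn φ (pointMap T X1 X0) φ.source) {u v : ℝ × ℝ → ℝ} {p : ℝ × ℝ}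
    (h : TransformsAt φ u v p) (k : Kappa r) :
    tderiv v (base (φ (graph u p))) -
        spatial r (newKappa r T X1 X0 p k) (xjet v (base (φ (graph u p)))) =
      X1 p.1 / deriv T p.1 ^ 2 * (tderiv u p - spatial r k (xjet u p)) := by
  obtain ⟨t₀, x₀⟩ := p
  have ht₀ : t₀ ∈ times φ.source := ⟨_, h.mem, rfl⟩
  have hT0 := hpar.deriv_ne ht₀
  have hX0 := hpar.ne ht₀
  have hu := h.2.1
  have hv : ContDiffAt ℝ ∞ v (base (φ (graph u (t₀, x₀)))) := h.2.2.1
  have hp' : base (φ (graph u (t₀, x₀))) = (T t₀, X1 t₀ * x₀ + X0 t₀) := by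
    rw [hexp h.mem]; rfl
  rw [hp'] at hv ⊢
  set p' : ℝ × ℝ := (T t₀, X1 t₀ * x₀ + X0 t₀) with hp'def
  -- the relation between the two functions
  have hrel : ∀ᶠ q : ℝ × ℝ in 𝓝 (t₀, x₀), v (T q.1, X1 q.1 * q.2 + X0 q.1) =
      X1 q.1 / deriv T q.1 * u q + deriv X1 q.1 / deriv T q.1 * q.2 +
        deriv X0 q.1 / deriv T q.1 := by
    have hs : ∀ᶠ q in 𝓝 (t₀, x₀), graph u q ∈ φ.source :=
      (contDiffAt_graph hu).continuousAt (φ.open_source.mem_nhds h.mem)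
    filter_upwards [hs, h.2.2.2] with q hq hq'
    change v (base (φ (graph u q))) = (φ (graph u q)).2.2 at hq'
    rw [hexp hq] at hq'
    exact hq'
  -- derivatives with respect to `x`
  have hx : ∀ᶠ x in 𝓝 x₀, v (T t₀, X1 t₀ * x + X0 t₀) =
      X1 t₀ / deriv T t₀ * u (t₀, x) + (deriv X1 t₀ / deriv T t₀ * x +
        deriv X0 t₀ / deriv T t₀) := by
    have := (show Tendsto (fun x : ℝ => (t₀, x)) (𝓝 x₀) (𝓝 (t₀, x₀)) from
      (continuous_const.prodMk continuous_id).tendsto x₀).eventually hrel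
    exact this.mono fun x hx => by rw [hx, add_assoc]
  have hjet : ∀ j, X1 t₀ ^ j * xjet v p' j = X1 t₀ / deriv T t₀ * xjet u (t₀, x₀) j +
      iteratedDeriv j (fun x => deriv X1 t₀ / deriv T t₀ * x + deriv X0 t₀ / deriv T t₀) x₀ := by
    intro j
    have hn : (j : WithTop ℕ∞) ≤ ∞ := by exact_mod_cast le_top
    have hs : ContDiffAt ℝ j (fun x => u (t₀, x)) x₀ :=
      contDiffAt_slice_snd (p := (t₀, x₀)) (hu.of_le hn)
    have e1 := iteratedDeriv_comp_affine (fun y => v (T t₀, y)) (X1 t₀) (X0 t₀) j x₀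
    have hev : (fun x => v (T t₀, X1 t₀ * x + X0 t₀)) =ᶠ[𝓝 x₀] fun x =>
      X1 t₀ / deriv T t₀ * u (t₀, x) + (deriv X1 t₀ / deriv T t₀ * x +
        deriv X0 t₀ / deriv T t₀) := hx
    rw [hev.iteratedDeriv_eq, iteratedDeriv_fun_add (contDiffAt_const.mul hs) (by fun_prop),
      iteratedDeriv_const_mul _ hs] at e1
    exact e1.symm
  have hlin : (fun x => deriv X1 t₀ / deriv T t₀ * x + deriv X0 t₀ / deriv T t₀) =
      trial (deriv X1 t₀ / deriv T t₀ * x₀ + deriv X0 t₀ / deriv T t₀)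
        (deriv X1 t₀ / deriv T t₀) 0 0 x₀ := by
    funext x; simp only [trial]; ring
  simp only [hlin, iteratedDeriv_trial, zero_mul, ite_self, add_zero] at hjet
  have hj0 := hjet 0
  have hj1 := hjet 1
  have hj2 : ∀ j, 2 ≤ j → X1 t₀ ^ j * xjet v p' j =
      X1 t₀ / deriv T t₀ * xjet u (t₀, x₀) j := by
    intro j hj
    rw [hjet, if_neg (by omega), if_neg (by omega), add_zero, add_zero]
  simp only [pow_zero, one_mul, pow_one, if_true, zero_ne_one, one_ne_zero, if_false, zero_add,
    add_zero] at hj0 hj1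
  -- derivatives with respect to `t`
  have hdT := hasDerivAt_of_contDiffOn hI hpar.1 ht₀
  have hdX1 := hasDerivAt_of_contDiffOn hI hpar.2.1 ht₀
  have hdX0 := hasDerivAt_of_contDiffOn hI hpar.2.2.1 ht₀
  have hdTt := hasDerivAt_of_contDiffOn hI (contDiffOn_deriv hI hpar.1) ht₀
  have hc2 := hasDerivAt_of_contDiffOn hI ((contDiffOn_deriv hI hpar.2.1).div
    (contDiffOn_deriv hI hpar.1) fun t ht => hpar.deriv_ne ht) ht₀
  have hc3 := hasDerivAt_of_contDiffOn hI ((contDiffOn_deriv hI hpar.2.2.1).div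
    (contDiffOn_deriv hI hpar.1) fun t ht => hpar.deriv_ne ht) ht₀
  have htime : deriv T t₀ * tderiv v p' + (deriv X1 t₀ * x₀ + deriv X0 t₀) * xjet v p' 1 =
      (deriv X1 t₀ * deriv T t₀ - X1 t₀ * deriv (deriv T) t₀) / deriv T t₀ ^ 2 * u (t₀, x₀) +
        X1 t₀ / deriv T t₀ * tderiv u (t₀, x₀) +
        deriv (fun s => deriv X1 s / deriv T s) t₀ * x₀ +
        deriv (fun s => deriv X0 s / deriv T s) t₀ := by
    have hvd : DifferentiableAt ℝ v p' := hv.differentiableAt (by simp)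
    have d1 : HasDerivAt (fun s => v (T s, X1 s * x₀ + X0 s)) _ t₀ :=
      HasFDerivAt.comp_hasDerivAt (l := v) (f := fun s => (T s, X1 s * x₀ + X0 s)) t₀
        hvd.hasFDerivAt (hdT.prodMk ((hdX1.mul_const x₀).add hdX0))
    have d2 : HasDerivAt (fun s => u (s, x₀)) (tderiv u (t₀, x₀)) t₀ := by
      have hud : DifferentiableAt ℝ u (t₀, x₀) := hu.differentiableAt (by simp)
      rw [tderiv_eq_fderiv hud]
      exact hasDerivAt_slice_fst (p := (t₀, x₀)) hud
    have d3 := (((hdX1.div hdTt hT0).mul d2).add (hc2.mul_const x₀)).add hc3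
    have hev := (show Tendsto (fun s : ℝ => (s, x₀)) (𝓝 t₀) (𝓝 (t₀, x₀)) from
      (continuous_id.prodMk continuous_const).tendsto t₀).eventually hrel
    have d4 := d1.unique (d3.congr_of_eventuallyEq hev)
    rw [fderiv_eq_tderiv_xjet hvd] at d4
    exact d4
  -- comparison of the equations
  have hsum : ∑ j : Finset.Icc 2 r, X1 t₀ ^ (j : ℕ) / deriv T t₀ * k.2.1 j * xjet v p' j =
      X1 t₀ / deriv T t₀ ^ 2 * ∑ j : Finset.Icc 2 r, k.2.1 j * xjet u (t₀, x₀) j := by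
    rw [Finset.mul_sum]
    refine Finset.sum_congr rfl fun j _ => ?_
    have := hj2 j (Finset.mem_Icc.1 j.2).1
    have e : X1 t₀ ^ (j : ℕ) / deriv T t₀ * k.2.1 j * xjet v p' j =
        (X1 t₀ ^ (j : ℕ) * xjet v p' j) * (k.2.1 j / deriv T t₀) := by ring
    rw [e, this]
    field_simp
  simp only [spatial, newKappa, newA0]
  rw [hsum]
  rw [xjet_zero] at hj0
  rw [xjet_zero, xjet_zero] at *
  have hj1' : xjet v p' 1 = (X1 t₀ / deriv T t₀ * xjet u (t₀, x₀) 1 +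
      deriv X1 t₀ / deriv T t₀) / X1 t₀ := by
    rw [← hj1]; field_simp
  have htime' : tderiv v p' = ((deriv X1 t₀ * deriv T t₀ - X1 t₀ * deriv (deriv T) t₀) /
      deriv T t₀ ^ 2 * u (t₀, x₀) + X1 t₀ / deriv T t₀ * tderiv u (t₀, x₀) +
        deriv (fun s => deriv X1 s / deriv T s) t₀ * x₀ +
        deriv (fun s => deriv X0 s / deriv T s) t₀ -
        (deriv X1 t₀ * x₀ + deriv X0 t₀) * xjet v p' 1) / deriv T t₀ := by
    rw [← htime]; field_simp; ring
  rw [htime', hj0, hj1']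
  field_simp
  ring

theorem mapsEquation_explicit (hI : IsOpen (times φ.source))
    (hpar : AreParameters (times φ.source) T X1 X0)
    (hexp : Set.EqOn φ (pointMap T X1 X0) φ.source)
    (hκ : ∀ z ∈ φ.source, κ' (base (φ z)) = newKappa r T X1 X0 (base z) (κ (base z))) :
    MapsEquation r φ κ κ' := by
  intro u v p h
  change _ ↔ SatisfiesAt r κ' v (base (φ (graph u p)))
  have hd := defect_explicit hI hpar hexp h (κ p)
  have hk := hκ _ h.mem
  rw [base_graph] at hk
  have ht : p.1 ∈ times φ.source := ⟨_, h.mem, rfl⟩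
  rw [satisfiesAt_iff, satisfiesAt_iff, hk, ← sub_eq_zero, ← sub_eq_zero (a := tderiv v _), hd,
    mul_eq_zero, or_iff_right (div_ne_zero (hpar.ne ht) (pow_ne_zero _ (hpar.deriv_ne ht)))]

/-- Test jets c + s (x - x₀)^j with vanishing first derivative suffice, as there is no A¹. Two
values of c are needed to separate A⁰ from B. -/
theorem kappa_ext_of_spatial {k k' : Kappa r} {x₀ a a' : ℝ} (haa : a ≠ a')
    (h : ∀ f : ℝ → ℝ, ContDiff ℝ ∞ f → (f x₀ = a ∨ f x₀ = a') →
      spatial r k (fun j => iteratedDeriv j f x₀) = spatial r k' fun j => iteratedDeriv j f x₀) :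
    k = k' := by
  have key : ∀ c s, (c = a ∨ c = a') → ∀ j, 2 ≤ j →
      (∑ i : Finset.Icc 2 r, k.2.1 i * (if (i : ℕ) = j then s * (j.factorial : ℝ) else 0)) +
        k.1 * c + k.2.2 =
      (∑ i : Finset.Icc 2 r, k'.2.1 i * (if (i : ℕ) = j then s * (j.factorial : ℝ) else 0)) +
        k'.1 * c + k'.2.2 := by
    intro c s hc j hj
    have h1 := h (trial c 0 s j x₀) (contDiff_trial _ _ _ _ _)
      (by rwa [trial_self _ _ _ (by omega)])
    have h2 : ∀ i : Finset.Icc 2 r, iteratedDeriv (i : ℕ) (trial c 0 s j x₀) x₀ =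
        if (i : ℕ) = j then s * (j.factorial : ℝ) else 0 := by
      intro i
      have := (Finset.mem_Icc.1 i.2).1
      rw [iteratedDeriv_trial, if_neg (by omega), if_neg (by omega), zero_add, zero_add]
    simp only [spatial, h2] at h1
    simp only [iteratedDeriv_trial, if_true, zero_ne_one, one_ne_zero, if_false,
      show (0 : ℕ) ≠ j by omega, show (1 : ℕ) ≠ j by omega, add_zero, mul_zero, sub_zero] at h1
    exact h1
  have k1 := key a 0 (Or.inl rfl) 2 le_rfl
  have k2 := key a' 0 (Or.inr rfl) 2 le_rfl
  simp only [zero_mul, ite_self, mul_zero, Finset.sum_const_zero, zero_add] at k1 k2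
  have e1 : (k.1 - k'.1) * (a - a') = 0 := by linear_combination k1 - k2
  have e2 : k.1 = k'.1 := sub_eq_zero.1 ((mul_eq_zero.1 e1).resolve_right (sub_ne_zero.2 haa))
  have e3 : k.2.2 = k'.2.2 := by rw [e2] at k1; linarith
  refine Prod.ext e2 (Prod.ext (funext fun j => ?_) e3)
  have k3 := key a 1 (Or.inl rfl) j (Finset.mem_Icc.1 j.2).1
  have hsum : ∀ k : Kappa r, ∑ i : Finset.Icc 2 r,
      k.2.1 i * (if (i : ℕ) = j then 1 * ((j : ℕ).factorial : ℝ) else 0) =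
      k.2.1 j * (j : ℕ).factorial := by
    intro k
    rw [Finset.sum_eq_single j]
    · simp
    · intro i _ hi
      rw [if_neg fun h => hi (Subtype.ext h), mul_zero]
    · simp
  rw [hsum, hsum, e2, e3] at k3
  have hfac : ((j : ℕ).factorial : ℝ) ≠ 0 := by positivity
  exact mul_right_cancel₀ hfac (by linarith)

/-- Rolle's theorem on an interval. -/
theorem AreParameters.injOn {I : Set ℝ} (h : AreParameters I T X1 X0)
    (hc : I.OrdConnected) : Set.InjOn T I := by
  have key : ∀ s ∈ I, ∀ t ∈ I, s < t → T s ≠ T t := by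
    intro s hs t ht hst he
    have hsub : Set.Icc s t ⊆ I := hc.out hs ht
    obtain ⟨c, hcm, hc0⟩ := exists_deriv_eq_zero hst (h.1.continuousOn.mono hsub) he
    exact h.deriv_ne (hsub (Set.Ioo_subset_Icc_self hcm)) hc0
  intro s hs t ht he
  rcases lt_trichotomy s t with hlt | heq | hgt
  · exact absurd he (key s hs t ht hlt)
  · exact heq
  · exact absurd he.symm (key t ht s hs hgt)

theorem base_eq_of_base_pointMap_eq {V : Set Var} (hV : IsDom V)
    (hpar : AreParameters (times V) T X1 X0) {z z' : Var} (hz : z ∈ V) (hz' : z' ∈ V)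
    (h : base (pointMap T X1 X0 z) = base (pointMap T X1 X0 z')) : base z = base z' := by
  have h1 : T z.1 = T z'.1 := congrArg Prod.fst h
  have h2 : X1 z.1 * z.2.1 + X0 z.1 = X1 z'.1 * z'.2.1 + X0 z'.1 := congrArg Prod.snd h
  have e1 : z.1 = z'.1 := hpar.injOn hV.ordConnected_times ⟨z, hz, rfl⟩
    ⟨z', hz', rfl⟩ h1
  rw [e1] at h2
  exact Prod.ext e1 (mul_left_cancel₀ (hpar.ne ⟨z', hz', rfl⟩) (add_right_cancel h2))

/-- Solution jets of the target equation over p' are pulled back to solution jets of the source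
equation; by `defect_explicit` they also solve the equation with the explicit coefficients. Hence
both tuples prescribe the same t-derivative for all test jets. -/
theorem IsAdmissible.eq_newKappa (h : IsAdmissible r φ κ κ') (hr : 2 ≤ r) (hV : IsDom φ.source)
    (hpar : AreParameters (times φ.source) T X1 X0)
    (hexp : Set.EqOn φ (pointMap T X1 X0) φ.source) {z : Var} (hz : z ∈ φ.source) :
    κ' (base (φ z)) = newKappa r T X1 X0 (base z) (κ (base z)) := by
  set p' := base (φ z) with hp'
  obtain ⟨ε, hε, hb⟩ := Metric.isOpen_iff.1 φ.open_target (φ z) (φ.map_source hz)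
  -- The target of φ is open, so its fibre over p' contains a second value of u close to the given
  -- one.
  have hmem : ∀ c, c = (φ z).2.2 ∨ c = (φ z).2.2 + ε / 2 → ((p'.1, p'.2, c) : Var) ∈ φ.target := by
    rintro c (rfl | rfl)
    · exact φ.map_source hz
    · refine hb ?_
      rw [Metric.mem_ball, Prod.dist_eq, Prod.dist_eq]
      simp only [hp', base, dist_self, Real.dist_eq, add_sub_cancel_left]
      rw [max_lt_iff, max_lt_iff]
      exact ⟨hε, hε, by rw [abs_of_pos (by positivity)]; linarith⟩
  refine kappa_ext_of_spatial (x₀ := p'.2) (a := (φ z).2.2) (a' := (φ z).2.2 + ε / 2)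
    (by linarith) fun f hf hfa => ?_
  set α := spatial r (κ' p') fun j => iteratedDeriv j f p'.2 with hα
  set ψ : ℝ → ℝ := trial 0 α 0 2 p'.1 with hψ
  have hψ0 : ψ p'.1 = 0 := trial_self _ _ _ two_ne_zero _
  set v := sep f ψ with hvdef
  have hvs : ContDiff ℝ ∞ v := contDiff_sep hf (contDiff_trial _ _ _ _ _)
  have hval : v p' = f p'.2 := by rw [hvdef, sep, hψ0, add_zero]
  have hgr : graph v p' ∈ φ.symm.source := by
    rw [graph, hval]; exact hmem _ hfa
  have htd : tderiv v p' = α := by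
    rw [hvdef, tderiv_sep]; exact deriv_trial_self _ _ _ le_rfl _
  have hjet : xjet v p' = fun j => iteratedDeriv j f p'.2 := funext fun j => xjet_sep hψ0 j
  obtain ⟨u, hu⟩ := h.symm.exists_transformsAt hr hgr hvs.contDiffAt
  obtain ⟨hT, hbase⟩ := hu.symm h.symm.diffeo
  rw [OpenPartialHomeomorph.symm_symm] at hT hbase
  set p := base (φ.symm (graph v p')) with hp
  have hsat : SatisfiesAt r κ' v p' := by rw [satisfiesAt_iff, htd, hjet]
  have hsat' : SatisfiesAt r κ u p := (h.symm.maps v u p' hu).1 hsat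
  rw [satisfiesAt_iff] at hsat'
  have hd := defect_explicit hV.isOpen_times hpar hexp hT (κ p)
  rw [hbase, hsat', sub_self, mul_zero, htd, hjet] at hd
  -- The preimage of (p', f p'.2) need not be z, but global injectivity of the (t, x)-part of the
  -- transformation puts it over the same base point.
  have hpz : p = base z := by
    refine base_eq_of_base_pointMap_eq hV hpar (φ.map_target hgr) hz ?_
    rw [← hexp (φ.map_target hgr), ← hexp hz, φ.right_inv hgr]
    rfl
  rw [hpz] at hd
  linarith

end

section

variable {r : ℕ} {φ : OpenPartialHomeomorph Var Var} {κ κ' : ℝ × ℝ → Kappa r}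
  {T X1 X0 : ℝ → ℝ}

/-! ### Existence of the explicit transformations -/

/-- Taking W ∩ g⁻¹(s) as target makes its openness a consequence of continuity of g, so the image of
s need not be described. -/
theorem exists_diffeo {E : Type*} [NormedAddCommGroup E] [NormedSpace ℝ E] {f g : E → E}
    {s W : Set E} (hs : IsOpen s) (hW : IsOpen W) (hf : ContDiffOn ℝ ∞ f s)
    (hg : ContDiffOn ℝ ∞ g W) (hfW : Set.MapsTo f s W) (hgf : ∀ x ∈ s, g (f x) = x)
    (hfg : ∀ y ∈ W, f (g y) = y) :
    ∃ e : OpenPartialHomeomorph E E, e.source = s ∧ (e : E → E) = f ∧ IsDiffeo e := by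
  refine ⟨
    { toFun := f
      invFun := g
      source := s
      target := W ∩ g ⁻¹' s
      map_source' := fun x hx => ⟨hfW hx, by rw [Set.mem_preimage, hgf x hx]; exact hx⟩
      map_target' := fun y hy => hy.2
      left_inv' := hgf
      right_inv' := fun y hy => hfg y hy.1
      open_source := hs
      open_target := hg.continuousOn.isOpen_inter_preimage hW hs
      continuousOn_toFun := hf.continuousOn
      continuousOn_invFun := hg.continuousOn.mono Set.inter_subset_left }, rfl, rfl,
    hf, hg.mono Set.inter_subset_left⟩

/-- A function with nonvanishing derivative on an open interval has a smooth inverse. -/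
theorem exists_smooth_inverse {I : Set ℝ} (hI : IsOpen I) (hT : ContDiffOn ℝ ∞ T I)
    (hT' : ∀ t ∈ I, deriv T t ≠ 0) (hinj : Set.InjOn T I) :
    ∃ S : ℝ → ℝ, IsOpen (T '' I) ∧ ContDiffOn ℝ ∞ S (T '' I) ∧ ∀ t ∈ I, S (T t) = t := by
  set S := Function.invFunOn T I
  have hS : ∀ t ∈ I, S (T t) = t := hinj.leftInvOn_invFunOn
  have hst : ∀ t ∈ I, HasStrictDerivAt T (deriv T t) t := fun t ht =>
    ((hT t ht).contDiffAt (hI.mem_nhds ht)).hasStrictDerivAt (by simp)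
  refine ⟨S, ?_, ?_, hS⟩
  · rw [isOpen_iff_mem_nhds]
    rintro _ ⟨t, ht, rfl⟩
    rw [← (hst t ht).map_nhds_eq (hT' t ht)]
    exact image_mem_map (hI.mem_nhds ht)
  · rintro _ ⟨t, ht, rfl⟩
    have hc := (hT t ht).contDiffAt (hI.mem_nhds ht)
    have hd : HasFDerivAt T ((ContinuousLinearEquiv.unitsEquivAut ℝ (Units.mk0 _ (hT' t ht)) :
        ℝ ≃L[ℝ] ℝ) : ℝ →L[ℝ] ℝ) t := (hst t ht).hasDerivAt.hasFDerivAt_equiv (hT' t ht)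
    have hloc := hc.to_localInverse hd (by simp)
    -- The global inverse is a choice function; by injectivity it agrees near T t with the smooth
    -- local inverse.
    have heq : S =ᶠ[𝓝 (T t)] hc.localInverse hd (by simp) := by
      rw [← (hst t ht).map_nhds_eq (hT' t ht)]
      refine eventually_map.2 ?_
      filter_upwards [hI.mem_nhds ht, (hc.toOpenPartialHomeomorph T hd
        (by simp)).eventually_left_inverse (hc.mem_toOpenPartialHomeomorph_source hd (by simp))]
        with s hs hs'
      rw [hS s hs]
      exact hs'.symm
    exact (hloc.congr_of_eventuallyEq heq).contDiffWithinAt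

theorem isOpen_regular (hr : 2 ≤ r) : IsOpen (regular r) := by
  have : regular r = {k | lead hr k ≠ 0} := by
    ext k
    refine ⟨fun h => lead_ne_zero hr h, fun h j hj => ?_⟩
    have : j = ⟨r, Finset.mem_Icc.2 ⟨hr, le_rfl⟩⟩ := Subtype.ext hj
    rw [this]; exact h
  rw [this]
  exact isOpen_ne.preimage (show Continuous fun k : Kappa r => lead hr k by
    unfold lead; fun_prop)

/-- The inverse of `pointMap`, in terms of the inverse `S` of `T`. -/
noncomputable def pointInv (T X1 X0 S : ℝ → ℝ) (z : Var) : Var :=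
  (S z.1, (z.2.1 - X0 (S z.1)) / X1 (S z.1),
    (deriv T (S z.1) * z.2.2 - deriv X1 (S z.1) * ((z.2.1 - X0 (S z.1)) / X1 (S z.1)) -
      deriv X0 (S z.1)) / X1 (S z.1))

/-- The inverse of `newKappa` at `p`. -/
noncomputable def oldKappa (r : ℕ) (T X1 X0 : ℝ → ℝ) (p : ℝ × ℝ) (k : Kappa r) : Kappa r :=
  (deriv T p.1 * k.1 - 2 * (deriv X1 p.1 / X1 p.1) + deriv (deriv T) p.1 / deriv T p.1,
    fun j => deriv T p.1 / X1 p.1 ^ (j : ℕ) * k.2.1 j,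
    (k.2.2 - 1 / deriv T p.1 * deriv (fun s => deriv X1 s / deriv T s) p.1 * p.2
      - 1 / deriv T p.1 * deriv (fun s => deriv X0 s / deriv T s) p.1
      + (deriv X1 p.1 / deriv T p.1 * p.2 + deriv X0 p.1 / deriv T p.1) * k.1) *
      (deriv T p.1 ^ 2 / X1 p.1))

theorem oldKappa_newKappa {p : ℝ × ℝ} (hT : deriv T p.1 ≠ 0) (hX : X1 p.1 ≠ 0) (k : Kappa r) :
    oldKappa r T X1 X0 p (newKappa r T X1 X0 p k) = k := by
  obtain ⟨a, A, b⟩ := k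
  refine Prod.ext ?_ (Prod.ext (funext fun j => ?_) ?_)
  · simp only [oldKappa, newKappa, newA0]; field_simp; ring
  · simp only [oldKappa, newKappa]; field_simp
  · simp only [oldKappa, newKappa]; field_simp; ring

theorem newKappa_oldKappa {p : ℝ × ℝ} (hT : deriv T p.1 ≠ 0) (hX : X1 p.1 ≠ 0) (k : Kappa r) :
    newKappa r T X1 X0 p (oldKappa r T X1 X0 p k) = k := by
  obtain ⟨a, A, b⟩ := k
  have h0 : newA0 T X1 p.1 (oldKappa r T X1 X0 p (a, A, b)).1 = a := by
    simp only [oldKappa, newA0]; field_simp; ring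
  refine Prod.ext h0 (Prod.ext (funext fun j => ?_) ?_)
  · simp only [oldKappa, newKappa]; field_simp
  · simp only [newKappa]
    rw [h0]
    simp only [oldKappa]; field_simp; ring

theorem pointInv_pointMap {S : ℝ → ℝ} {z : Var} (hS : S (T z.1) = z.1) (hT : deriv T z.1 ≠ 0)
    (hX : X1 z.1 ≠ 0) : pointInv T X1 X0 S (pointMap T X1 X0 z) = z := by
  obtain ⟨t, x, u⟩ := z
  simp only at hS hT hX
  simp only [pointInv, pointMap, hS]
  refine Prod.ext rfl (Prod.ext ?_ ?_)
  · simp only; field_simp; ring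
  · simp only; field_simp; ring

theorem pointMap_pointInv {S : ℝ → ℝ} {z : Var} (hS : T (S z.1) = z.1)
    (hT : deriv T (S z.1) ≠ 0) (hX : X1 (S z.1) ≠ 0) :
    pointMap T X1 X0 (pointInv T X1 X0 S z) = z := by
  obtain ⟨t, x, u⟩ := z
  simp only at hS hT hX
  simp only [pointInv, pointMap, hS]
  refine Prod.ext rfl (Prod.ext ?_ ?_)
  · simp only; field_simp; ring
  · simp only; field_simp; ring

/-! ### Smoothness of the explicit maps and of their inverses -/

section Smoothness

variable {I : Set ℝ} {E : Type*} [NormedAddCommGroup E] [NormedSpace ℝ E] {s : Set E}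

theorem contDiffOn_newKappa (hI : IsOpen I) (hpar : AreParameters I T X1 X0) {p : E → ℝ × ℝ}
    {k : E → Kappa r} (hp : ContDiffOn ℝ ∞ p s) (hpI : ∀ y ∈ s, (p y).1 ∈ I)
    (hk : ContDiffOn ℝ ∞ k s) : ContDiffOn ℝ ∞ (fun y => newKappa r T X1 X0 (p y) (k y)) s := by
  have hT := contDiffOn_deriv hI hpar.1
  have hTt := contDiffOn_deriv hI hT
  have hX1 := contDiffOn_deriv hI hpar.2.1
  have hX0 := contDiffOn_deriv hI hpar.2.2.1
  have hq1 := contDiffOn_deriv hI (hX1.div hT fun t ht => hpar.deriv_ne ht)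
  have hq0 := contDiffOn_deriv hI (hX0.div hT fun t ht => hpar.deriv_ne ht)
  have hp1 : ContDiffOn ℝ ∞ (fun y => (p y).1) s := hp.fst
  have hp2 : ContDiffOn ℝ ∞ (fun y => (p y).2) s := hp.snd
  have cT := hT.comp hp1 hpI
  have cTt := hTt.comp hp1 hpI
  have c1 := hpar.2.1.comp hp1 hpI
  have cX1 := hX1.comp hp1 hpI
  have cX0 := hX0.comp hp1 hpI
  have cq1 := hq1.comp hp1 hpI
  have cq0 := hq0.comp hp1 hpI
  have nT : ∀ y ∈ s, deriv T (p y).1 ≠ 0 := fun y hy => hpar.deriv_ne (hpI y hy)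
  have nX : ∀ y ∈ s, X1 (p y).1 ≠ 0 := fun y hy => hpar.ne (hpI y hy)
  have hA0 : ContDiffOn ℝ ∞ (fun y => newA0 T X1 (p y).1 (k y).1) s :=
    (contDiffOn_const.div cT nT).mul
      ((hk.fst.add (contDiffOn_const.mul (cX1.div c1 nX))).sub (cTt.div cT nT))
  refine hA0.prodMk (ContDiffOn.prodMk ?_ ?_)
  · refine contDiffOn_pi.2 fun j => ?_
    exact ((c1.pow j).div cT nT).mul (contDiffOn_pi.1 hk.snd.fst j)
  · exact (((c1.div (cT.pow 2) fun y hy => pow_ne_zero _ (nT y hy)).mul hk.snd.snd).add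
      (((contDiffOn_const.div cT nT).mul cq1).mul hp2)).add
      ((contDiffOn_const.div cT nT).mul cq0) |>.sub
      ((((cX1.div cT nT).mul hp2).add (cX0.div cT nT)).mul hA0)

theorem contDiffOn_oldKappa (hI : IsOpen I) (hpar : AreParameters I T X1 X0) {p : E → ℝ × ℝ}
    {k : E → Kappa r} (hp : ContDiffOn ℝ ∞ p s) (hpI : ∀ y ∈ s, (p y).1 ∈ I)
    (hk : ContDiffOn ℝ ∞ k s) : ContDiffOn ℝ ∞ (fun y => oldKappa r T X1 X0 (p y) (k y)) s := by
  have hT := contDiffOn_deriv hI hpar.1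
  have hTt := contDiffOn_deriv hI hT
  have hX1 := contDiffOn_deriv hI hpar.2.1
  have hX0 := contDiffOn_deriv hI hpar.2.2.1
  have hq1 := contDiffOn_deriv hI (hX1.div hT fun t ht => hpar.deriv_ne ht)
  have hq0 := contDiffOn_deriv hI (hX0.div hT fun t ht => hpar.deriv_ne ht)
  have hp1 : ContDiffOn ℝ ∞ (fun y => (p y).1) s := hp.fst
  have hp2 : ContDiffOn ℝ ∞ (fun y => (p y).2) s := hp.snd
  have cT := hT.comp hp1 hpI
  have cTt := hTt.comp hp1 hpI
  have c1 := hpar.2.1.comp hp1 hpI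
  have cX1 := hX1.comp hp1 hpI
  have cX0 := hX0.comp hp1 hpI
  have cq1 := hq1.comp hp1 hpI
  have cq0 := hq0.comp hp1 hpI
  have nT : ∀ y ∈ s, deriv T (p y).1 ≠ 0 := fun y hy => hpar.deriv_ne (hpI y hy)
  have nX : ∀ y ∈ s, X1 (p y).1 ≠ 0 := fun y hy => hpar.ne (hpI y hy)
  refine ContDiffOn.prodMk ?_ (ContDiffOn.prodMk ?_ ?_)
  · exact ((cT.mul hk.fst).sub (contDiffOn_const.mul (cX1.div c1 nX))).add (cTt.div cT nT)
  · refine contDiffOn_pi.2 fun j => ?_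
    exact (cT.div (c1.pow j) fun y hy => pow_ne_zero _ (nX y hy)).mul
      (contDiffOn_pi.1 hk.snd.fst j)
  · exact (((hk.snd.snd.sub (((contDiffOn_const.div cT nT).mul cq1).mul hp2)).sub
      ((contDiffOn_const.div cT nT).mul cq0)).add
      ((((cX1.div cT nT).mul hp2).add (cX0.div cT nT)).mul hk.fst)).mul
      ((cT.pow 2).div c1 nX)

theorem contDiffOn_pointMap (hI : IsOpen I) (hpar : AreParameters I T X1 X0) {z : E → Var}
    (hz : ContDiffOn ℝ ∞ z s) (hzI : ∀ y ∈ s, (z y).1 ∈ I) :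
    ContDiffOn ℝ ∞ (fun y => pointMap T X1 X0 (z y)) s := by
  have h1 : ContDiffOn ℝ ∞ (fun y => (z y).1) s := hz.fst
  have cT := (contDiffOn_deriv hI hpar.1).comp h1 hzI
  have cX1 := (contDiffOn_deriv hI hpar.2.1).comp h1 hzI
  have cX0 := (contDiffOn_deriv hI hpar.2.2.1).comp h1 hzI
  have nT : ∀ y ∈ s, deriv T (z y).1 ≠ 0 := fun y hy => hpar.deriv_ne (hzI y hy)
  have c1 := hpar.2.1.comp h1 hzI
  exact (hpar.1.comp h1 hzI).prodMk (((c1.mul hz.snd.fst).add (hpar.2.2.1.comp h1 hzI)).prodMk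
    ((((c1.div cT nT).mul hz.snd.snd).add ((cX1.div cT nT).mul hz.snd.fst)).add (cX0.div cT nT)))

theorem contDiffOn_pointInv (hI : IsOpen I) (hpar : AreParameters I T X1 X0) {S : ℝ → ℝ}
    (hS : ContDiffOn ℝ ∞ S (T '' I)) (hSI : ∀ t ∈ T '' I, S t ∈ I) {z : E → Var}
    (hz : ContDiffOn ℝ ∞ z s) (hzI : ∀ y ∈ s, (z y).1 ∈ T '' I) :
    ContDiffOn ℝ ∞ (fun y => pointInv T X1 X0 S (z y)) s := by
  have h1 : ContDiffOn ℝ ∞ (fun y => S (z y).1) s := hS.comp hz.fst hzI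
  have hm : ∀ y ∈ s, S (z y).1 ∈ I := fun y hy => hSI _ (hzI y hy)
  have cT := (contDiffOn_deriv hI hpar.1).comp h1 hm
  have cX1 := (contDiffOn_deriv hI hpar.2.1).comp h1 hm
  have cX0 := (contDiffOn_deriv hI hpar.2.2.1).comp h1 hm
  have c1 := hpar.2.1.comp h1 hm
  have nX : ∀ y ∈ s, X1 (S (z y).1) ≠ 0 := fun y hy => hpar.ne (hm y hy)
  have hx := (hz.snd.fst.sub (hpar.2.2.1.comp h1 hm)).div c1 nX
  exact h1.prodMk (hx.prodMk ((((cT.mul hz.snd.snd).sub (cX1.mul hx)).sub cX0).div c1 nX))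

end Smoothness

/-- The data needed to invert the explicit transformations over a domain. -/
theorem IsDom.exists_inverse {V : Set Var} (hV : IsDom V)
    (hpar : AreParameters (times V) T X1 X0) :
    ∃ S : ℝ → ℝ, IsOpen (T '' times V) ∧ ContDiffOn ℝ ∞ S (T '' times V) ∧
      ∀ t ∈ times V, S (T t) = t :=
  exists_smooth_inverse hV.isOpen_times hpar.1 (fun _ ht => hpar.deriv_ne ht)
    (hpar.injOn hV.ordConnected_times)

theorem exists_pointTransformation {V : Set Var} (hV : IsDom V)
    (hpar : AreParameters (times V) T X1 X0) :
    ∃ φ : OpenPartialHomeomorph Var Var, φ.source = V ∧ (φ : Var → Var) = pointMap T X1 X0 ∧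
      IsPointTransformation φ := by
  obtain ⟨S, hTo, hS, hST⟩ := hV.exists_inverse hpar
  have hSI : ∀ t ∈ T '' times V, S t ∈ times V ∧ T (S t) = t := by
    rintro _ ⟨t, ht, rfl⟩
    rw [hST t ht]; exact ⟨ht, rfl⟩
  obtain ⟨φ, h1, h2, h3⟩ := exists_diffeo (f := pointMap T X1 X0) (g := pointInv T X1 X0 S)
    (s := V) (W := {z | z.1 ∈ T '' times V}) hV.1 (hTo.preimage continuous_fst)
    (contDiffOn_pointMap hV.isOpen_times hpar contDiffOn_id fun y hy => ⟨y, hy, rfl⟩)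
    (contDiffOn_pointInv hV.isOpen_times hpar hS (fun t ht => (hSI t ht).1) contDiffOn_id
      fun y hy => hy)
    (fun z hz => ⟨z.1, ⟨z, hz, rfl⟩, rfl⟩)
    (fun z hz => pointInv_pointMap (hST _ ⟨z, hz, rfl⟩) (hpar.deriv_ne ⟨z, hz, rfl⟩)
      (hpar.ne ⟨z, hz, rfl⟩))
    (fun z hz => pointMap_pointInv (hSI _ hz).2 (hpar.deriv_ne (hSI _ hz).1)
      (hpar.ne (hSI _ hz).1))
  exact ⟨φ, h1, h2, h3, by rw [h1]; exact hV⟩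

theorem exists_jointTransformation (hr : 2 ≤ r) {V : Set Var} (hV : IsDom V)
    (hpar : AreParameters (times V) T X1 X0) :
    ∃ Θ : OpenPartialHomeomorph (Var × Kappa r) (Var × Kappa r),
      Θ.source = V ×ˢ regular r ∧ (Θ : Var × Kappa r → Var × Kappa r) = explicitMap r T X1 X0 ∧
        IsDiffeo Θ := by
  obtain ⟨S, hTo, hS, hST⟩ := hV.exists_inverse hpar
  have hSI : ∀ t ∈ T '' times V, S t ∈ times V ∧ T (S t) = t := by
    rintro _ ⟨t, ht, rfl⟩
    rw [hST t ht]; exact ⟨ht, rfl⟩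
  have hI := hV.isOpen_times
  refine exists_diffeo (f := explicitMap r T X1 X0)
    (g := fun y => (pointInv T X1 X0 S y.1,
      oldKappa r T X1 X0 (base (pointInv T X1 X0 S y.1)) y.2))
    (W := {y | y.1.1 ∈ T '' times V}) (hV.1.prod (isOpen_regular hr))
    (hTo.preimage (continuous_fst.comp continuous_fst)) ?_ ?_ ?_ ?_ ?_
  · have hfst : ContDiffOn ℝ ∞ (fun y : Var × Kappa r => y.1) (V ×ˢ regular r) := contDiffOn_fst
    have hm : ∀ y ∈ V ×ˢ regular r, y.1.1 ∈ times V := fun y hy => ⟨y.1, hy.1, rfl⟩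
    exact (contDiffOn_pointMap hI hpar hfst hm).prodMk
      (contDiffOn_newKappa hI hpar (baseL.contDiff.comp_contDiffOn hfst) hm contDiffOn_snd)
  · have hp := contDiffOn_pointInv hI hpar hS (fun t ht => (hSI t ht).1)
      (s := {y : Var × Kappa r | y.1.1 ∈ T '' times V}) contDiffOn_fst fun y hy => hy
    exact hp.prodMk (contDiffOn_oldKappa hI hpar (baseL.contDiff.comp_contDiffOn hp)
      (fun y hy => (hSI _ hy).1) contDiffOn_snd)
  · exact fun y hy => ⟨y.1.1, ⟨y.1, hy.1, rfl⟩, rfl⟩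
  · rintro ⟨z, k⟩ ⟨hz, -⟩
    have ht : z.1 ∈ times V := ⟨z, hz, rfl⟩
    rw [explicitMap_eq]
    simp only [pointInv_pointMap (hST _ ht) (hpar.deriv_ne ht) (hpar.ne ht)]
    rw [oldKappa_newKappa (hpar.deriv_ne ht) (hpar.ne ht)]
  · rintro ⟨z, k⟩ hz
    have ht := (hSI _ hz).1
    rw [explicitMap_eq, pointMap_pointInv (hSI _ hz).2 (hpar.deriv_ne ht) (hpar.ne ht),
      newKappa_oldKappa (hpar.deriv_ne ht) (hpar.ne ht)]

theorem exists_newArbitraryElement {V : Set Var} (hV : IsDom V)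
    (hpar : AreParameters (times V) T X1 X0) (κ : ℝ × ℝ → Kappa r) :
    ∃ κ' : ℝ × ℝ → Kappa r, (IsArbitraryElement r (base '' V) κ →
        IsArbitraryElement r (base '' (pointMap T X1 X0 '' V)) κ') ∧
      ∀ z ∈ V, κ' (base (pointMap T X1 X0 z)) = newKappa r T X1 X0 (base z) (κ (base z)) := by
  obtain ⟨S, hTo, hS, hST⟩ := hV.exists_inverse hpar
  have hSI : ∀ t ∈ T '' times V, S t ∈ times V := by
    rintro _ ⟨t, ht, rfl⟩
    rw [hST t ht]; exact ht
  -- The (t, x)-part of `pointInv` does not involve u, so the value 0 is arbitrary.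
  set g : ℝ × ℝ → ℝ × ℝ := fun p => base (pointInv T X1 X0 S (p.1, p.2, 0)) with hg
  have hgz : ∀ z ∈ V, g (base (pointMap T X1 X0 z)) = base z := by
    intro z hz
    have ht : z.1 ∈ times V := ⟨z, hz, rfl⟩
    have := congrArg base (pointInv_pointMap (X0 := X0) (hST _ ht) (hpar.deriv_ne ht) (hpar.ne ht))
    exact this
  refine ⟨fun p => newKappa r T X1 X0 (g p) (κ (g p)), fun hκ => ⟨?_, ?_⟩, fun z hz => ?_⟩
  · have hgs : ContDiffOn ℝ ∞ g (base '' (pointMap T X1 X0 '' V)) := by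
      refine baseL.contDiff.comp_contDiffOn (contDiffOn_pointInv hV.isOpen_times hpar hS hSI
        (contDiffOn_fst.prodMk (contDiffOn_snd.prodMk contDiffOn_const)) ?_)
      rintro _ ⟨_, ⟨z, hz, rfl⟩, rfl⟩
      exact ⟨z.1, ⟨z, hz, rfl⟩, rfl⟩
    refine contDiffOn_newKappa hV.isOpen_times hpar hgs ?_ (hκ.1.comp hgs ?_)
    · rintro _ ⟨_, ⟨z, hz, rfl⟩, rfl⟩
      rw [hgz z hz]; exact ⟨z, hz, rfl⟩
    · rintro _ ⟨_, ⟨z, hz, rfl⟩, rfl⟩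
      rw [hgz z hz]; exact ⟨z, hz, rfl⟩
  · rintro _ ⟨_, ⟨z, hz, rfl⟩, rfl⟩
    simp only [hgz z hz]
    exact newKappa_mem_regular (hpar.2.2.2 _ ⟨z, hz, rfl⟩) (hκ.2 _ ⟨z, hz, rfl⟩)
  · simp only [hgz z hz]

theorem IsArbitraryElement.congr {Ω : Set (ℝ × ℝ)} (h : IsArbitraryElement r Ω κ)
    (he : ∀ p ∈ Ω, κ' p = κ p) : IsArbitraryElement r Ω κ' :=
  ⟨h.1.congr he, fun p hp => by rw [he p hp]; exact h.2 p hp⟩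

theorem IsDiffeo.congr {E : Type*} [NormedAddCommGroup E] [NormedSpace ℝ E]
    {f g : OpenPartialHomeomorph E E} (hf : IsDiffeo f) (h : f ≈ g) : IsDiffeo g := by
  refine ⟨?_, ?_⟩
  · rw [← h.1]; exact hf.1.congr fun x hx => (h.2 hx).symm
  · rw [← h.target_eq]
    exact hf.2.congr fun x hx => (h.symm_eqOn_target hx).symm

/-! ### The equivalence group -/

theorem nonempty_regular (r : ℕ) : (regular r).Nonempty := ⟨(0, 1, 0), fun _ _ => one_ne_zero⟩

theorem target_eq_of_eqOn {V : Set Var} (h : Set.EqOn φ (pointMap T X1 X0) φ.source)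
    (hV : φ.source = V) : φ.target = pointMap T X1 X0 '' V := by
  rw [← φ.image_source_eq_target, h.image_eq, hV]

theorem mem_usualEquivalenceGroup (hr : 2 ≤ r) {V : Set Var} (hV : IsDom V)
    (hpar : AreParameters (times V) T X1 X0)
    {Θ : OpenPartialHomeomorph (Var × Kappa r) (Var × Kappa r)}
    (hs : Θ.source = V ×ˢ regular r) (hΘ : Set.EqOn Θ (explicitMap r T X1 X0) Θ.source) :
    Θ ∈ usualEquivalenceGroup r := by
  obtain ⟨Θ₀, h1, h2, h3⟩ := exists_jointTransformation hr hV hpar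
  obtain ⟨φ, p1, p2, p3⟩ := exists_pointTransformation hV hpar
  have hexp : Set.EqOn φ (pointMap T X1 X0) φ.source := fun z _ => by rw [p2]
  have hval : ∀ z ∈ V, ∀ k ∈ regular r, Θ (z, k) =
      (pointMap T X1 X0 z, newKappa r T X1 X0 (base z) k) := fun z hz k hk =>
    hΘ (by rw [hs]; exact ⟨hz, hk⟩)
  refine ⟨h3.congr ⟨h1.trans hs.symm, fun y hy => ?_⟩, φ, p3, ⟨by rw [hs, p1], ?_⟩, ?_⟩
  · rw [h2]
    exact (hΘ (by rw [hs, ← h1]; exact hy)).symm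
  · rintro ⟨z, k⟩ hzk
    rw [hs] at hzk
    rw [hval z hzk.1 k hzk.2, p2]
  · intro κ hκ
    rw [p1] at hκ
    obtain ⟨κ', hκ', he⟩ := exists_newArbitraryElement hV hpar κ
    refine ⟨κ', ?_, ?_, ?_⟩
    · rw [target_eq_of_eqOn hexp p1]; exact hκ' hκ
    · intro z hz
      rw [p1] at hz
      rw [hval z hz _ (hκ.2 _ ⟨z, hz, rfl⟩), p2, he z hz]
    · refine mapsEquation_explicit (by rw [p1]; exact hV.isOpen_times) (by rw [p1]; exact hpar) hexp
        fun z hz => ?_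
      rw [p2]
      exact he z (p1 ▸ hz)

theorem IsPointTransformation.isAdmissible (h : IsPointTransformation φ)
    (hκ : IsArbitraryElement r (base '' φ.source) κ)
    (hκ' : IsArbitraryElement r (base '' φ.target) κ') (hm : MapsEquation r φ κ κ') :
    IsAdmissible r φ κ κ' := ⟨h.1, hκ.2, hκ'.2, hm⟩

/-- Every k in the regular set is the value of a constant tuple, and all constant tuples are
transformed by the same φ. One of them yields T, X¹, X⁰; applying `eq_newKappa` to the others
determines Θ at every (z, k). -/
theorem exists_parameters_of_mem (hr : 2 ≤ r)
    {Θ : OpenPartialHomeomorph (Var × Kappa r) (Var × Kappa r)} (h : Θ ∈ usualEquivalenceGroup r) :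
    ∃ V : Set Var, IsDom V ∧ Θ.source = V ×ˢ regular r ∧ ∃ T X1 X0 : ℝ → ℝ,
      AreParameters (times V) T X1 X0 ∧ Set.EqOn Θ (explicitMap r T X1 X0) Θ.source := by
  obtain ⟨-, φ, hφ, hproj, hcar⟩ := h
  have hconst : ∀ k ∈ regular r, ∃ κ', IsAdmissible r φ (fun _ => k) κ' ∧
      Carries r Θ φ (fun _ => k) κ' := by
    intro k hk
    have hκ : IsArbitraryElement r (base '' φ.source) fun _ => k :=
      ⟨contDiffOn_const, fun _ _ => hk⟩
    obtain ⟨κ', h1, h2, h3⟩ := hcar _ hκ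
    exact ⟨κ', hφ.isAdmissible hκ h1 h3, h2⟩
  obtain ⟨k₀, hk₀⟩ := nonempty_regular r
  obtain ⟨κ₀, hadm, -⟩ := hconst k₀ hk₀
  obtain ⟨T, X1, X0, hpar, hexp⟩ := hadm.exists_parameters hr hφ.2
  refine ⟨φ.source, hφ.2, hproj.1, T, X1, X0, hpar, ?_⟩
  rintro ⟨z, k⟩ hzk
  have hzk' := hzk
  rw [hproj.1] at hzk'
  obtain ⟨κ', hadm', hc⟩ := hconst k hzk'.2
  rw [explicitMap_eq]
  refine Prod.ext ?_ ?_
  · rw [hproj.2 _ hzk]; exact hexp hzk'.1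
  · exact (hc z hzk'.1).trans (hadm'.eq_newKappa hr hφ.2 hpar hexp hzk'.1)

/-- From left to right, the explicit form of Θ provides the new tuple and the mapping of equations.
From right to left, φ has the explicit form, its explicit extension to the arbitrary elements lies
in the group, and the target tuple is forced. -/
theorem isNormalized (hr : 2 ≤ r) : IsNormalized r := by
  ext ⟨κ, κ', φ⟩
  constructor
  · rintro ⟨hφ, hκ, Θ, hΘ, hproj, hcar⟩
    simp only at hφ hκ hproj hcar
    obtain ⟨V, hV, hs, T, X1, X0, hpar, hexp⟩ := exists_parameters_of_mem hr hΘ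
    -- The product with the nonempty regular set determines its first factor.
    have hVφ : φ.source = V := by
      have := hproj.1.symm.trans hs
      obtain ⟨k₀, hk₀⟩ := nonempty_regular r
      ext z
      have h2 := Set.ext_iff.1 this (z, k₀)
      simpa [hk₀] using h2
    have hval : ∀ z ∈ φ.source, ∀ k ∈ regular r, Θ (z, k) =
        (pointMap T X1 X0 z, newKappa r T X1 X0 (base z) k) := fun z hz k hk =>
      hexp (by rw [hproj.1]; exact ⟨hz, hk⟩)
    have hφexp : Set.EqOn φ (pointMap T X1 X0) φ.source := by
      intro z hz
      obtain ⟨k₀, hk₀⟩ := nonempty_regular r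
      have h1 := hproj.2 (z, k₀) (by rw [hproj.1]; exact ⟨hz, hk₀⟩)
      rw [hval z hz k₀ hk₀] at h1
      exact h1.symm
    have hnew : ∀ z ∈ φ.source, κ' (base (φ z)) = newKappa r T X1 X0 (base z) (κ (base z)) := by
      intro z hz
      have h1 := hcar z hz
      rw [hval z hz _ (hκ.2 _ ⟨z, hz, rfl⟩)] at h1
      exact h1.symm
    obtain ⟨κ'', hκ'', he⟩ := exists_newArbitraryElement hV hpar κ
    refine ⟨hφ, hκ, ?_, ?_⟩
    · simp only
      rw [hVφ] at hκ
      rw [target_eq_of_eqOn hφexp hVφ]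
      refine (hκ'' hκ).congr ?_
      rintro _ ⟨_, ⟨z, hz, rfl⟩, rfl⟩
      have hz' : z ∈ φ.source := by rw [hVφ]; exact hz
      rw [he z hz, ← hnew z hz', hφexp hz']
    · exact mapsEquation_explicit (by rw [hVφ]; exact hV.isOpen_times)
        (by rw [hVφ]; exact hpar) hφexp hnew
  · rintro ⟨hφ, hκ, hκ', hm⟩
    simp only at hφ hκ hκ' hm
    have hadm := hφ.isAdmissible hκ hκ' hm
    obtain ⟨T, X1, X0, hpar, hexp⟩ := hadm.exists_parameters hr hφ.2
    obtain ⟨Θ, h1, h2, -⟩ := exists_jointTransformation hr hφ.2 hpar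
    refine ⟨hφ, hκ, Θ, mem_usualEquivalenceGroup hr hφ.2 hpar h1 (fun y _ => by rw [h2]),
      ⟨h1, ?_⟩, ?_⟩
    · rintro ⟨z, k⟩ hzk
      rw [h1] at hzk
      rw [h2, explicitMap_eq]
      exact (hexp hzk.1).symm
    · intro z hz
      rw [h2, explicitMap_eq]
      exact (hadm.eq_newKappa hr hφ.2 hpar hexp hz).symm

end

end BurgersKdV

theorem mainTheorem3 (r : ℕ) (hr : 2 ≤ r) :
    BurgersKdV.IsNormalized r ∧
    (∀ Θ : OpenPartialHomeomorph (BurgersKdV.Var × BurgersKdV.Kappa r)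
        (BurgersKdV.Var × BurgersKdV.Kappa r),
      Θ ∈ BurgersKdV.usualEquivalenceGroup r ↔
        ∃ V : Set BurgersKdV.Var, BurgersKdV.IsDom V ∧
          Θ.source = V ×ˢ BurgersKdV.regular r ∧
          ∃ T X1 X0 : ℝ → ℝ, BurgersKdV.AreParameters (BurgersKdV.times V) T X1 X0 ∧
            Set.EqOn Θ (BurgersKdV.explicitMap r T X1 X0) Θ.source) ∧
    (∀ V : Set BurgersKdV.Var, BurgersKdV.IsDom V →
      ∀ T X1 X0 : ℝ → ℝ, BurgersKdV.AreParameters (BurgersKdV.times V) T X1 X0 →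
        ∃ Θ ∈ BurgersKdV.usualEquivalenceGroup r,
          Θ.source = V ×ˢ BurgersKdV.regular r ∧
            Set.EqOn Θ (BurgersKdV.explicitMap r T X1 X0) Θ.source) := by
  refine ⟨BurgersKdV.isNormalized hr, fun Θ => ⟨BurgersKdV.exists_parameters_of_mem hr, ?_⟩, ?_⟩
  · rintro ⟨V, hV, hs, T, X1, X0, hpar, hexp⟩
    exact BurgersKdV.mem_usualEquivalenceGroup hr hV hpar hs hexp
  · intro V hV T X1 X0 hpar
    obtain ⟨Θ, h1, h2, -⟩ := BurgersKdV.exists_jointTransformation hr hV hpar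
    have he : Set.EqOn Θ (BurgersKdV.explicitMap r T X1 X0) Θ.source := fun y _ => by rw [h2]
    exact ⟨Θ, BurgersKdV.mem_usualEquivalenceGroup hr hV hpar h1 he, h1, he⟩
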